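/- Let $Q\subset\mathbb{R}^2$ be a polygon that is a square, an isosceles right triangle, or an equilateral triangle, and label its sides by pairwise distinct symbols. A point mass moves with unit speed along straight lines inside $Q$ and is reflected at the sides by the mirror law (the angle of incidence equals the angle of reflection). Let $X$ be the set of pairs $(s,v)$ where $s$ is a point of $\partial Q$ that is not a vertex and $v$ is a unit vector at $s$ pointing into the interior of $Q$, and let $T$ be the billiard ball map, which sends $(s,v)$ to the next point of $\partial Q$ that the ball reaches together with its reflected direction there; $T$ is not defined at $(s,v)$ if that next point is a vertex. For $n\ge 1$ let $p(n)$ be the number of words of length $n$ that arise as the sequence of labels of the sides containing the footpoints of $x, Tx,\dots,T^{n-1}x$, where $x$ runs over all points of $X$ for which these are defined. Then the limit $$\lim_{n\to\infty}\frac{p(n)}{n^3}$$ exists, and it equals $\dfrac{4}{\pi^2}$ for the square, $\dfrac{2}{3\pi^2}$ for the isosceles right triangle (angles $\pi/2,\pi/4,\pi/4$), and $\dfrac{3}{4\pi^2}$ for the equilateral triangle. -/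

import Mathlib

open Filter Topology

namespace PolygonalBilliard

/-- The Euclidean plane. -/
abbrev Plane := EuclideanSpace ℝ (Fin 2)

/-- The direction vector of the `i`-th side, which joins vertex `i` to the cyclically next one. -/
def edgeVector {m : ℕ} (Q : Polygon Plane m) (i : Fin m) : Plane :=
  Q (finRotate m i) - Q i

/-- The `i`-th side without its two endpoints. -/
def openSide {m : ℕ} (Q : Polygon Plane m) (i : Fin m) : Set Plane :=
  openSegment ℝ (Q i) (Q (finRotate m i))

/-- The open region enclosed by a convex polygon. -/
def table {m : ℕ} (Q : Polygon Plane m) : Set Plane :=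
  interior (convexHull ℝ (Set.range Q.vertices))

/-- The phase space of the billiard ball map: a footpoint on a side (and not at a vertex),
with an inner pointing unit vector. -/
structure PhasePoint {m : ℕ} (Q : Polygon Plane m) where
  /-- the label of the side that contains the footpoint -/
  side : Fin m
  /-- the footpoint -/
  point : Plane
  /-- the direction of motion -/
  dir : Plane
  point_mem : point ∈ openSide Q side
  norm_dir : ‖dir‖ = 1
  inward : ∃ ε : ℝ, 0 < ε ∧ ∀ s ∈ Set.Ioo 0 ε, point + s • dir ∈ table Q

/-- The graph of the billiard ball map: the ball flies freely from the footpoint of `x`, through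
the interior of the table, until it reaches the boundary at the footpoint of `y`, and there its
direction is reflected in the side that it has hit. There is no such `y` if the ball runs into
a vertex. -/
def BilliardStep {m : ℕ} {Q : Polygon Plane m} (x y : PhasePoint Q) : Prop :=
  (∃ t : ℝ, 0 < t ∧ y.point = x.point + t • x.dir ∧
    ∀ s ∈ Set.Ioo 0 t, x.point + s • x.dir ∈ table Q) ∧
  y.dir = (Submodule.span ℝ {edgeVector Q y.side}).reflection x.dir

/-- The words of length `n` that arise as codes of orbits of the billiard ball map: the labels of
the sides that contain the footpoints of `x, T x, …, T^(n-1) x`, where `x` runs over the phase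
points for which these are defined. -/
def language {m : ℕ} (Q : Polygon Plane m) (n : ℕ) : Set (Fin n → Fin m) :=
  {w | ∃ γ : Fin n → PhasePoint Q,
    (∀ i j : Fin n, (j : ℕ) = (i : ℕ) + 1 → BilliardStep (γ i) (γ j)) ∧
    ∀ i, (γ i).side = w i}

/-- The complexity function: the number of words of length `n` in the language. -/
noncomputable def complexity {m : ℕ} (Q : Polygon Plane m) (n : ℕ) : ℕ :=
  (language Q n).ncard

/-- A square: four sides of the same nonzero length and four right angles. -/
def IsSquareTable (Q : Polygon Plane 4) : Prop :=
  ∃ a : ℝ, 0 < a ∧ ∀ i : Fin 4, dist (Q i) (Q (i + 1)) = a ∧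
    EuclideanGeometry.angle (Q i) (Q (i + 1)) (Q (i + 2)) = Real.pi / 2

/-- A triangle with angles `π/2, π/4, π/4`, in any labelling of the vertices. -/
def IsRightIsoscelesTable (Q : Polygon Plane 3) : Prop :=
  ∃ i : Fin 3, EuclideanGeometry.angle (Q (i + 2)) (Q i) (Q (i + 1)) = Real.pi / 2 ∧
    EuclideanGeometry.angle (Q i) (Q (i + 1)) (Q (i + 2)) = Real.pi / 4 ∧
    EuclideanGeometry.angle (Q (i + 1)) (Q (i + 2)) (Q i) = Real.pi / 4

/-- An equilateral triangle: three sides of the same nonzero length. -/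
def IsEquilateralTable (Q : Polygon Plane 3) : Prop :=
  ∃ a : ℝ, 0 < a ∧ ∀ i : Fin 3, dist (Q i) (Q (i + 1)) = a

end PolygonalBilliard

/-!
Unfold the billiard: instead of reflecting the ball, reflect the table in the side that is hit and
let the ball go on along a straight line. A line is recorded by an affine functional that vanishes
on it, and the functional by its values at the vertices of the current tile. Reflecting the tile is
a linear map of these values, and the line crosses a side when the values at its two endpoints have
opposite signs. So a word is the code of an orbit precisely when some vector of vertex values has
the right signs along the corresponding fold (`Realises.image_language`). This leaves one
combinatorial object for each of the three tables, an `UnfoldingModel`; the size and the position of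
the polygon no longer matter.

The lines with a given code form a convex open set. When such a set of lines is prolonged backwards
by one tile, the number of sides that can be met is one more than the number of vertices that can be
met, because the vertices separate the sides. Hence the number of words of length `n + 1` exceeds
that of length `n` by the number, summed over the vertices `c`, of words of length `n` of lines from
`c`, and the same argument for the one-parameter families of lines through `c` shows that the latter
number grows by the number of generalized diagonals, that is, of unfolded segments from vertex to
vertex without a vertex inside (`ncard_words_top_succ`, `CornerData.ncard_words_vanishing`).

For these three tables the unfolded tiles fit into a tiling whose vertices lie on a lattice. In
suitable coordinates `X`, `Y` at a corner `c`, the generalized diagonals from `c` are the vectors to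
the coprime points of the positive quadrant, possibly without `(1, 1)`, and the number of tiles that
such a segment meets is, up to a bounded error, a height of its endpoint: `x + y` for the square,
`2 (x + y)` for the equilateral triangle, `x + y + max x y` at the right angle of the isosceles
triangle and `2 x + 3 y` or `3 x + 2 y` at its other angles. This is the content of `CornerData`,
established by walking along a line of slope `y / x` and keeping track of the cell in which the walk
is. Coprime pairs have density `6 / π ^ 2` by Möbius inversion (`tendsto_primitive`), which gives
the quadratic rate of the generalized diagonals at each corner, and the cubic rate of the number of
words is a third of the sum of these rates (`tendsto_words`).
-/

namespace PolygonalBilliard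

/-! ### Unfolded lines as vectors of values at the vertices -/

/-- The line on which an affine functional with the vertex values `F` vanishes crosses the open
side `i`, which joins the vertices `i` and `i + 1`. -/
def Crosses {m : ℕ} [NeZero m] (F : Fin m → ℝ) (i : Fin m) : Prop := F i * F (i + 1) < 0

/-- The vertex `v` is not an endpoint of the side `i`. -/
def OffSide {m : ℕ} [NeZero m] (v i : Fin m) : Prop := v ≠ i ∧ v ≠ i + 1

/-- A billiard table seen through affine functionals. An affine functional on the plane is recorded
by its values at the vertices of the current tile of the unfolding; `refl i` passes to the tile
reflected in side `i`. The fields from `aligned` on express that a line meets a convex tile in a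
segment: they describe the sides and vertices through which it can leave when it has entered through
side `i`, and `exit_card` does so for a convex family of lines which is open enough to be perturbed
off the vertices. -/
structure UnfoldingModel (m : ℕ) [NeZero m] where
  /-- the vertex values of affine functionals -/
  V : Submodule ℝ (Fin m → ℝ)
  /-- the vertex values in the tile reflected in a side -/
  refl : Fin m → (Fin m → ℝ) →ₗ[ℝ] (Fin m → ℝ)
  refl_mem : ∀ i, ∀ F ∈ V, refl i F ∈ V
  refl_refl : ∀ i F, refl i (refl i F) = F
  refl_left : ∀ i F, refl i F i = F i
  refl_right : ∀ i F, refl i F (i + 1) = F (i + 1)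
  one_mem : (fun _ => 1) ∈ V
  aligned : ∀ F ∈ V, ∀ G ∈ V, ∀ i j, Crosses F i → Crosses G i → Crosses F j → Crosses G j →
    0 < F i * G i → 0 < F j * G j
  exit_card : ∀ i, ∀ D ⊆ (V : Set (Fin m → ℝ)), D.Nonempty → Convex ℝ D →
    (∀ F ∈ D, 0 < F i ∧ F (i + 1) < 0) →
    (∀ F ∈ D, ∀ v, OffSide v i → F v = 0 →
      ∃ G : Fin m → ℝ, G v ≠ 0 ∧ ∀ᶠ ε in 𝓝 (0 : ℝ), F + ε • G ∈ D) →
    {j | j ≠ i ∧ ∃ F ∈ D, Crosses F j}.ncard = 1 + {v | OffSide v i ∧ ∃ F ∈ D, F v = 0}.ncard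
  not_crosses : ∀ F ∈ V, ∀ i v j, Crosses F i → OffSide v i → F v = 0 → j ≠ i → ¬ Crosses F j
  exit_unique : ∀ F ∈ V, ∀ i j j', Crosses F i → j ≠ i → j' ≠ i → Crosses F j → Crosses F j' → j = j'
  zero_unique : ∀ F ∈ V, ∀ i v v', Crosses F i → OffSide v i → OffSide v' i →
    F v = 0 → F v' = 0 → v = v'
  exists_exit : ∀ F ∈ V, ∀ i, Crosses F i → (∀ v, OffSide v i → F v ≠ 0) → ∃ j, j ≠ i ∧ Crosses F j

lemma Crosses.smul {m : ℕ} [NeZero m] {F : Fin m → ℝ} {i : Fin m} (h : Crosses F i) {t : ℝ}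
    (ht : t ≠ 0) : Crosses (t • F) i := by
  unfold Crosses at *
  have : 0 < t * t := mul_self_pos.mpr ht
  simp only [Pi.smul_apply, smul_eq_mul]
  nlinarith

lemma Crosses.convex {m : ℕ} [NeZero m] {F G : Fin m → ℝ} {i : Fin m} (h : Crosses F i)
    (h' : Crosses G i) (hFG : 0 < F i * G i) {s t : ℝ} (hs : 0 ≤ s) (ht : 0 ≤ t)
    (hst : s + t = 1) : Crosses (s • F + t • G) i := by
  have key : ∀ a b : ℝ, 0 < a → 0 < b → 0 < s * a + t * b := fun a b ha hb => by
    rcases hs.eq_or_lt with rfl | hs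
    · have : t = 1 := by linarith
      subst this; linarith
    · positivity
  unfold Crosses at *
  simp only [Pi.add_apply, Pi.smul_apply, smul_eq_mul]
  rcases pos_and_pos_or_neg_and_neg_of_mul_pos hFG with ⟨ha, hb⟩ | ⟨ha, hb⟩
  · have hc : F (i + 1) < 0 := by nlinarith
    have hd : G (i + 1) < 0 := by nlinarith
    have e1 := key _ _ ha hb
    have e2 := key _ _ (neg_pos.2 hc) (neg_pos.2 hd)
    nlinarith
  · have hc : 0 < F (i + 1) := by nlinarith
    have hd : 0 < G (i + 1) := by nlinarith
    have e1 := key _ _ (neg_pos.2 ha) (neg_pos.2 hb)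
    have e2 := key _ _ hc hd
    nlinarith

namespace UnfoldingModel

variable {m : ℕ} [NeZero m] (M : UnfoldingModel m)

lemma crosses_refl {F : Fin m → ℝ} {i : Fin m} : Crosses (M.refl i F) i ↔ Crosses F i := by
  simp [Crosses, M.refl_left, M.refl_right]

/-- The vertex values in the tile that is reached by crossing the sides `w` one after the other. -/
def fold : List (Fin m) → (Fin m → ℝ) →ₗ[ℝ] (Fin m → ℝ)
  | [] => LinearMap.id
  | i :: w => (fold w).comp (M.refl i)

/-- The line given by the vertex values `F` crosses the unfolded sides `w`. -/
def Run : List (Fin m) → (Fin m → ℝ) → Prop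
  | [], _ => True
  | i :: w, F => Crosses F i ∧ Run w (M.refl i F)

@[simp] lemma fold_nil (F) : M.fold [] F = F := rfl
@[simp] lemma fold_cons (i w F) : M.fold (i :: w) F = M.fold w (M.refl i F) := rfl
@[simp] lemma run_nil (F) : M.Run [] F := trivial
@[simp] lemma run_cons (i w F) : M.Run (i :: w) F ↔ Crosses F i ∧ M.Run w (M.refl i F) := Iff.rfl

lemma fold_append (w w' F) : M.fold (w ++ w') F = M.fold w' (M.fold w F) := by
  induction w generalizing F with
  | nil => rfl
  | cons i w ih => simp [ih]

lemma run_append (w w' F) : M.Run (w ++ w') F ↔ M.Run w F ∧ M.Run w' (M.fold w F) := by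
  induction w generalizing F with
  | nil => simp
  | cons i w ih => simp [ih, and_assoc]

lemma fold_mem {F} (hF : F ∈ M.V) (w) : M.fold w F ∈ M.V := by
  induction w generalizing F with
  | nil => exact hF
  | cons i w ih => exact ih (M.refl_mem i F hF)

lemma fold_reverse (w F) : M.fold w.reverse (M.fold w F) = F := by
  induction w generalizing F with
  | nil => rfl
  | cons i w ih => simp [fold_append, ih, M.refl_refl]

/-- A line can be travelled backwards. -/
lemma Run.reverse {w F} (h : M.Run w F) : M.Run w.reverse (M.fold w F) := by
  induction w generalizing F with
  | nil => trivial
  | cons i w ih =>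
    simp only [List.reverse_cons, run_append, fold_cons, fold_reverse, run_cons, run_nil, and_true]
    exact ⟨ih h.2, M.crosses_refl.2 h.1⟩

variable {M}

lemma Run.smul {w F} (h : M.Run w F) {t : ℝ} (ht : t ≠ 0) : M.Run w (t • F) := by
  induction w generalizing F with
  | nil => trivial
  | cons i w ih => exact ⟨h.1.smul ht, by simpa using ih h.2⟩

lemma Run.neg {w F} (h : M.Run w F) : M.Run w (-F) := by
  simpa using h.smul (t := -1) (by norm_num)

/-- To cross given sides is an open condition. -/
lemma Run.eventually {w F} (h : M.Run w F) (G) : ∀ᶠ ε in 𝓝 (0 : ℝ), M.Run w (F + ε • G) := by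
  induction w generalizing F G with
  | nil => simp
  | cons i w ih =>
    have h1 : ∀ᶠ ε in 𝓝 (0 : ℝ), Crosses (F + ε • G) i := by
      have hc : Continuous fun ε : ℝ => (F + ε • G) i * (F + ε • G) (i + 1) := by
        simp only [Pi.add_apply, Pi.smul_apply, smul_eq_mul]; fun_prop
      refine hc.continuousAt.eventually_lt continuousAt_const ?_
      have h1 := h.1
      unfold Crosses at h1
      simpa using h1
    filter_upwards [h1, ih h.2 (M.refl i G)] with ε h1 h2
    exact ⟨h1, by simpa using h2⟩

/-- The lines which cross given sides and whose left and right endpoints agree form a convex set. -/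
lemma Run.convex {i w F G} (hw : (i :: w).IsChain (· ≠ ·)) (hF : F ∈ M.V) (hG : G ∈ M.V)
    (h : M.Run (i :: w) F) (h' : M.Run (i :: w) G) (hFG : 0 < F i * G i) {s t : ℝ} (hs : 0 ≤ s)
    (ht : 0 ≤ t) (hst : s + t = 1) : M.Run (i :: w) (s • F + t • G) := by
  have hc : Crosses (s • F + t • G) i := h.1.convex h'.1 hFG hs ht hst
  induction w generalizing i F G with
  | nil => exact ⟨hc, trivial⟩
  | cons j w ih =>
    rw [List.isChain_cons_cons] at hw
    have hj := M.aligned _ (M.refl_mem i F hF) _ (M.refl_mem i G hG) i j (M.crosses_refl.2 h.1)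
      (M.crosses_refl.2 h'.1) h.2.1 h'.2.1 (by simpa [M.refl_left] using hFG)
    have := ih hw.2 (M.refl_mem i F hF) (M.refl_mem i G hG) h.2 h'.2 hj
      (h.2.1.convex h'.2.1 hj hs ht hst)
    exact ⟨hc, by simpa using this⟩

/-! ### Counting words by their extensions -/

variable (M)

/-- The words of length `n` which end with a letter satisfying `P` and are followed by a line whose
vertex values in the last tile lie in `K`. -/
def words (K : Submodule ℝ (Fin m → ℝ)) (P : Fin m → Prop) (n : ℕ) : Set (List (Fin m)) :=
  {w | w.length = n ∧ w.IsChain (· ≠ ·) ∧ (∀ i ∈ w.getLast?, P i) ∧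
    ∃ F ∈ M.V, M.Run w F ∧ M.fold w F ∈ K}

/-- The words as in `words`, with a vertex of the first tile which does not lie on the first side
and through which one of the lines passes. -/
def contacts (K : Submodule ℝ (Fin m → ℝ)) (P : Fin m → Prop) (n : ℕ) :
    Set (List (Fin m) × Fin m) :=
  {x | x.1.length = n ∧ x.1.IsChain (· ≠ ·) ∧ (∀ i ∈ x.1.getLast?, P i) ∧
    (∀ i ∈ x.1.head?, OffSide x.2 i) ∧ ∃ F ∈ M.V, M.Run x.1 F ∧ M.fold x.1 F ∈ K ∧ F x.2 = 0}

lemma finite_words (K P n) : (M.words K P n).Finite :=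
  (List.finite_length_eq (Fin m) n).subset fun _ h => h.1

lemma finite_contacts (K P n) : (M.contacts K P n).Finite :=
  ((List.finite_length_eq (Fin m) n).prod Set.finite_univ).subset fun _ h => ⟨h.1, trivial⟩

variable {M}

/-- A word has one more extension to the left than there are vertices which a line with this word
can hit when it is prolonged backwards. -/
lemma ncard_extensions {K : Submodule ℝ (Fin m → ℝ)} {i w} (hw : (i :: w).IsChain (· ≠ ·))
    (hne : ∃ F ∈ M.V, M.Run (i :: w) F ∧ M.fold (i :: w) F ∈ K)
    (hK : ∀ v, OffSide v i → (∃ F ∈ M.V, M.Run (i :: w) F ∧ M.fold (i :: w) F ∈ K ∧ F v = 0) →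
      ∃ G ∈ M.V, M.fold (i :: w) G ∈ K ∧ G v ≠ 0) :
    {j | j ≠ i ∧ ∃ F ∈ M.V, M.Run (i :: w) F ∧ M.fold (i :: w) F ∈ K ∧ Crosses F j}.ncard =
      1 + {v | OffSide v i ∧
        ∃ F ∈ M.V, M.Run (i :: w) F ∧ M.fold (i :: w) F ∈ K ∧ F v = 0}.ncard := by
  set D : Set (Fin m → ℝ) :=
    {F | F ∈ M.V ∧ M.Run (i :: w) F ∧ M.fold (i :: w) F ∈ K ∧ 0 < F i} with hD
  -- a functional and its negative describe the same line
  have hsign : ∀ F ∈ M.V, M.Run (i :: w) F → M.fold (i :: w) F ∈ K → F ∈ D ∨ -F ∈ D := by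
    intro F hF hr hk
    have h0 : F i ≠ 0 := fun h => by simpa [Crosses, h] using hr.1
    rcases lt_or_gt_of_ne h0 with h | h
    · exact Or.inr ⟨M.V.neg_mem hF, hr.neg, by rw [map_neg]; exact K.neg_mem hk, by simpa using h⟩
    · exact Or.inl ⟨hF, hr, hk, h⟩
  have key := M.exit_card i D (fun F h => h.1) ?_ ?_ ?_ ?_
  · have e1 : {j | j ≠ i ∧ ∃ F ∈ M.V, M.Run (i :: w) F ∧ M.fold (i :: w) F ∈ K ∧ Crosses F j} =
        {j | j ≠ i ∧ ∃ F ∈ D, Crosses F j} := by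
      ext j
      constructor
      · rintro ⟨hj, F, hF, hr, hk, hc⟩
        rcases hsign F hF hr hk with h | h
        · exact ⟨hj, F, h, hc⟩
        · exact ⟨hj, -F, h, by simpa using hc.smul (t := -1) (by norm_num)⟩
      · rintro ⟨hj, F, h, hc⟩
        exact ⟨hj, F, h.1, h.2.1, h.2.2.1, hc⟩
    have e2 : {v | OffSide v i ∧
        ∃ F ∈ M.V, M.Run (i :: w) F ∧ M.fold (i :: w) F ∈ K ∧ F v = 0} =
        {v | OffSide v i ∧ ∃ F ∈ D, F v = 0} := by
      ext v
      constructor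
      · rintro ⟨hj, F, hF, hr, hk, hc⟩
        rcases hsign F hF hr hk with h | h
        · exact ⟨hj, F, h, hc⟩
        · exact ⟨hj, -F, h, by simpa using hc⟩
      · rintro ⟨hj, F, h, hc⟩
        exact ⟨hj, F, h.1, h.2.1, h.2.2.1, hc⟩
    rw [e1, e2, key]
  · obtain ⟨F, hF, hr, hk⟩ := hne
    rcases hsign F hF hr hk with h | h
    exacts [⟨_, h⟩, ⟨_, h⟩]
  · intro F hF G hG s t hs ht hst
    refine ⟨M.V.add_mem (M.V.smul_mem _ hF.1) (M.V.smul_mem _ hG.1),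
      Run.convex hw hF.1 hG.1 hF.2.1 hG.2.1 (mul_pos hF.2.2.2 hG.2.2.2) hs ht hst, ?_, ?_⟩
    · rw [map_add, map_smul, map_smul]
      exact K.add_mem (K.smul_mem _ hF.2.2.1) (K.smul_mem _ hG.2.2.1)
    · have := convex_Ioi (0 : ℝ) hF.2.2.2 hG.2.2.2 hs ht hst
      simpa using this
  · intro F hF
    have h1 := hF.2.1.1
    have h2 := hF.2.2.2
    unfold Crosses at h1
    exact ⟨h2, by nlinarith⟩
  · intro F hF v hv hz
    obtain ⟨G, hG, hk, hGv⟩ := hK v hv ⟨F, hF.1, hF.2.1, hF.2.2.1, hz⟩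
    refine ⟨G, hGv, ?_⟩
    have h3 : ∀ᶠ ε in 𝓝 (0 : ℝ), 0 < (F + ε • G) i := by
      have hc : Continuous fun ε : ℝ => (F + ε • G) i := by
        simp only [Pi.add_apply, Pi.smul_apply, smul_eq_mul]; fun_prop
      refine continuousAt_const.eventually_lt hc.continuousAt ?_
      simpa using hF.2.2.2
    filter_upwards [h3, hF.2.1.eventually G] with ε h3 h4
    refine ⟨M.V.add_mem hF.1 (M.V.smul_mem _ hG), h4, ?_, h3⟩
    rw [map_add, map_smul]
    exact K.add_mem hF.2.2.1 (K.smul_mem _ hk)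

/-- The number of words grows by the number of contacts. -/
lemma ncard_words_succ {K : Submodule ℝ (Fin m → ℝ)} {P n} (hn : 1 ≤ n)
    (hK : ∀ x ∈ M.contacts K P n, ∃ G ∈ M.V, M.fold x.1 G ∈ K ∧ G x.2 ≠ 0) :
    (M.words K P (n + 1)).ncard = (M.words K P n).ncard + (M.contacts K P n).ncard := by
  classical
  set A := (M.finite_words K P (n + 1)).toFinset
  set B := (M.finite_words K P n).toFinset
  set H := (M.finite_contacts K P n).toFinset
  have hA : (M.words K P (n + 1)).ncard = A.card := Set.ncard_eq_toFinset_card _ _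
  have hB : (M.words K P n).ncard = B.card := Set.ncard_eq_toFinset_card _ _
  have hH : (M.contacts K P n).ncard = H.card := Set.ncard_eq_toFinset_card _ _
  have mA : ∀ w, w ∈ A ↔ w ∈ M.words K P (n + 1) := fun w => Set.Finite.mem_toFinset _
  have mB : ∀ w, w ∈ B ↔ w ∈ M.words K P n := fun w => Set.Finite.mem_toFinset _
  have mH : ∀ w, w ∈ H ↔ w ∈ M.contacts K P n := fun w => Set.Finite.mem_toFinset _
  have fA : ∀ w ∈ A, w.tail ∈ B := by
    intro w hw
    rw [mA] at hw
    rw [mB]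
    obtain ⟨hl, hc, hp, F, hF, hr, hk⟩ := hw
    match w, hl with
    | j :: i :: w, hl =>
      rw [List.isChain_cons_cons] at hc
      exact ⟨by simpa using hl, hc.2, by simpa using hp, _, M.refl_mem j F hF, hr.2, hk⟩
    | [j], hl => simp at hl; omega
  have fH : ∀ x ∈ H, x.1 ∈ B := by
    intro x hx
    rw [mH] at hx
    rw [mB]
    obtain ⟨hl, hc, hp, _, F, hF, hr, hk, _⟩ := hx
    exact ⟨hl, hc, hp, F, hF, hr, hk⟩
  rw [hA, hB, hH, Finset.card_eq_sum_card_fiberwise fA, Finset.card_eq_sum_card_fiberwise fH,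
    Finset.card_eq_sum_ones B, ← Finset.sum_add_distrib]
  refine Finset.sum_congr rfl fun w hw => ?_
  rw [mB] at hw
  obtain ⟨hl, hc, hp, F, hF, hr, hk⟩ := hw
  match w, hl with
  | [], hl => simp at hl; omega
  | i :: w, hl =>
    have key := ncard_extensions (M := M) (K := K) hc ⟨F, hF, hr, hk⟩ (fun v hv ⟨F, hF, hr, hk, hz⟩ =>
      hK (i :: w, v) ⟨hl, hc, hp, by simpa using hv, F, hF, hr, hk, hz⟩)
    have e1 : (((A.filter fun x => x.tail = i :: w : Finset _)) : Set (List (Fin m))) =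
        (fun j => j :: i :: w) '' {j | j ≠ i ∧
          ∃ F ∈ M.V, M.Run (i :: w) F ∧ M.fold (i :: w) F ∈ K ∧ Crosses F j} := by
      ext x
      simp only [Finset.coe_filter, Set.mem_ofPred_eq, mA, Set.mem_image]
      constructor
      · rintro ⟨⟨hl', hc', hp', F, hF, hr, hk⟩, ht⟩
        match x, hl' with
        | j :: x, hl' =>
          simp only [List.tail_cons] at ht
          subst ht
          rw [List.isChain_cons_cons] at hc'
          exact ⟨j, ⟨hc'.1, _, M.refl_mem j F hF, hr.2, hk, M.crosses_refl.2 hr.1⟩, rfl⟩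
      · rintro ⟨j, ⟨hj, F, hF, hr, hk, hx⟩, rfl⟩
        refine ⟨⟨by simpa using hl, List.isChain_cons_cons.2 ⟨hj, hc⟩, by simpa using hp,
          M.refl j F, M.refl_mem j F hF, ⟨M.crosses_refl.2 hx, ?_⟩, ?_⟩, rfl⟩
        · rwa [M.refl_refl]
        · rwa [fold_cons, M.refl_refl]
    have e2 : (((H.filter fun x => x.1 = i :: w : Finset _)) : Set (List (Fin m) × Fin m)) =
        (fun v => (i :: w, v)) '' {v | OffSide v i ∧
          ∃ F ∈ M.V, M.Run (i :: w) F ∧ M.fold (i :: w) F ∈ K ∧ F v = 0} := by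
      ext x
      simp only [Finset.coe_filter, Set.mem_ofPred_eq, mH, Set.mem_image]
      constructor
      · rintro ⟨⟨hl', hc', hp', hv, F, hF, hr, hk, hz⟩, ht⟩
        obtain ⟨x, v⟩ := x
        simp only at ht
        subst ht
        exact ⟨v, ⟨by simpa using hv, F, hF, hr, hk, hz⟩, rfl⟩
      · rintro ⟨v, ⟨hv, F, hF, hr, hk, hz⟩, rfl⟩
        exact ⟨⟨hl, hc, hp, by simpa using hv, F, hF, hr, hk, hz⟩, rfl⟩
    rw [← Set.ncard_coe_finset, e1, ← Set.ncard_coe_finset (Finset.filter _ H), e2,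
      Set.ncard_image_of_injective _ (fun a b h => by simpa using h),
      Set.ncard_image_of_injective _ (fun a b h => by simpa using h), key]

end UnfoldingModel
end PolygonalBilliard

namespace PolygonalBilliard
namespace UnfoldingModel

variable {m : ℕ} [NeZero m] (M : UnfoldingModel m)

/-! ### Lines through vertices -/

/-- Vertex values of functionals which vanish at the vertex `c`. -/
def vanishing {k : ℕ} (c : Fin k) : Submodule ℝ (Fin k → ℝ) := LinearMap.ker (LinearMap.proj c)

lemma mem_vanishing {k : ℕ} {c : Fin k} {F : Fin k → ℝ} : F ∈ vanishing c ↔ F c = 0 := by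
  simp [vanishing]

/-- The line `F` starts at the vertex `c`, crosses the sides `w` and then meets the vertex `v`. -/
def Joins (c : Fin m) (F : Fin m → ℝ) (w : List (Fin m)) (v : Fin m) : Prop :=
  w.IsChain (· ≠ ·) ∧ (∀ i ∈ w.head?, OffSide c i) ∧ (∀ i ∈ w.getLast?, OffSide v i) ∧
    F ∈ M.V ∧ F c = 0 ∧ M.Run w F ∧ M.fold w F v = 0

/-- Generalized diagonals which start at the vertex `c` and cross exactly `n` sides. -/
def diagonals (c : Fin m) (n : ℕ) : Set (List (Fin m) × Fin m) :=
  {x | x.1.length = n ∧ ∃ F, M.Joins c F x.1 x.2}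

/-- Generalized diagonals which start at the vertex `c` and cross between `1` and `n` sides. -/
def diagonalsUpTo (c : Fin m) (n : ℕ) : Set (List (Fin m) × Fin m) :=
  {x | 1 ≤ x.1.length ∧ x.1.length ≤ n ∧ ∃ F, M.Joins c F x.1 x.2}

lemma isChain_ne_reverse {α : Type*} {w : List α} :
    w.reverse.IsChain (· ≠ ·) ↔ w.IsChain (· ≠ ·) := by
  rw [List.isChain_reverse]
  constructor <;> exact fun h => h.imp fun _ _ h => h.symm

lemma finite_diagonalsUpTo (c n) : (M.diagonalsUpTo c n).Finite :=
  ((List.finite_length_le (Fin m) n).prod Set.finite_univ).subset fun _ h => ⟨h.2.1, trivial⟩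

lemma ncard_diagonalsUpTo_succ (c n) : (M.diagonalsUpTo c (n + 1)).ncard =
    (M.diagonalsUpTo c n).ncard + (M.diagonals c (n + 1)).ncard := by
  have h : M.diagonalsUpTo c (n + 1) = M.diagonalsUpTo c n ∪ M.diagonals c (n + 1) := by
    ext x
    simp only [diagonalsUpTo, diagonals, Set.mem_union, Set.mem_ofPred_eq]
    constructor
    · rintro ⟨h1, h2, h3⟩
      rcases h2.lt_or_eq with h | h
      exacts [Or.inl ⟨h1, by omega, h3⟩, Or.inr ⟨h, h3⟩]
    · rintro (⟨h1, h2, h3⟩ | ⟨h1, h3⟩)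
      exacts [⟨h1, by omega, h3⟩, ⟨by omega, by omega, h3⟩]
  have hf := M.finite_diagonalsUpTo c (n + 1)
  rw [h] at hf ⊢
  refine Set.ncard_union_eq ?_ (hf.subset Set.subset_union_left) (hf.subset Set.subset_union_right)
  rw [Set.disjoint_left]
  rintro x ⟨-, h1, -⟩ ⟨h2, -⟩
  omega

/-- Reversing the time turns contacts of lines that end in the vertex `c` into generalized
diagonals that start there. -/
lemma ncard_contacts_vanishing (c n) :
    (M.contacts (vanishing c) (OffSide c) n).ncard = (M.diagonals c n).ncard := by
  have h : M.diagonals c n =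
      (fun x => (x.1.reverse, x.2)) '' M.contacts (vanishing c) (OffSide c) n := by
    ext ⟨w, v⟩
    simp only [diagonals, contacts, Joins, Set.mem_image, Set.mem_ofPred_eq, mem_vanishing,
      Prod.exists, Prod.mk.injEq]
    constructor
    · rintro ⟨hl, F, hc, hh, ht, hF, h0, hr, hv⟩
      refine ⟨w.reverse, v, ⟨by simpa using hl, isChain_ne_reverse.2 hc, by simpa using hh,
        by simpa using ht, M.fold w F, M.fold_mem hF w, hr.reverse, ?_, hv⟩, by simp, rfl⟩
      rwa [fold_reverse]
    · rintro ⟨w', v', ⟨hl, hc, hh, ht, F, hF, hr, h0, hv⟩, rfl, rfl⟩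
      refine ⟨by simpa using hl, M.fold w' F, isChain_ne_reverse.2 hc, by simpa using hh,
        by simpa using ht, M.fold_mem hF _, h0, hr.reverse, ?_⟩
      rwa [fold_reverse]
  rw [h, Set.ncard_image_of_injective]
  rintro ⟨a, b⟩ ⟨a', b'⟩ h
  simpa using h

/-- Reversing the time turns contacts into words of lines that end in a vertex. -/
lemma ncard_contacts_top (n) : (M.contacts ⊤ (fun _ => True) n).ncard =
    ∑ c, (M.words (vanishing c) (OffSide c) n).ncard := by
  classical
  set H := (M.finite_contacts ⊤ (fun _ => True) n).toFinset with hH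
  rw [Set.ncard_eq_toFinset_card _ (M.finite_contacts ⊤ (fun _ => True) n),
    Finset.card_eq_sum_card_fiberwise (f := Prod.snd) (t := Finset.univ) (by simp)]
  refine Finset.sum_congr rfl fun c _ => ?_
  have h : ((H.filter fun x => x.2 = c : Finset _) : Set (List (Fin m) × Fin m)) =
      (fun w => (w.reverse, c)) '' M.words (vanishing c) (OffSide c) n := by
    ext ⟨w, v⟩
    simp only [Finset.coe_filter, hH, Set.Finite.mem_toFinset, words, contacts, Set.mem_image,
      Set.mem_ofPred_eq, mem_vanishing, Prod.mk.injEq]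
    constructor
    · rintro ⟨⟨hl, hc, -, hh, F, hF, hr, -, hv⟩, rfl⟩
      refine ⟨w.reverse, ⟨by simpa using hl, isChain_ne_reverse.2 hc, by simpa using hh,
        M.fold w F, M.fold_mem hF w, hr.reverse, ?_⟩, by simp, rfl⟩
      rwa [fold_reverse]
    · rintro ⟨w', ⟨hl, hc, hh, F, hF, hr, h0⟩, rfl, rfl⟩
      refine ⟨⟨by simpa using hl, isChain_ne_reverse.2 hc, by simp, by simpa using hh,
        M.fold w' F, M.fold_mem hF _, hr.reverse, trivial, h0⟩, rfl⟩
  rw [← Set.ncard_coe_finset, h, Set.ncard_image_of_injective]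
  intro a b h
  simpa using h

/-- The first difference of the number of words counts lines that end in a vertex. -/
lemma ncard_words_top_succ {n} (hn : 1 ≤ n) : (M.words ⊤ (fun _ => True) (n + 1)).ncard =
    (M.words ⊤ (fun _ => True) n).ncard + ∑ c, (M.words (vanishing c) (OffSide c) n).ncard := by
  rw [← ncard_contacts_top]
  exact ncard_words_succ hn fun x _ => ⟨_, M.one_mem, trivial, one_ne_zero⟩

/-! ### Generalized diagonals and coprime pairs -/

/-- Lattice coordinates for the lines through the vertex `c`. The vectors `X` and `Y` hold the
coordinates of the vertices of the first tile, so that the directions into this tile are those of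
the functionals `β Y - α X` with `α, β > 0`. The number of sides which the segment from `c` to the
lattice point `(x, y)` crosses is `h x y`, up to the error `C`. -/
structure CornerData (c : Fin m) (X Y : Fin m → ℝ) (h : ℕ → ℕ → ℕ) (C : ℕ) : Prop where
  X_mem : X ∈ M.V
  Y_mem : Y ∈ M.V
  X_zero : X c = 0
  Y_zero : Y c = 0
  repr : ∀ F ∈ M.V, F c = 0 → ∀ i, OffSide c i → Crosses F i →
    ∃ α β t : ℝ, 0 < α ∧ 0 < β ∧ t ≠ 0 ∧ F = t • (β • Y - α • X)
  start : ∀ α β : ℝ, 0 < α → 0 < β → α ≠ β → ∃ i, OffSide c i ∧ Crosses (β • Y - α • X) i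
  start_unique : ∀ F ∈ M.V, F c = 0 → ∀ i j, OffSide c i → OffSide c j → Crosses F i →
    Crosses F j → i = j
  hit : ∀ α β : ℝ, 0 < α → 0 < β → ∀ i w v, (i :: w).IsChain (· ≠ ·) → OffSide c i →
    M.Run (i :: w) (β • Y - α • X) → (∀ j ∈ (i :: w).getLast?, OffSide v j) →
    M.fold (i :: w) (β • Y - α • X) v = 0 →
    ∃ x y : ℕ, 0 < x ∧ 0 < y ∧ M.fold (i :: w) X v = x ∧ M.fold (i :: w) Y v = y ∧
      h x y ≤ (i :: w).length + C
  block : ∀ α β : ℝ, 0 < α → 0 < β → ∀ i w, (i :: w).IsChain (· ≠ ·) → OffSide c i →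
    M.Run (i :: w) (β • Y - α • X) → ∀ x y : ℕ, 0 < x → 0 < y → β * y = α * x →
    (i :: w).length ≤ h x y + C

/-- Coprime pairs of positive integers of height at most `N`. -/
def primitive (h : ℕ → ℕ → ℕ) (N : ℕ) : Set (ℕ × ℕ) :=
  {z | 0 < z.1 ∧ 0 < z.2 ∧ Nat.Coprime z.1 z.2 ∧ h z.1 z.2 ≤ N}

variable {M} {c : Fin m} {X Y : Fin m → ℝ} {h : ℕ → ℕ → ℕ} {C : ℕ}

lemma eq_of_run_of_zero {F} (hF : F ∈ M.V) {i w w' v v'} (hi : Crosses F i)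
    (hc : (i :: w).IsChain (· ≠ ·)) (hc' : (i :: w').IsChain (· ≠ ·))
    (hv : ∀ j ∈ (i :: w).getLast?, OffSide v j) (hv' : ∀ j ∈ (i :: w').getLast?, OffSide v' j)
    (hr : M.Run w F) (hr' : M.Run w' F) (h0 : M.fold w F v = 0) (h0' : M.fold w' F v' = 0) :
    w = w' ∧ v = v' := by
  induction w generalizing F i w' with
  | nil =>
    cases w' with
    | nil => exact ⟨rfl, M.zero_unique F hF i v v' hi (hv i rfl) (hv' i rfl) h0 h0'⟩
    | cons j w' =>
      rw [List.isChain_cons_cons] at hc'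
      exact absurd hr'.1 (M.not_crosses F hF i v j hi (hv i rfl) h0 hc'.1.symm)
  | cons k w ih =>
    rw [List.isChain_cons_cons] at hc
    cases w' with
    | nil => exact absurd hr.1 (M.not_crosses F hF i v' k hi (hv' i rfl) h0' hc.1.symm)
    | cons j w' =>
      rw [List.isChain_cons_cons] at hc'
      obtain rfl := M.exit_unique F hF i k j hi hc.1.symm hc'.1.symm hr.1 hr'.1
      rw [List.getLast?_cons_cons] at hv hv'
      obtain ⟨h1, h2⟩ := ih (M.refl_mem k F hF) (M.crosses_refl.2 hr.1) hc.2 hc'.2 hv hv' hr.2 hr'.2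
        h0 h0'
      exact ⟨by rw [h1], h2⟩

namespace CornerData

/-- A line through `c` determines the generalized diagonal along it. -/
lemma joins_unique (hD : M.CornerData c X Y h C) {F w w' v v'} (hw : w ≠ []) (hw' : w' ≠ [])
    (hJ : M.Joins c F w v) (hJ' : M.Joins c F w' v') : w = w' ∧ v = v' := by
  obtain ⟨hc, hh, ht, hF, h0, hr, hv⟩ := hJ
  obtain ⟨hc', hh', ht', _, _, hr', hv'⟩ := hJ'
  match w, w', hw, hw' with
  | i :: w, j :: w', _, _ =>
    obtain rfl := hD.start_unique F hF h0 i j (hh i rfl) (hh' j rfl) hr.1 hr'.1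
    obtain ⟨h1, h2⟩ := eq_of_run_of_zero (M.refl_mem i F hF) (M.crosses_refl.2 hr.1) hc hc' ht ht'
      hr.2 hr'.2 hv hv'
    exact ⟨by rw [h1], h2⟩

lemma mem_V (hD : M.CornerData c X Y h C) (a b : ℝ) : a • Y - b • X ∈ M.V :=
  M.V.sub_mem (M.V.smul_mem _ hD.Y_mem) (M.V.smul_mem _ hD.X_mem)

/-- A generalized diagonal leads from `c` to a lattice point in the cone of directions. -/
lemma exists_of_joins (hD : M.CornerData c X Y h C) {F w v} (hw : w ≠ []) (hJ : M.Joins c F w v) :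
    ∃ x y : ℕ, 0 < x ∧ 0 < y ∧ M.fold w X v = x ∧ M.fold w Y v = y ∧ h x y ≤ w.length + C ∧
      ∃ t : ℝ, t ≠ 0 ∧ F = t • ((x : ℝ) • Y - (y : ℝ) • X) := by
  obtain ⟨hc, hh, ht, hF, h0, hr, hv⟩ := hJ
  match w, hw with
  | i :: w, _ =>
    obtain ⟨α, β, t, hα, hβ, ht0, rfl⟩ := hD.repr F hF h0 i (hh i rfl) hr.1
    have hr' : M.Run (i :: w) (β • Y - α • X) := by
      simpa [smul_smul, ht0] using hr.smul (inv_ne_zero ht0)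
    have hv' : M.fold (i :: w) (β • Y - α • X) v = 0 := by
      rw [map_smul, Pi.smul_apply, smul_eq_mul] at hv
      exact (mul_eq_zero.1 hv).resolve_left ht0
    obtain ⟨x, y, hx, hy, hX, hY, hh'⟩ := hD.hit α β hα hβ i w v hc (hh i rfl) hr' ht hv'
    refine ⟨x, y, hx, hy, hX, hY, hh', t * (α / y), ?_, ?_⟩
    · have : (0 : ℝ) < y := by exact_mod_cast hy
      exact mul_ne_zero ht0 (by positivity)
    · have hy' : (y : ℝ) ≠ 0 := by exact_mod_cast hy.ne'
      rw [map_sub, map_smul, map_smul, Pi.sub_apply, Pi.smul_apply, Pi.smul_apply, hX, hY,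
        smul_eq_mul, smul_eq_mul] at hv'
      have hβ' : β = α / y * x := by field_simp; linarith
      rw [mul_smul, smul_sub (α / (y : ℝ)), smul_smul, smul_smul, ← hβ', div_mul_cancel₀ _ hy']

/-- Different generalized diagonals that start at `c` have different primitive directions. -/
lemma ncard_diagonalsUpTo_le (hD : M.CornerData c X Y h C)
    (hmono : ∀ g x y, 0 < g → h x y ≤ h (g * x) (g * y)) (hx : ∀ x y, x ≤ h x y)
    (hy : ∀ x y, y ≤ h x y) (N : ℕ) :
    (M.diagonalsUpTo c N).ncard ≤ (primitive h (N + C)).ncard := by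
  have key : ∀ p : List (Fin m) × Fin m, p ∈ M.diagonalsUpTo c N →
      ∃ z ∈ primitive h (N + C), M.Joins c ((z.1 : ℝ) • Y - (z.2 : ℝ) • X) p.1 p.2 := by
    rintro ⟨w, v⟩ ⟨h1, hN, F, hJ⟩
    have hw : w ≠ [] := by rintro rfl; simp at h1
    obtain ⟨x, y, hx, hy, hX, hY, hh, t, ht, rfl⟩ := hD.exists_of_joins hw hJ
    obtain ⟨g, x', y', hg, hco, rfl, rfl⟩ := Nat.exists_coprime' (Nat.gcd_pos_of_pos_left y hx)
    have hx' : 0 < x' := Nat.pos_of_ne_zero (by rintro rfl; simp at hx)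
    have hy' : 0 < y' := Nat.pos_of_ne_zero (by rintro rfl; simp at hy)
    have hg' : (g : ℝ) ≠ 0 := by exact_mod_cast hg.ne'
    have htg : t * g ≠ 0 := mul_ne_zero ht hg'
    have hF : t • (((x' * g : ℕ) : ℝ) • Y - ((y' * g : ℕ) : ℝ) • X) =
        (t * g) • ((x' : ℝ) • Y - (y' : ℝ) • X) := by
      push_cast
      module
    rw [hF] at hJ
    obtain ⟨hc, hh', ht', hF', h0, hr, hv⟩ := hJ
    refine ⟨(x', y'), ⟨hx', hy', hco, ?_⟩, hc, hh', ht', hD.mem_V _ _, ?_, ?_, ?_⟩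
    · have := hmono g x' y' hg
      rw [mul_comm g, mul_comm g] at this
      simp only at hN ⊢
      omega
    · simp [hD.X_zero, hD.Y_zero]
    · have := hr.smul (inv_ne_zero htg)
      rwa [smul_smul, inv_mul_cancel₀ htg, one_smul] at this
    · rw [map_smul, Pi.smul_apply, smul_eq_mul] at hv
      exact (mul_eq_zero.1 hv).resolve_left htg
  choose! f hf hf' using key
  refine Set.ncard_le_ncard_of_injOn f hf ?_ ?_
  · rintro ⟨w, v⟩ hp ⟨w', v'⟩ hp' he
    have h1 := hf' _ hp
    have h2 := hf' _ hp'
    rw [← he] at h2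
    have hw : w ≠ [] := by rintro rfl; simpa using hp.1
    have hw' : w' ≠ [] := by rintro rfl; simpa using hp'.1
    obtain ⟨rfl, rfl⟩ := hD.joins_unique hw hw' h1 h2
    rfl
  · refine ((Set.finite_Iic (N + C)).prod (Set.finite_Iic (N + C))).subset ?_
    rintro ⟨x, y⟩ ⟨_, _, _, hN⟩
    exact ⟨(hx x y).trans hN, (hy x y).trans hN⟩

/-- In a rational direction a line from `c` runs into a vertex. -/
lemma exists_joins (hD : M.CornerData c X Y h C) {x y : ℕ} (hx : 0 < x) (hy : 0 < y)
    (hxy : x ≠ y) : ∃ w v, w ≠ [] ∧ w.length ≤ h x y + C ∧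
      M.Joins c ((x : ℝ) • Y - (y : ℝ) • X) w v := by
  have hx' : (0 : ℝ) < x := by exact_mod_cast hx
  have hy' : (0 : ℝ) < y := by exact_mod_cast hy
  by_contra! hno
  -- without a vertex in its way the line crosses arbitrarily many sides
  have key : ∀ k, k ≤ h x y + C → ∃ i w, (i :: w).length = k + 1 ∧ (i :: w).IsChain (· ≠ ·) ∧
      OffSide c i ∧ M.Run (i :: w) ((x : ℝ) • Y - (y : ℝ) • X) := by
    intro k
    induction k with
    | zero =>
      intro _
      obtain ⟨i, hi, hc⟩ := hD.start y x hy' hx' (by exact_mod_cast hxy.symm)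
      exact ⟨i, [], rfl, List.isChain_singleton i, hi, hc, trivial⟩
    | succ k ih =>
      intro hk
      obtain ⟨i, w, hl, hc, hi, hr⟩ := ih (by omega)
      obtain ⟨w0, l, hw0⟩ := (List.eq_nil_or_concat' (i :: w)).resolve_left (by simp)
      have hlast : (i :: w).getLast? = some l := by rw [hw0]; simp
      have hmem := hD.mem_V (x : ℝ) (y : ℝ)
      have hcl : Crosses (M.fold (i :: w) ((x : ℝ) • Y - (y : ℝ) • X)) l := by
        rw [hw0, fold_append]
        rw [hw0, run_append] at hr
        exact M.crosses_refl.2 hr.2.1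
      obtain ⟨j, hj, hcj⟩ := M.exists_exit _ (M.fold_mem hmem (i :: w)) l hcl (by
        intro v hv h0
        refine hno (i :: w) v (by simp) (by omega) ⟨hc, ?_, ?_, hmem, ?_, hr, h0⟩
        · simpa using hi
        · rw [hlast]; simpa using hv
        · simp [hD.X_zero, hD.Y_zero])
      refine ⟨i, w ++ [j], by simpa using hl, ?_, hi, ?_⟩
      · rw [← List.cons_append, List.isChain_append]
        refine ⟨hc, List.isChain_singleton j, ?_⟩
        rw [hlast]
        simpa using hj.symm
      · rw [← List.cons_append, run_append]
        exact ⟨hr, hcj, trivial⟩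
  obtain ⟨i, w, hl, hc, hi, hr⟩ := key _ le_rfl
  have := hD.block y x hy' hx' i w hc hi hr x y hx hy (by ring)
  omega

/-- Every primitive direction at `c`, up to one, carries a generalized diagonal. -/
lemma ncard_primitive_le (hD : M.CornerData c X Y h C) (N : ℕ) :
    (primitive h N).ncard ≤ (M.diagonalsUpTo c (N + C)).ncard + 1 := by
  have key : ∀ z : ℕ × ℕ, z ∈ primitive h N \ {(1, 1)} → ∃ p ∈ M.diagonalsUpTo c (N + C),
      M.Joins c ((z.1 : ℝ) • Y - (z.2 : ℝ) • X) p.1 p.2 := by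
    rintro ⟨x, y⟩ ⟨⟨hx, hy, hco, hN⟩, h1⟩
    have hxy : x ≠ y := by
      rintro rfl
      simp only [Nat.coprime_self] at hco
      subst hco
      exact h1 rfl
    obtain ⟨w, v, hw, hl, hJ⟩ := hD.exists_joins hx hy hxy
    have := List.length_pos_iff.2 hw
    have hN' : h x y ≤ N := hN
    exact ⟨(w, v), ⟨this, by simp only; omega, _, hJ⟩, hJ⟩
  choose! f hf hf' using key
  have h2 : (primitive h N \ {(1, 1)}).ncard ≤ (M.diagonalsUpTo c (N + C)).ncard := by
    refine Set.ncard_le_ncard_of_injOn f hf ?_ (M.finite_diagonalsUpTo _ _)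
    rintro ⟨x, y⟩ hz ⟨x', y'⟩ hz' he
    have hne : (f (x, y)).1 ≠ [] := by
      have := (hf _ hz).1
      rintro h; simp [h] at this
    have h1 := hf' _ hz
    have h2 := hf' _ hz'
    rw [← he] at h2
    obtain ⟨a, b, ha, hb, hX, hY, -⟩ := hD.exists_of_joins hne h1
    have e1 := h1.2.2.2.2.2.2
    have e2 := h2.2.2.2.2.2.2
    simp only [map_sub, map_smul, Pi.sub_apply, Pi.smul_apply, hX, hY, smul_eq_mul] at e1 e2
    have e1' : x * b = y * a := by
      have : (x : ℝ) * b = y * a := by linarith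
      exact_mod_cast this
    have e2' : x' * b = y' * a := by
      have : (x' : ℝ) * b = y' * a := by linarith
      exact_mod_cast this
    -- both pairs are the primitive vector in the direction of `(a, b)`
    have e3 : x * y' = x' * y := by
      have : (x * y') * (a * b) = (x' * y) * (a * b) := by
        calc (x * y') * (a * b) = (x * b) * (y' * a) := by ring
          _ = (y * a) * (x' * b) := by rw [e1', e2']
          _ = _ := by ring
      exact Nat.eq_of_mul_eq_mul_right (Nat.mul_pos ha hb) this
    have hco : Nat.Coprime x y := hz.1.2.2.1
    have hco' : Nat.Coprime x' y' := hz'.1.2.2.1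
    have d1 : x ∣ x' := hco.dvd_of_dvd_mul_right ⟨y', e3.symm⟩
    have d2 : x' ∣ x := hco'.dvd_of_dvd_mul_right ⟨y, e3⟩
    obtain rfl := Nat.dvd_antisymm d1 d2
    have : y' = y := Nat.eq_of_mul_eq_mul_left hz.1.1 e3
    rw [this]
  have h3 := Set.ncard_le_ncard_sdiff_add_ncard (primitive h N) {(1, 1)}
  rw [Set.ncard_singleton] at h3
  omega

/-- The number of words of lines that end in `c`. -/
lemma ncard_words_vanishing (hD : M.CornerData c X Y h C) (n : ℕ) :
    (M.words (vanishing c) (OffSide c) (n + 1)).ncard =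
      (M.words (vanishing c) (OffSide c) 1).ncard + (M.diagonalsUpTo c n).ncard := by
  induction n with
  | zero =>
    have : M.diagonalsUpTo c 0 = ∅ := by
      ext x
      simp only [diagonalsUpTo, Set.mem_ofPred_eq, Set.mem_empty_iff_false, iff_false]
      rintro ⟨h1, h2, _⟩
      omega
    simp [this]
  | succ n ih =>
    rw [ncard_words_succ (by omega), ih, ncard_diagonalsUpTo_succ, ncard_contacts_vanishing,
      add_assoc]
    rintro ⟨w, v⟩ ⟨hl, hc, hp, hh, F, hF, hr, hk, hz⟩
    have hne : w.reverse ≠ [] := by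
      rintro h0
      simp only [List.reverse_eq_nil_iff] at h0
      simp [h0] at hl
    obtain ⟨x, y, hx, hy, hX, -⟩ := hD.exists_of_joins (w := w.reverse) (v := v)
      (F := M.fold w F) hne
      ⟨isChain_ne_reverse.2 hc, by simpa using hp, by simpa using hh, M.fold_mem hF w,
        mem_vanishing.1 hk, hr.reverse, by rwa [fold_reverse]⟩
    refine ⟨M.fold w.reverse X, M.fold_mem hD.X_mem _, ?_, ?_⟩
    · have := M.fold_reverse w.reverse X
      rw [List.reverse_reverse] at this
      simp only [this, mem_vanishing, hD.X_zero]
    · simp only [hX]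
      exact_mod_cast hx.ne'

end CornerData
end UnfoldingModel
end PolygonalBilliard

namespace PolygonalBilliard
namespace UnfoldingModel

/-! ### The models of triangles and of the square -/

section exits

variable {ι : Type*} {D : Set (ι → ℝ)}

/-- If a convex family of functionals has a member which is positive and one which is negative at
`v`, then it has one that vanishes there. -/
lemma exists_zero (hD : Convex ℝ D) {v : ι} {F G : ι → ℝ} (hF : F ∈ D) (hG : G ∈ D)
    (hFv : 0 < F v) (hGv : G v < 0) : ∃ H ∈ D, H v = 0 := by
  refine ⟨_, hD hF hG (a := -G v / (F v - G v)) (b := F v / (F v - G v)) ?_ ?_ ?_, ?_⟩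
  · exact div_nonneg (by linarith) (by linarith)
  · exact div_nonneg (by linarith) (by linarith)
  · rw [← add_div]
    exact (div_eq_one_iff_eq (by linarith)).2 (by ring)
  · simp only [Pi.add_apply, Pi.smul_apply, smul_eq_mul]
    ring

/-- A functional that vanishes at `v` and can be perturbed in an open family becomes positive and
negative at `v`, without changing the signs at another place. -/
lemma exists_pos_neg {F : ι → ℝ} {v u : ι} (hv : F v = 0)
    (h : ∃ G : ι → ℝ, G v ≠ 0 ∧ ∀ᶠ ε in 𝓝 (0 : ℝ), F + ε • G ∈ D) :
    (∃ H ∈ D, 0 < H v ∧ (F u < 0 → H u < 0)) ∧ ∃ H ∈ D, H v < 0 ∧ (0 < F u → 0 < H u) := by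
  obtain ⟨G, hG, hε⟩ := h
  have h1 : ∀ᶠ ε in 𝓝 (0 : ℝ), F u < 0 → (F + ε • G) u < 0 := by
    by_cases hu : F u < 0
    · have hc : Continuous fun ε : ℝ => (F + ε • G) u := by
        simp only [Pi.add_apply, Pi.smul_apply, smul_eq_mul]; fun_prop
      filter_upwards [hc.continuousAt.eventually_lt
        (continuousAt_const (y := (0 : ℝ))) (by simpa using hu)] with ε hε _ using hε
    · simp [hu]
  have h2 : ∀ᶠ ε in 𝓝 (0 : ℝ), 0 < F u → 0 < (F + ε • G) u := by
    by_cases hu : 0 < F u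
    · have hc : Continuous fun ε : ℝ => (F + ε • G) u := by
        simp only [Pi.add_apply, Pi.smul_apply, smul_eq_mul]; fun_prop
      filter_upwards [(continuousAt_const (y := (0 : ℝ))).eventually_lt hc.continuousAt
        (by simpa using hu)] with ε hε _ using hε
    · simp [hu]
  obtain ⟨δ, hδ, hball⟩ := Metric.eventually_nhds_iff.1 (hε.and (h1.and h2))
  have e1 := @hball (δ / 2) (by simp [abs_of_pos hδ]; linarith)
  have e2 := @hball (-(δ / 2)) (by simp [abs_of_pos hδ]; linarith)
  have hδ' : 0 < δ / 2 := by linarith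
  rcases lt_or_gt_of_ne hG with h | h
  · refine ⟨⟨_, e2.1, ?_, e2.2.1⟩, ⟨_, e1.1, ?_, e1.2.2⟩⟩
    · simp only [Pi.add_apply, Pi.smul_apply, smul_eq_mul, hv]; nlinarith
    · simp only [Pi.add_apply, Pi.smul_apply, smul_eq_mul, hv]; nlinarith
  · refine ⟨⟨_, e1.1, ?_, e1.2.1⟩, ⟨_, e2.1, ?_, e2.2.2⟩⟩
    · simp only [Pi.add_apply, Pi.smul_apply, smul_eq_mul, hv]; nlinarith
    · simp only [Pi.add_apply, Pi.smul_apply, smul_eq_mul, hv]; nlinarith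

end exits

lemma add_one_ne_fin3 (i : Fin 3) : i + 1 ≠ i := by revert i; decide

lemma add_two_ne_fin3 (i : Fin 3) : i + 2 ≠ i := by revert i; decide

lemma add_one_ne_add_two_fin3 (i : Fin 3) : i + 1 ≠ i + 2 := by revert i; decide

lemma add_one_add_one_fin3 (i : Fin 3) : i + 1 + 1 = i + 2 := by revert i; decide

lemma add_two_add_one_fin3 (i : Fin 3) : i + 2 + 1 = i := by revert i; decide

lemma fin3_cases {i j : Fin 3} (h : j ≠ i) : j = i + 1 ∨ j = i + 2 := by
  revert i j; decide

lemma offSide_fin3 {v i : Fin 3} : OffSide v i ↔ v = i + 2 := by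
  revert v i; unfold OffSide; decide

lemma crosses_succ_fin3 {F : Fin 3 → ℝ} {i : Fin 3} (h2 : F (i + 1) < 0) :
    Crosses F (i + 1) ↔ 0 < F (i + 2) := by
  have : i + 1 + 1 = i + 2 := add_one_add_one_fin3 i
  rw [Crosses, this]
  constructor <;> intro h <;> nlinarith

lemma crosses_add_two_fin3 {F : Fin 3 → ℝ} {i : Fin 3} (h1 : 0 < F i) :
    Crosses F (i + 2) ↔ F (i + 2) < 0 := by
  have : i + 2 + 1 = i := add_two_add_one_fin3 i
  rw [Crosses, this]
  constructor <;> intro h <;> nlinarith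

/-- In a triangle a line is split by the vertex opposite to the side through which it enters. -/
lemma exit_card_triangle (i : Fin 3) (D : Set (Fin 3 → ℝ)) (hne : D.Nonempty) (hD : Convex ℝ D)
    (hs : ∀ F ∈ D, 0 < F i ∧ F (i + 1) < 0)
    (hp : ∀ F ∈ D, ∀ v, OffSide v i → F v = 0 →
      ∃ G : Fin 3 → ℝ, G v ≠ 0 ∧ ∀ᶠ ε in 𝓝 (0 : ℝ), F + ε • G ∈ D) :
    {j | j ≠ i ∧ ∃ F ∈ D, Crosses F j}.ncard = 1 + {v | OffSide v i ∧ ∃ F ∈ D, F v = 0}.ncard := by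
  have i1 : i + 1 ≠ i := add_one_ne_fin3 i
  have i2 : i + 2 ≠ i := add_two_ne_fin3 i
  have i12 : i + 1 ≠ i + 2 := add_one_ne_add_two_fin3 i
  have hj1 : (∃ F ∈ D, Crosses F (i + 1)) ↔ ∃ F ∈ D, 0 < F (i + 2) :=
    exists_congr fun F => and_congr_right fun hF => crosses_succ_fin3 (hs F hF).2
  have hj2 : (∃ F ∈ D, Crosses F (i + 2)) ↔ ∃ F ∈ D, F (i + 2) < 0 :=
    exists_congr fun F => and_congr_right fun hF => crosses_add_two_fin3 (hs F hF).1
  by_cases h0 : ∃ F ∈ D, F (i + 2) = 0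
  · obtain ⟨F, hF, hz⟩ := h0
    obtain ⟨⟨G, hG, hGp, -⟩, ⟨H, hH, hHn, -⟩⟩ :=
      exists_pos_neg (u := i) hz (hp F hF (i + 2) (offSide_fin3.2 rfl) hz)
    have e1 : {j | j ≠ i ∧ ∃ F ∈ D, Crosses F j} = {i + 1, i + 2} := by
      ext j
      simp only [Set.mem_ofPred_eq, Set.mem_insert_iff, Set.mem_singleton_iff]
      refine ⟨fun h => fin3_cases h.1, ?_⟩
      rintro (rfl | rfl)
      exacts [⟨i1, hj1.2 ⟨G, hG, hGp⟩⟩, ⟨i2, hj2.2 ⟨H, hH, hHn⟩⟩]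
    have e2 : {v | OffSide v i ∧ ∃ F ∈ D, F v = 0} = {i + 2} := by
      ext v
      simp only [Set.mem_ofPred_eq, Set.mem_singleton_iff, offSide_fin3]
      refine ⟨fun h => h.1, ?_⟩
      rintro rfl
      exact ⟨rfl, F, hF, hz⟩
    rw [e1, e2, Set.ncard_pair i12, Set.ncard_singleton]
  · push Not at h0
    have e2 : {v | OffSide v i ∧ ∃ F ∈ D, F v = 0} = ∅ := by
      ext v
      simp only [Set.mem_ofPred_eq, Set.mem_empty_iff_false, iff_false, offSide_fin3]
      rintro ⟨rfl, F, hF, hz⟩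
      exact h0 F hF hz
    obtain ⟨F, hF⟩ := hne
    rcases lt_or_gt_of_ne (h0 F hF) with h | h
    · have e1 : {j | j ≠ i ∧ ∃ F ∈ D, Crosses F j} = {i + 2} := by
        ext j
        simp only [Set.mem_ofPred_eq, Set.mem_singleton_iff]
        constructor
        · rintro ⟨hj, hc⟩
          rcases fin3_cases hj with rfl | rfl
          · obtain ⟨G, hG, hGp⟩ := hj1.1 hc
            obtain ⟨H, hH, hz⟩ := exists_zero hD hG hF hGp h
            exact absurd hz (h0 H hH)
          · rfl
        · rintro rfl
          exact ⟨i2, hj2.2 ⟨F, hF, h⟩⟩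
      rw [e1, e2, Set.ncard_singleton, Set.ncard_empty]
    · have e1 : {j | j ≠ i ∧ ∃ F ∈ D, Crosses F j} = {i + 1} := by
        ext j
        simp only [Set.mem_ofPred_eq, Set.mem_singleton_iff]
        constructor
        · rintro ⟨hj, hc⟩
          rcases fin3_cases hj with rfl | rfl
          · rfl
          · obtain ⟨G, hG, hGp⟩ := hj2.1 hc
            obtain ⟨H, hH, hz⟩ := exists_zero hD hF hG h hGp
            exact absurd hz (h0 H hH)
        · rintro rfl
          exact ⟨i1, hj1.2 ⟨F, hF, h⟩⟩
      rw [e1, e2, Set.ncard_singleton, Set.ncard_empty]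

/-- The model of a triangle. Here `a i` are the coefficients of the reflected apex: the vertex
`i + 2` is reflected in the side `i` to the affine combination of the vertices with the
coefficients `a i`, `2 - a i` and `-1` at `i`, `i + 1` and `i + 2`. -/
def triangle (a : Fin 3 → ℝ) : UnfoldingModel 3 where
  V := ⊤
  refl i :=
    { toFun := fun F => Function.update F (i + 2) (a i * F i + (2 - a i) * F (i + 1) - F (i + 2))
      map_add' := fun F G => by
        ext v
        by_cases hv : v = i + 2
        · subst hv; simp; ring
        · simp [Function.update_of_ne hv]
      map_smul' := fun t F => by
        ext v
        by_cases hv : v = i + 2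
        · subst hv; simp; ring
        · simp [Function.update_of_ne hv] }
  refl_mem _ _ _ := trivial
  refl_refl i F := by
    ext v
    by_cases hv : v = i + 2
    · subst hv; simp
    · simp [Function.update_of_ne hv]
  refl_left i F := by simp
  refl_right i F := by simp
  one_mem := trivial
  aligned F _ G _ i j hFi hGi hFj hGj hFG := by
    by_cases hj : j = i
    · rwa [hj]
    have e1 : i + 1 + 1 = i + 2 := add_one_add_one_fin3 i
    have e2 : i + 2 + 1 = i := add_two_add_one_fin3 i
    unfold Crosses at *
    rcases fin3_cases hj with rfl | rfl
    · by_contra hn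
      rcases pos_and_pos_or_neg_and_neg_of_mul_pos hFG with ⟨h1, h2⟩ | ⟨h1, h2⟩
      · have h3 : F (i + 1) < 0 := by nlinarith
        have h4 : G (i + 1) < 0 := by nlinarith
        nlinarith
      · have h3 : 0 < F (i + 1) := by nlinarith
        have h4 : 0 < G (i + 1) := by nlinarith
        nlinarith
    · rw [e2] at hFj hGj
      rcases pos_and_pos_or_neg_and_neg_of_mul_pos hFG with ⟨h1, h2⟩ | ⟨h1, h2⟩
      · have h3 : F (i + 2) < 0 := by nlinarith
        have h4 : G (i + 2) < 0 := by nlinarith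
        nlinarith
      · have h3 : 0 < F (i + 2) := by nlinarith
        have h4 : 0 < G (i + 2) := by nlinarith
        nlinarith
  exit_card i D _ := exit_card_triangle i D
  not_crosses F _ i v j _ hv h0 hj := by
    obtain rfl := offSide_fin3.1 hv
    have e1 : i + 1 + 1 = i + 2 := add_one_add_one_fin3 i
    rcases fin3_cases hj with rfl | rfl
    · simp [Crosses, e1, h0]
    · simp [Crosses, h0]
  exit_unique F _ i j j' hi hj hj' hc hc' := by
    have e1 : i + 1 + 1 = i + 2 := add_one_add_one_fin3 i
    have e2 : i + 2 + 1 = i := add_two_add_one_fin3 i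
    have key : ¬ (Crosses F (i + 1) ∧ Crosses F (i + 2)) := by
      unfold Crosses at *
      rw [e1, e2]
      rintro ⟨h1, h2⟩
      have := mul_pos_of_neg_of_neg h1 h2
      nlinarith [mul_self_nonneg (F (i + 2))]
    rcases fin3_cases hj with rfl | rfl <;> rcases fin3_cases hj' with rfl | rfl
    exacts [rfl, absurd ⟨hc, hc'⟩ key, absurd ⟨hc', hc⟩ key, rfl]
  zero_unique F _ i v v' _ hv hv' _ _ := by
    rw [offSide_fin3.1 hv, offSide_fin3.1 hv']
  exists_exit F _ i hi h0 := by
    have h := h0 (i + 2) (offSide_fin3.2 rfl)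
    have e1 : i + 1 + 1 = i + 2 := add_one_add_one_fin3 i
    have e2 : i + 2 + 1 = i := add_two_add_one_fin3 i
    have i1 : i + 1 ≠ i := add_one_ne_fin3 i
    have i2 : i + 2 ≠ i := add_two_ne_fin3 i
    by_cases hp : F (i + 1) * F (i + 2) < 0
    · exact ⟨i + 1, i1, by rwa [Crosses, e1]⟩
    · refine ⟨i + 2, i2, ?_⟩
      rw [Crosses, e2]
      unfold Crosses at hi
      have hne : F (i + 1) ≠ 0 := fun h => by simp [h] at hi
      have hp' : 0 < F (i + 1) * F (i + 2) :=
        lt_of_le_of_ne (not_lt.1 hp) (mul_ne_zero hne h).symm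
      by_contra hn
      have := mul_neg_of_neg_of_pos hi hp'
      nlinarith [mul_self_nonneg (F (i + 1))]

lemma triangle_refl_apex (a : Fin 3 → ℝ) (i : Fin 3) (F : Fin 3 → ℝ) :
    (triangle a).refl i F (i + 2) = a i * F i + (2 - a i) * F (i + 1) - F (i + 2) := by
  simp [triangle]

end UnfoldingModel
end PolygonalBilliard

namespace PolygonalBilliard
namespace UnfoldingModel

lemma fin4_cases {i j : Fin 4} (h : j ≠ i) : j = i + 1 ∨ j = i + 2 ∨ j = i + 3 := by
  revert i j; decide

lemma ne_fin4 (i : Fin 4) : i + 1 ≠ i ∧ i + 2 ≠ i ∧ i + 3 ≠ i ∧ i + 1 ≠ i + 2 ∧ i + 1 ≠ i + 3 ∧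
    i + 2 ≠ i + 3 := by
  revert i; decide

lemma add_fin4 (i : Fin 4) : i + 1 + 1 = i + 2 ∧ i + 2 + 1 = i + 3 ∧ i + 3 + 1 = i := by
  revert i; decide

lemma offSide_fin4 {v i : Fin 4} : OffSide v i ↔ v = i + 2 ∨ v = i + 3 := by
  revert v i; unfold OffSide; decide

/-- The vertex values of affine functionals on a parallelogram. -/
def parallelogramValues : Submodule ℝ (Fin 4 → ℝ) where
  carrier := {F | F 0 + F 2 = F 1 + F 3}
  add_mem' {F G} hF hG := by
    simp only [Set.mem_ofPred_eq, Pi.add_apply] at *; linarith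
  zero_mem' := by simp
  smul_mem' t F hF := by
    simp only [Set.mem_ofPred_eq, Pi.smul_apply, smul_eq_mul] at *
    rw [← mul_add, ← mul_add, hF]

lemma mem_parallelogramValues {F : Fin 4 → ℝ} :
    F ∈ parallelogramValues ↔ F 0 + F 2 = F 1 + F 3 := Iff.rfl

lemma parallelogramValues_add_three {F : Fin 4 → ℝ} (hF : F ∈ parallelogramValues) (i : Fin 4) :
    F (i + 3) = F i - F (i + 1) + F (i + 2) := by
  rw [mem_parallelogramValues] at hF
  fin_cases i
  · change F 3 = F 0 - F 1 + F 2; linarith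
  · change F 0 = F 1 - F 2 + F 3; linarith
  · change F 1 = F 2 - F 3 + F 0; linarith
  · change F 2 = F 3 - F 0 + F 1; linarith

/-- In a square a line is split by both vertices opposite to the side through which it enters. -/
lemma exit_card_square (i : Fin 4) (D : Set (Fin 4 → ℝ))
    (hV : D ⊆ (parallelogramValues : Set (Fin 4 → ℝ))) (hne : D.Nonempty) (hD : Convex ℝ D)
    (hs : ∀ F ∈ D, 0 < F i ∧ F (i + 1) < 0)
    (hp : ∀ F ∈ D, ∀ v, OffSide v i → F v = 0 →
      ∃ G : Fin 4 → ℝ, G v ≠ 0 ∧ ∀ᶠ ε in 𝓝 (0 : ℝ), F + ε • G ∈ D) :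
    {j | j ≠ i ∧ ∃ F ∈ D, Crosses F j}.ncard = 1 + {v | OffSide v i ∧ ∃ F ∈ D, F v = 0}.ncard := by
  obtain ⟨i1, i2, i3, i12, i13, i23⟩ := ne_fin4 i
  obtain ⟨a1, a2, a3⟩ := add_fin4 i
  have hlt : ∀ F ∈ D, F (i + 2) < F (i + 3) := fun F hF => by
    have := parallelogramValues_add_three (hV hF) i
    have := hs F hF
    linarith
  have hj1 : (∃ F ∈ D, Crosses F (i + 1)) ↔ ∃ F ∈ D, 0 < F (i + 2) := by
    refine exists_congr fun F => and_congr_right fun hF => ?_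
    have := (hs F hF).2
    rw [Crosses, a1]
    constructor <;> intro h <;> nlinarith
  have hj2 : (∃ F ∈ D, Crosses F (i + 2)) ↔ ∃ F ∈ D, F (i + 2) < 0 ∧ 0 < F (i + 3) := by
    refine exists_congr fun F => and_congr_right fun hF => ?_
    have := hlt F hF
    rw [Crosses, a2]
    constructor
    · intro h
      rcases mul_neg_iff.1 h with h | h
      · linarith
      · exact h
    · exact fun h => mul_neg_of_neg_of_pos h.1 h.2
  have hj3 : (∃ F ∈ D, Crosses F (i + 3)) ↔ ∃ F ∈ D, F (i + 3) < 0 := by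
    refine exists_congr fun F => and_congr_right fun hF => ?_
    have := (hs F hF).1
    rw [Crosses, a3]
    constructor <;> intro h <;> nlinarith
  have hE : {j | j ≠ i ∧ ∃ F ∈ D, Crosses F j} = {j | j = i + 1 ∧ (∃ F ∈ D, 0 < F (i + 2)) ∨
      j = i + 2 ∧ (∃ F ∈ D, F (i + 2) < 0 ∧ 0 < F (i + 3)) ∨
      j = i + 3 ∧ ∃ F ∈ D, F (i + 3) < 0} := by
    ext j
    simp only [Set.mem_ofPred_eq]
    rw [← hj1, ← hj2, ← hj3]
    constructor
    · rintro ⟨hj, h⟩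
      rcases fin4_cases hj with rfl | rfl | rfl
      exacts [Or.inl ⟨rfl, h⟩, Or.inr (Or.inl ⟨rfl, h⟩), Or.inr (Or.inr ⟨rfl, h⟩)]
    · rintro (⟨rfl, h⟩ | ⟨rfl, h⟩ | ⟨rfl, h⟩)
      exacts [⟨i1, h⟩, ⟨i2, h⟩, ⟨i3, h⟩]
  have hH : {v | OffSide v i ∧ ∃ F ∈ D, F v = 0} = {v | v = i + 2 ∧ (∃ F ∈ D, F (i + 2) = 0) ∨
      v = i + 3 ∧ ∃ F ∈ D, F (i + 3) = 0} := by
    ext v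
    simp only [Set.mem_ofPred_eq, offSide_fin4]
    constructor
    · rintro ⟨rfl | rfl, h⟩
      exacts [Or.inl ⟨rfl, h⟩, Or.inr ⟨rfl, h⟩]
    · rintro (⟨rfl, h⟩ | ⟨rfl, h⟩)
      exacts [⟨Or.inl rfl, h⟩, ⟨Or.inr rfl, h⟩]
  have z1 : (∃ F ∈ D, F (i + 2) = 0) →
      (∃ F ∈ D, 0 < F (i + 2)) ∧ ∃ F ∈ D, F (i + 2) < 0 ∧ 0 < F (i + 3) := by
    rintro ⟨F, hF, hz⟩
    obtain ⟨⟨G, hG, hGp, -⟩, ⟨H, hH, hHn, hu⟩⟩ :=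
      exists_pos_neg (u := i + 3) hz (hp F hF _ (offSide_fin4.2 (Or.inl rfl)) hz)
    exact ⟨⟨G, hG, hGp⟩, ⟨H, hH, hHn, hu (by linarith [hlt F hF])⟩⟩
  have z2 : (∃ F ∈ D, F (i + 3) = 0) →
      (∃ F ∈ D, F (i + 3) < 0) ∧ ∃ F ∈ D, F (i + 2) < 0 ∧ 0 < F (i + 3) := by
    rintro ⟨F, hF, hz⟩
    obtain ⟨⟨H, hH, hHn, hu⟩, ⟨G, hG, hGp, -⟩⟩ :=
      exists_pos_neg (u := i + 2) hz (hp F hF _ (offSide_fin4.2 (Or.inr rfl)) hz)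
    exact ⟨⟨G, hG, hGp⟩, ⟨H, hH, hu (by linarith [hlt F hF]), hHn⟩⟩
  have n1 : (∃ F ∈ D, 0 < F (i + 2)) → (∃ F ∈ D, F (i + 2) < 0) → ∃ F ∈ D, F (i + 2) = 0 :=
    fun ⟨F, hF, h⟩ ⟨G, hG, h'⟩ => exists_zero hD hF hG h h'
  have n2 : (∃ F ∈ D, 0 < F (i + 3)) → (∃ F ∈ D, F (i + 3) < 0) → ∃ F ∈ D, F (i + 3) = 0 :=
    fun ⟨F, hF, h⟩ ⟨G, hG, h'⟩ => exists_zero hD hF hG h h'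
  have s12 : ({j | j = i + 1 ∨ j = i + 2} : Set (Fin 4)).ncard = 2 := Set.ncard_pair i12
  have s23 : ({j | j = i + 2 ∨ j = i + 3} : Set (Fin 4)).ncard = 2 := Set.ncard_pair i23
  have s123 : ({j | j = i + 1 ∨ j = i + 2 ∨ j = i + 3} : Set (Fin 4)).ncard = 3 := by
    rw [show ({j | j = i + 1 ∨ j = i + 2 ∨ j = i + 3} : Set (Fin 4)) = {i + 1, i + 2, i + 3} from
      rfl, Set.ncard_insert_of_notMem (by simp [i12, i13]), Set.ncard_pair i23]
  have s1 : ∀ k : Fin 4, ({j | j = k} : Set (Fin 4)).ncard = 1 := Set.ncard_singleton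
  have s0 : ({j | False} : Set (Fin 4)).ncard = 0 := Set.ncard_empty _
  rw [hE, hH]
  by_cases h1 : ∃ F ∈ D, F (i + 2) = 0 <;> by_cases h2 : ∃ F ∈ D, F (i + 3) = 0
  · simp only [h1, h2, z1 h1, z2 h2, and_true, s123, s23]
  · obtain ⟨F, hF, hF1, hF2⟩ := (z1 h1).2
    have : ¬ ∃ F ∈ D, F (i + 3) < 0 := fun h => h2 (n2 ⟨F, hF, hF2⟩ h)
    simp only [h1, h2, z1 h1, this, and_true, and_false, or_false, s12, s1]
  · obtain ⟨F, hF, hF1, hF2⟩ := (z2 h2).2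
    have : ¬ ∃ F ∈ D, 0 < F (i + 2) := fun h => h1 (n1 h ⟨F, hF, hF1⟩)
    simp only [h1, h2, z2 h2, this, and_true, and_false, false_or, s23, s1]
  · obtain ⟨F, hF⟩ := hne
    have hz1 : F (i + 2) ≠ 0 := fun h => h1 ⟨F, hF, h⟩
    have hz2 : F (i + 3) ≠ 0 := fun h => h2 ⟨F, hF, h⟩
    have hl := hlt F hF
    rcases lt_or_gt_of_ne hz1 with h3 | h3
    · have t1 : ¬ ∃ F ∈ D, 0 < F (i + 2) := fun h => h1 (n1 h ⟨F, hF, h3⟩)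
      rcases lt_or_gt_of_ne hz2 with h4 | h4
      · have t2 : ¬ ∃ F ∈ D, F (i + 2) < 0 ∧ 0 < F (i + 3) :=
          fun ⟨G, hG, _, h⟩ => h2 (n2 ⟨G, hG, h⟩ ⟨F, hF, h4⟩)
        have t3 : ∃ F ∈ D, F (i + 3) < 0 := ⟨F, hF, h4⟩
        simp only [h1, h2, t1, t2, t3, and_true, and_false, false_or, s1, s0]
      · have t2 : ∃ F ∈ D, F (i + 2) < 0 ∧ 0 < F (i + 3) := ⟨F, hF, h3, h4⟩
        have t3 : ¬ ∃ F ∈ D, F (i + 3) < 0 := fun h => h2 (n2 ⟨F, hF, h4⟩ h)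
        simp only [h1, h2, t1, t2, t3, and_true, and_false, false_or, or_false, s1, s0]
    · have t1 : ∃ F ∈ D, 0 < F (i + 2) := ⟨F, hF, h3⟩
      have t2 : ¬ ∃ F ∈ D, F (i + 2) < 0 ∧ 0 < F (i + 3) :=
        fun ⟨G, hG, h, _⟩ => h1 (n1 t1 ⟨G, hG, h⟩)
      have t3 : ¬ ∃ F ∈ D, F (i + 3) < 0 := fun h => h2 (n2 ⟨F, hF, by linarith⟩ h)
      simp only [h1, h2, t1, t2, t3, and_true, and_false, or_false, s1, s0]

/-- The model of a square. -/
def square : UnfoldingModel 4 where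
  V := parallelogramValues
  refl i :=
    { toFun := fun F v => if v = i + 2 then 2 * F (i + 1) - F (i + 2)
        else if v = i + 3 then 2 * F i - F (i + 3) else F v
      map_add' := fun F G => by
        ext v
        simp only [Pi.add_apply]
        split_ifs <;> ring
      map_smul' := fun t F => by
        ext v
        simp only [Pi.smul_apply, smul_eq_mul, RingHom.id_apply]
        split_ifs <;> ring }
  refl_mem i F hF := by
    rw [mem_parallelogramValues] at *
    fin_cases i <;> simp <;> linarith
  refl_refl i F := by
    obtain ⟨i1, i2, i3, i12, i13, i23⟩ := ne_fin4 i
    ext v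
    by_cases hv : v = i + 2
    · subst hv; simp [i13]
    · by_cases hv' : v = i + 3
      · subst hv'; simp [i23.symm]
      · simp [hv, hv']
  refl_left i F := by simp
  refl_right i F := by
    obtain ⟨i1, i2, i3, i12, i13, i23⟩ := ne_fin4 i
    simp [i13]
  one_mem := by rw [mem_parallelogramValues]
  aligned F hF G hG i j hFi hGi hFj hGj hFG := by
    by_cases hj : j = i
    · rwa [hj]
    have hf := parallelogramValues_add_three hF i
    have hg := parallelogramValues_add_three hG i
    obtain ⟨a1, a2, a3⟩ := add_fin4 i
    unfold Crosses at *
    rcases fin4_cases hj with rfl | rfl | rfl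
    · rcases pos_and_pos_or_neg_and_neg_of_mul_pos hFG with ⟨h1, h2⟩ | ⟨h1, h2⟩
      · have h3 : F (i + 1) < 0 := by nlinarith
        have h4 : G (i + 1) < 0 := by nlinarith
        nlinarith
      · have h3 : 0 < F (i + 1) := by nlinarith
        have h4 : 0 < G (i + 1) := by nlinarith
        nlinarith
    · rw [a2] at hFj hGj
      rcases pos_and_pos_or_neg_and_neg_of_mul_pos hFG with ⟨h1, h2⟩ | ⟨h1, h2⟩
      · have h3 : F (i + 1) < 0 := by nlinarith
        have h4 : G (i + 1) < 0 := by nlinarith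
        have h5 : F (i + 2) < 0 := by
          rcases mul_neg_iff.1 hFj with h | h <;> linarith
        have h6 : G (i + 2) < 0 := by
          rcases mul_neg_iff.1 hGj with h | h <;> linarith
        exact mul_pos_of_neg_of_neg h5 h6
      · have h3 : 0 < F (i + 1) := by nlinarith
        have h4 : 0 < G (i + 1) := by nlinarith
        have h5 : 0 < F (i + 2) := by
          rcases mul_neg_iff.1 hFj with h | h <;> linarith
        have h6 : 0 < G (i + 2) := by
          rcases mul_neg_iff.1 hGj with h | h <;> linarith
        exact mul_pos h5 h6
    · rw [a3] at hFj hGj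
      rcases pos_and_pos_or_neg_and_neg_of_mul_pos hFG with ⟨h1, h2⟩ | ⟨h1, h2⟩
      · have h3 : F (i + 3) < 0 := by nlinarith
        have h4 : G (i + 3) < 0 := by nlinarith
        exact mul_pos_of_neg_of_neg h3 h4
      · have h3 : 0 < F (i + 3) := by nlinarith
        have h4 : 0 < G (i + 3) := by nlinarith
        exact mul_pos h3 h4
  exit_card := exit_card_square
  not_crosses F hF i v j hi hv h0 hj hc := by
    have hf := parallelogramValues_add_three hF i
    obtain ⟨a1, a2, a3⟩ := add_fin4 i
    unfold Crosses at *
    rcases offSide_fin4.1 hv with rfl | rfl <;> rcases fin4_cases hj with rfl | rfl | rfl <;>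
      simp only [a1, a2, a3, h0, mul_zero, zero_mul, lt_irrefl] at hc
    · rw [h0] at hf
      rcases mul_neg_iff.1 hc with h | h <;> rcases mul_neg_iff.1 hi with h' | h' <;> linarith
    · rw [h0] at hf
      rcases mul_neg_iff.1 hc with h | h <;> rcases mul_neg_iff.1 hi with h' | h' <;> linarith
  exit_unique F hF i j j' hi hj hj' hc hc' := by
    have hf := parallelogramValues_add_three hF i
    obtain ⟨a1, a2, a3⟩ := add_fin4 i
    unfold Crosses at *
    rcases fin4_cases hj with rfl | rfl | rfl <;> rcases fin4_cases hj' with rfl | rfl | rfl <;>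
      first
      | rfl
      | exfalso
        simp only [a1, a2, a3] at hc hc'
        rcases mul_neg_iff.1 hc with h | h <;> rcases mul_neg_iff.1 hi with h' | h' <;>
          rcases mul_neg_iff.1 hc' with h'' | h'' <;> linarith
  zero_unique F hF i v v' hi hv hv' h0 h0' := by
    have hf := parallelogramValues_add_three hF i
    unfold Crosses at hi
    rcases offSide_fin4.1 hv with rfl | rfl <;> rcases offSide_fin4.1 hv' with rfl | rfl
    · rfl
    · exfalso
      rcases mul_neg_iff.1 hi with h' | h' <;> linarith
    · exfalso
      rcases mul_neg_iff.1 hi with h' | h' <;> linarith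
    · rfl
  exists_exit F hF i hi h0 := by
    have hf := parallelogramValues_add_three hF i
    obtain ⟨i1, i2, i3, i12, i13, i23⟩ := ne_fin4 i
    obtain ⟨a1, a2, a3⟩ := add_fin4 i
    have h2 := h0 (i + 2) (offSide_fin4.2 (Or.inl rfl))
    have h3 := h0 (i + 3) (offSide_fin4.2 (Or.inr rfl))
    have e1 (h : F (i + 1) * F (i + 2) < 0) : ∃ j, j ≠ i ∧ Crosses F j :=
      ⟨i + 1, i1, by rwa [Crosses, a1]⟩
    have e2 (h : F (i + 2) * F (i + 3) < 0) : ∃ j, j ≠ i ∧ Crosses F j :=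
      ⟨i + 2, i2, by rwa [Crosses, a2]⟩
    have e3 (h : F (i + 3) * F i < 0) : ∃ j, j ≠ i ∧ Crosses F j :=
      ⟨i + 3, i3, by rwa [Crosses, a3]⟩
    rcases mul_neg_iff.1 hi with h' | h' <;> rcases lt_or_gt_of_ne h2 with h4 | h4
    · rcases lt_or_gt_of_ne h3 with h5 | h5
      exacts [e3 (mul_neg_of_neg_of_pos h5 h'.1), e2 (mul_neg_of_neg_of_pos h4 h5)]
    · exact e1 (mul_neg_of_neg_of_pos h'.2 h4)
    · exact e1 (mul_neg_of_pos_of_neg h'.2 h4)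
    · rcases lt_or_gt_of_ne h3 with h5 | h5
      exacts [e2 (mul_neg_of_pos_of_neg h4 h5), e3 (mul_neg_of_pos_of_neg h5 h'.1)]

lemma square_refl (i v : Fin 4) (F : Fin 4 → ℝ) :
    square.refl i F v = if v = i + 2 then 2 * F (i + 1) - F (i + 2)
        else if v = i + 3 then 2 * F i - F (i + 3) else F v := rfl

end UnfoldingModel
end PolygonalBilliard

namespace PolygonalBilliard
namespace UnfoldingModel

/-! ### Following a line through the unfolding -/

/-- The induction along a line in the direction `(β, α)`: an invariant of the coordinate vectors of
the current tile, the number of crossings and the last side which has been crossed. -/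
lemma exists_invariant_of_run {m : ℕ} [NeZero m] (M : UnfoldingModel m) {α β : ℝ}
    {I : ℕ → (Fin m → ℝ) → (Fin m → ℝ) → Fin m → Prop}
    (hI : ∀ k X Y i j, I k X Y i → j ≠ i → Crosses (β • Y - α • X) j →
      I (k + 1) (M.refl j X) (M.refl j Y) j)
    {k X Y i w} (h : I k X Y i) (hw : (i :: w).IsChain (· ≠ ·)) (hr : M.Run w (β • Y - α • X)) :
    ∃ l, (i :: w).getLast? = some l ∧ I (k + w.length) (M.fold w X) (M.fold w Y) l := by
  induction w generalizing k X Y i with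
  | nil => exact ⟨i, rfl, h⟩
  | cons j w ih =>
    rw [List.isChain_cons_cons] at hw
    obtain ⟨l, hl, hIl⟩ := ih (hI k X Y i j h hw.1.symm hr.1) hw.2 (by simpa using hr.2)
    refine ⟨l, by rw [List.getLast?_cons_cons, hl], ?_⟩
    rwa [add_assoc, add_comm 1] at hIl

/-- The line through the origin in the direction `(β, α)` passes below the upper left and above
the lower right corner of the unit square with the lower left corner `(p, q)`, and its lattice
points in the open first quadrant lie beyond this square. -/
structure GridCell (α β : ℝ) (p q : ℤ) : Prop where
  nonneg_left : 0 ≤ p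
  nonneg_right : 0 ≤ q
  below : β * q < α * (p + 1)
  above : α * p < β * (q + 1)
  ahead : ∀ x y : ℤ, 0 < x → β * y = α * x → p + 1 ≤ x

namespace GridCell

variable {α β : ℝ} {p q : ℤ}

lemma zero (hα : 0 < α) (hβ : 0 < β) : GridCell α β 0 0 :=
  ⟨le_rfl, le_rfl, by simpa using hα, by simpa using hβ, fun x _ hx _ => by omega⟩

lemma right (h : GridCell α β p q) (hα : 0 < α) (hβ : 0 < β)
    (hr : α * (p + 1) < β * (q + 1)) : GridCell α β (p + 1) q := by
  refine ⟨by have := h.nonneg_left; omega, h.nonneg_right, ?_, ?_, fun x y hx hxy => ?_⟩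
  · have := h.below
    push_cast
    linarith
  · push_cast
    exact hr
  · have h1 := h.ahead x y hx hxy
    rcases h1.lt_or_eq with h2 | h2
    · omega
    · -- a lattice point on the line would lie strictly between `(p + 1, q)` and `(p + 1, q + 1)`
      exfalso
      have h3 : (x : ℝ) = p + 1 := by exact_mod_cast h2.symm
      rw [h3] at hxy
      have h4 : (q : ℝ) < y := lt_of_mul_lt_mul_left (hxy ▸ h.below) hβ.le
      have h5 : (y : ℝ) < q + 1 := lt_of_mul_lt_mul_left (hxy ▸ hr) hβ.le
      have h6 : q < y := by exact_mod_cast h4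
      have h7 : y < q + 1 := by exact_mod_cast h5
      omega

lemma up (h : GridCell α β p q) (hβ : 0 < β)
    (hu : β * (q + 1) < α * (p + 1)) : GridCell α β p (q + 1) := by
  refine ⟨h.nonneg_left, by have := h.nonneg_right; omega, ?_, ?_, h.ahead⟩
  · push_cast
    exact hu
  · have := h.above
    push_cast
    linarith

/-- The line has not yet passed its lattice points in the open first quadrant. -/
lemma lt_of_mem (h : GridCell α β p q) (hα : 0 < α) (hβ : 0 < β) {x y : ℕ} (hx : 0 < x)
    (hxy : β * y = α * x) : p + 1 ≤ x ∧ q + 1 ≤ y := by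
  have h1 : p + 1 ≤ x := h.ahead x y (by exact_mod_cast hx) (by exact_mod_cast hxy)
  refine ⟨h1, ?_⟩
  have h2 : (p : ℝ) + 1 ≤ x := by exact_mod_cast h1
  have h3 : β * q < β * y := by
    rw [hxy]
    exact h.below.trans_le (mul_le_mul_of_nonneg_left h2 hα.le)
  have h4 : (q : ℝ) < y := lt_of_mul_lt_mul_left h3 hβ.le
  have h5 : q < y := by exact_mod_cast h4
  omega

end GridCell

/-- The vertex `v` has the coordinates `(x, y)`. -/
def At {m : ℕ} (X Y : Fin m → ℝ) (v : Fin m) (x y : ℝ) : Prop := X v = x ∧ Y v = y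

lemma At.eval {m : ℕ} {X Y : Fin m → ℝ} {v : Fin m} {x y : ℝ} (h : At X Y v x y) (α β : ℝ) :
    (β • Y - α • X) v = β * y - α * x := by
  simp [h.1, h.2]

/-! ### Labels of a triangle -/

/-- The labels `l`, `r`, `t` are those of the three vertices of a triangle. The side opposite to
`t` is then `t + 1`. -/
def Distinct (l r t : Fin 3) : Prop := l ≠ r ∧ r ≠ t ∧ l ≠ t

lemma Distinct.swap {l r t} (h : Distinct l r t) : Distinct l t r := ⟨h.2.2, h.2.1.symm, h.1⟩

lemma Distinct.rotate {l r t} (h : Distinct l r t) : Distinct t r l :=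
  ⟨h.2.1.symm, h.1.symm, h.2.2.symm⟩

lemma add_one_add_two_fin3 (t : Fin 3) : t + 1 + 2 = t := by revert t; decide

lemma Distinct.eq_or {l r t} (h : Distinct l r t) :
    (l = t + 1 ∧ r = t + 1 + 1) ∨ (l = t + 1 + 1 ∧ r = t + 1) := by
  revert l r t; unfold Distinct; decide

lemma Distinct.crosses {l r t} (h : Distinct l r t) {F : Fin 3 → ℝ} :
    Crosses F (t + 1) ↔ F l * F r < 0 := by
  rcases h.eq_or with ⟨rfl, rfl⟩ | ⟨rfl, rfl⟩
  · rfl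
  · rw [Crosses, mul_comm]

lemma Distinct.side_cases {l r t j} (h : Distinct l r t) (hj : j ≠ t + 1) :
    j = l + 1 ∨ j = r + 1 := by
  revert l r t j; unfold Distinct; decide

lemma offSide_iff {v t : Fin 3} : OffSide v (t + 1) ↔ v = t := by
  revert v t; unfold OffSide; decide

lemma eq_of_offSide {c i : Fin 3} (h : OffSide c i) : i = c + 1 := by
  revert c i; unfold OffSide; decide

lemma fin3_eq_or (c v : Fin 3) : v = c ∨ v = c + 1 ∨ v = c + 2 := by revert v c; decide

lemma triangle_refl_of_ne {a : Fin 3 → ℝ} {t v : Fin 3} (hv : v ≠ t) (F : Fin 3 → ℝ) :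
    (triangle a).refl (t + 1) F v = F v := by
  simp [triangle, add_one_add_two_fin3, hv]

lemma At.triangle_refl {a : Fin 3 → ℝ} {X Y : Fin 3 → ℝ} {t v : Fin 3} {x y : ℝ}
    (h : At X Y v x y) (hv : v ≠ t) :
    At ((triangle a).refl (t + 1) X) ((triangle a).refl (t + 1) Y) v x y := by
  rwa [At, triangle_refl_of_ne hv, triangle_refl_of_ne hv]

/-- A line that has entered a triangle between the left vertex `l` and the right vertex `r` leaves
it to the left of the apex `t` or to the right of it. -/
lemma Distinct.exit_cases {l r t j} (h : Distinct l r t) {F : Fin 3 → ℝ} (hl : 0 < F l)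
    (hr : F r < 0) (hj : j ≠ t + 1) (hc : Crosses F j) :
    (j = l + 1 ∧ 0 < F t) ∨ (j = r + 1 ∧ F t < 0) := by
  rcases h.side_cases hj with rfl | rfl
  · left
    rw [h.rotate.crosses] at hc
    exact ⟨rfl, by nlinarith⟩
  · right
    rw [h.swap.crosses] at hc
    exact ⟨rfl, by nlinarith⟩

/-- The barycentric coordinate of `c + 1`, the first lattice coordinate for the lines through the
vertex `c` of a triangle. -/
def cornerX (c : Fin 3) : Fin 3 → ℝ := Pi.single (c + 1) 1

/-- The barycentric coordinate of `c + 2`, the second lattice coordinate for the lines through the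
vertex `c` of a triangle. -/
def cornerY (c : Fin 3) : Fin 3 → ℝ := Pi.single (c + 2) 1

lemma at_corner_one (c : Fin 3) : At (cornerX c) (cornerY c) (c + 1) 1 0 := by
  simp [At, cornerX, cornerY]

lemma at_corner_two (c : Fin 3) : At (cornerX c) (cornerY c) (c + 2) 0 1 := by
  simp [At, cornerX, cornerY]

lemma at_corner_zero (c : Fin 3) : At (cornerX c) (cornerY c) c 0 0 := by
  have h1 : c ≠ c + 1 := (add_one_ne_fin3 c).symm
  have h2 : c ≠ c + 2 := (add_two_ne_fin3 c).symm
  simp [At, cornerX, cornerY, h1, h2]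

lemma distinct_corner (c : Fin 3) : Distinct (c + 2) (c + 1) c := by
  revert c; unfold Distinct; decide

lemma eval_corner_one (c : Fin 3) (α β : ℝ) : (β • cornerY c - α • cornerX c) (c + 1) = -α := by
  rw [(at_corner_one c).eval]; ring

lemma eval_corner_two (c : Fin 3) (α β : ℝ) : (β • cornerY c - α • cornerX c) (c + 2) = β := by
  rw [(at_corner_two c).eval]; ring

/-- The corner data of a triangle, from what is known about the lines whose first crossing is that
of the opposite side. -/
lemma cornerData_triangle {a : Fin 3 → ℝ} {c : Fin 3} {h : ℕ → ℕ → ℕ} {C : ℕ}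
    (hI : ∀ α β : ℝ, 0 < α → 0 < β → ∀ w, ((c + 1) :: w).IsChain (· ≠ ·) →
      (triangle a).Run ((c + 1) :: w) (β • cornerY c - α • cornerX c) →
      (∀ v, (∀ j ∈ ((c + 1) :: w).getLast?, OffSide v j) →
        (triangle a).fold ((c + 1) :: w) (β • cornerY c - α • cornerX c) v = 0 →
        ∃ x y : ℕ, 0 < x ∧ 0 < y ∧ (triangle a).fold ((c + 1) :: w) (cornerX c) v = x ∧
          (triangle a).fold ((c + 1) :: w) (cornerY c) v = y ∧ h x y ≤ ((c + 1) :: w).length + C) ∧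
      ∀ x y : ℕ, 0 < x → 0 < y → β * y = α * x → ((c + 1) :: w).length ≤ h x y + C) :
    (triangle a).CornerData c (cornerX c) (cornerY c) h C where
  X_mem := trivial
  Y_mem := trivial
  X_zero := (at_corner_zero c).1
  Y_zero := (at_corner_zero c).2
  repr F _ h0 i hi hc := by
    obtain rfl := eq_of_offSide hi
    have hlin : ∀ s : ℝ, ∀ α β : ℝ, F (c + 1) = s * -α → F (c + 2) = s * β →
        F = s • (β • cornerY c - α • cornerX c) := by
      intro s α β h1 h2
      ext v
      rcases fin3_eq_or c v with rfl | rfl | rfl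
      · rw [h0, Pi.smul_apply, (at_corner_zero v).eval]; simp
      · rw [h1, Pi.smul_apply, eval_corner_one]; rfl
      · rw [h2, Pi.smul_apply, eval_corner_two]; rfl
    rw [(distinct_corner c).crosses] at hc
    rcases mul_neg_iff.1 hc with ⟨h1, h2⟩ | ⟨h1, h2⟩
    · exact ⟨-F (c + 1), F (c + 2), 1, by linarith, h1, one_ne_zero,
        hlin _ _ _ (by ring) (by ring)⟩
    · exact ⟨F (c + 1), -F (c + 2), -1, h2, by linarith, by norm_num,
        hlin _ _ _ (by ring) (by ring)⟩
  start α β hα hβ _ := by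
    refine ⟨c + 1, offSide_iff.2 rfl, ?_⟩
    rw [(distinct_corner c).crosses, eval_corner_one, eval_corner_two]
    nlinarith
  start_unique F _ _ i j hi hj _ _ := by
    rw [eq_of_offSide hi, eq_of_offSide hj]
  hit α β hα hβ i w v hw hi hr hv h0 := by
    obtain rfl := eq_of_offSide hi
    exact (hI α β hα hβ w hw hr).1 v hv h0
  block α β hα hβ i w hw hi hr := by
    obtain rfl := eq_of_offSide hi
    exact (hI α β hα hβ w hw hr).2

/-! ### The equilateral triangle -/

/-- The model of the equilateral triangle: the reflected apex completes a parallelogram. -/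
abbrev equilateral : UnfoldingModel 3 := triangle fun _ => 1

lemma equilateral_refl_apex {l r t} (h : Distinct l r t) (F : Fin 3 → ℝ) :
    equilateral.refl (t + 1) F t = F l + F r - F t := by
  have h1 := triangle_refl_apex (fun _ => 1) (t + 1) F
  rw [add_one_add_two_fin3] at h1
  rw [equilateral, h1]
  rcases h.eq_or with ⟨rfl, rfl⟩ | ⟨rfl, rfl⟩ <;> ring

lemma At.equilateral_apex {l r t} (h : Distinct l r t) {X Y : Fin 3 → ℝ} {x y x' y' x'' y'' : ℝ}
    (hl : At X Y l x y) (hr : At X Y r x' y') (ht : At X Y t x'' y'') :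
    At (equilateral.refl (t + 1) X) (equilateral.refl (t + 1) Y) t
      (x + x' - x'') (y + y' - y'') := by
  rw [At, equilateral_refl_apex h, equilateral_refl_apex h, hl.1, hl.2, hr.1, hr.2, ht.1, ht.2]
  exact ⟨rfl, rfl⟩

/-- The position of a line in the tiling by equilateral triangles after `k` crossings. In the
lattice coordinates the tiles are the halves of the unit squares, cut along their antidiagonals. A
lower half is entered from the left or from below, an upper half through the antidiagonal. -/
def EquilateralState (α β : ℝ) (k : ℕ) (X Y : Fin 3 → ℝ) (i : Fin 3) : Prop :=
  ∃ l r t, Distinct l r t ∧ i = t + 1 ∧ ∃ p q : ℤ, GridCell α β p q ∧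
    (((k : ℤ) = 2 * (p + q) + 1 ∧ At X Y l p (q + 1) ∧ At X Y r (p + 1) q ∧
        At X Y t (p + 1) (q + 1)) ∨
      ((k : ℤ) = 2 * (p + q) ∧ At X Y l p (q + 1) ∧ At X Y r p q ∧ At X Y t (p + 1) q ∧
        β * q < α * p) ∨
      ((k : ℤ) = 2 * (p + q) ∧ At X Y l p q ∧ At X Y r (p + 1) q ∧ At X Y t p (q + 1) ∧
        α * p < β * q))

lemma EquilateralState.step {α β : ℝ} (hα : 0 < α) (hβ : 0 < β) (k X Y i j)
    (h : EquilateralState α β k X Y i) (hj : j ≠ i) (hc : Crosses (β • Y - α • X) j) :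
    EquilateralState α β (k + 1) (equilateral.refl j X) (equilateral.refl j Y) j := by
  obtain ⟨l, r, t, hd, rfl, p, q, hg, h⟩ := h
  have hb := hg.below
  have ha := hg.above
  rcases h with ⟨hk, hl, hr, ht⟩ | ⟨hk, hl, hr, ht, hs⟩ | ⟨hk, hl, hr, ht, hs⟩
  · rcases hd.exit_cases (by rw [hl.eval]; linarith) (by rw [hr.eval]; linarith) hj hc with
      ⟨rfl, h⟩ | ⟨rfl, h⟩
    · rw [ht.eval] at h
      refine ⟨t, r, l, hd.rotate, rfl, p + 1, q, hg.right hα hβ (by linarith),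
        Or.inr (Or.inl ⟨by push_cast; linarith, ?_, ?_, ?_, ?_⟩)⟩
      · exact_mod_cast ht.triangle_refl hd.2.2.symm
      · exact_mod_cast hr.triangle_refl hd.1.symm
      · convert At.equilateral_apex hd.rotate ht hr hl using 1 <;> push_cast <;> ring
      · push_cast; exact hb
    · rw [ht.eval] at h
      refine ⟨l, t, r, hd.swap, rfl, p, q + 1, hg.up hβ (by linarith),
        Or.inr (Or.inr ⟨by push_cast; linarith, ?_, ?_, ?_, ?_⟩)⟩
      · exact_mod_cast hl.triangle_refl hd.1
      · exact_mod_cast ht.triangle_refl hd.2.1.symm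
      · convert At.equilateral_apex hd.swap hl ht hr using 1 <;> push_cast <;> ring
      · push_cast; exact ha
  · rcases hd.exit_cases (by rw [hl.eval]; linarith) (by rw [hr.eval]; linarith) hj hc with
      ⟨rfl, h⟩ | ⟨rfl, h⟩
    · rw [ht.eval] at h
      linarith
    · refine ⟨l, t, r, hd.swap, rfl, p, q, hg, Or.inl ⟨by push_cast; linarith, ?_, ?_, ?_⟩⟩
      · exact hl.triangle_refl hd.1
      · exact ht.triangle_refl hd.2.1.symm
      · convert At.equilateral_apex hd.swap hl ht hr using 1 <;> ring
  · rcases hd.exit_cases (by rw [hl.eval]; linarith) (by rw [hr.eval]; linarith) hj hc with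
      ⟨rfl, h⟩ | ⟨rfl, h⟩
    · refine ⟨t, r, l, hd.rotate, rfl, p, q, hg, Or.inl ⟨by push_cast; linarith, ?_, ?_, ?_⟩⟩
      · exact ht.triangle_refl hd.2.2.symm
      · exact hr.triangle_refl hd.1.symm
      · convert At.equilateral_apex hd.rotate ht hr hl using 1 <;> ring
    · rw [ht.eval] at h
      linarith

lemma cornerData_equilateral (c : Fin 3) :
    equilateral.CornerData c (cornerX c) (cornerY c) (fun x y => 2 * (x + y)) 3 := by
  refine cornerData_triangle fun α β hα hβ w hw hr => ?_
  have h0 : EquilateralState α β 1 (equilateral.refl (c + 1) (cornerX c))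
      (equilateral.refl (c + 1) (cornerY c)) (c + 1) := by
    have hd := distinct_corner c
    refine ⟨c + 2, c + 1, c, hd, rfl, 0, 0, GridCell.zero hα hβ, Or.inl ⟨by norm_num, ?_, ?_, ?_⟩⟩
    · simpa using (at_corner_two c).triangle_refl hd.2.2
    · simpa using (at_corner_one c).triangle_refl hd.2.1
    · simpa using At.equilateral_apex hd (at_corner_two c) (at_corner_one c) (at_corner_zero c)
  obtain ⟨i, hi, l, r, t, hd, rfl, p, q, hg, h⟩ :=
    exists_invariant_of_run equilateral (EquilateralState.step hα hβ) h0 hw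
      (by simpa only [map_sub, map_smul] using hr.2)
  have hp := hg.nonneg_left
  have hq := hg.nonneg_right
  rw [hi]
  constructor
  · intro v hv hz
    obtain rfl := offSide_iff.1 (hv _ rfl)
    change (equilateral.fold w _) v = 0 at hz
    rw [map_sub, map_sub, map_smul, map_smul, map_smul, map_smul] at hz
    rcases h with ⟨hk, hl, hr, ht⟩ | ⟨hk, hl, hr, ht, hs⟩ | ⟨hk, hl, hr, ht, hs⟩
    · refine ⟨(p + 1).toNat, (q + 1).toNat, by omega, by omega, ?_, ?_, ?_⟩
      · have : ((p + 1).toNat : ℤ) = p + 1 := Int.toNat_of_nonneg (by omega)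
        refine ht.1.trans ?_
        exact_mod_cast this.symm
      · have : ((q + 1).toNat : ℤ) = q + 1 := Int.toNat_of_nonneg (by omega)
        refine ht.2.trans ?_
        exact_mod_cast this.symm
      · simp only [List.length_cons]
        omega
    · have := hg.below
      rw [ht.eval] at hz
      linarith
    · have := hg.above
      rw [ht.eval] at hz
      linarith
  · intro x y hx hy hxy
    obtain ⟨h1, h2⟩ := hg.lt_of_mem hα hβ hx hxy
    simp only [List.length_cons]
    rcases h with ⟨hk, -⟩ | ⟨hk, -⟩ | ⟨hk, -⟩ <;> omega

end UnfoldingModel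
end PolygonalBilliard

namespace PolygonalBilliard
namespace UnfoldingModel

/-! ### The isosceles right triangle -/

/-- The model of the isosceles right triangle with the right angle at the vertex `o`. In a leg an
acute vertex is reflected through the right vertex; in the hypotenuse the right vertex is reflected
to the fourth corner of a square. -/
abbrev rightIsosceles (o : Fin 3) : UnfoldingModel 3 :=
  triangle fun i => if i + 2 = o then 1 else if i = o then 2 else 0

lemma rightIsosceles_refl_apex {l r t} (h : Distinct l r t) (o : Fin 3) (F : Fin 3 → ℝ) :
    (rightIsosceles o).refl (t + 1) F t =
      if t = o then F l + F r - F t else if l = o then 2 * F l - F t else 2 * F r - F t := by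
  have h1 := triangle_refl_apex (fun i => if i + 2 = o then 1 else if i = o then 2 else 0) (t + 1) F
  simp only [add_one_add_two_fin3] at h1
  rw [h1]
  rcases h.eq_or with ⟨rfl, rfl⟩ | ⟨rfl, rfl⟩
  · split_ifs <;> ring
  · have e1 : t + 1 ≠ t + 1 + 1 := h.1.symm
    rcases fin3_eq_or t o with rfl | rfl | rfl
    · simp; ring
    · simp [e1.symm]
    · simp [← add_one_add_one_fin3, e1, h.2.2.symm]

section apex

variable {l r t : Fin 3} {X Y : Fin 3 → ℝ} {x y x' y' x'' y'' : ℝ}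

lemma At.hypotenuse (h : Distinct l r t) (hl : At X Y l x y) (hr : At X Y r x' y')
    (ht : At X Y t x'' y'') :
    At ((rightIsosceles t).refl (t + 1) X) ((rightIsosceles t).refl (t + 1) Y) t
      (x + x' - x'') (y + y' - y'') := by
  rw [At, rightIsosceles_refl_apex h, rightIsosceles_refl_apex h, hl.1, hl.2, hr.1, hr.2, ht.1,
    ht.2]
  simp

lemma At.leg_left (h : Distinct l r t) (hl : At X Y l x y) (ht : At X Y t x'' y'') :
    At ((rightIsosceles l).refl (t + 1) X) ((rightIsosceles l).refl (t + 1) Y) t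
      (2 * x - x'') (2 * y - y'') := by
  rw [At, rightIsosceles_refl_apex h, rightIsosceles_refl_apex h, hl.1, hl.2, ht.1, ht.2]
  simp [h.2.2.symm]

lemma At.leg_right (h : Distinct l r t) (hr : At X Y r x' y') (ht : At X Y t x'' y'') :
    At ((rightIsosceles r).refl (t + 1) X) ((rightIsosceles r).refl (t + 1) Y) t
      (2 * x' - x'') (2 * y' - y'') := by
  rw [At, rightIsosceles_refl_apex h, rightIsosceles_refl_apex h, hr.1, hr.2, ht.1, ht.2]
  simp [h.1, h.2.1.symm]

end apex

/-- The position of a line of slope at most `1` in the tiling by isosceles right triangles after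
`k` crossings. The tiles are the halves of the unit squares; the squares with a right angle at their
upper left and lower right corners are cut along the diagonal, and the others along the
antidiagonal. The alternatives are: the upper half of a square of the first kind; its lower half,
entered from below or through the diagonal; the lower half of a square of the second kind, entered
from the left or from below; and its upper half. -/
def IsoscelesState (o : Fin 3) (κ : ℤ) (α β : ℝ) (k : ℕ) (X Y : Fin 3 → ℝ) (i : Fin 3) : Prop :=
  ∃ l r t, Distinct l r t ∧ i = t + 1 ∧ ∃ p q : ℤ, GridCell α β p q ∧
    ((o = l ∧ (k : ℤ) = 2 * p + q + κ - 1 ∧ At X Y l p (q + 1) ∧ At X Y r p q ∧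
        At X Y t (p + 1) (q + 1) ∧ β * q < α * p) ∨
      (o = r ∧ (k : ℤ) = 2 * p + q + κ ∧ At X Y l p q ∧ At X Y r (p + 1) q ∧
        At X Y t (p + 1) (q + 1) ∧ α * p < β * q) ∨
      (o = t ∧ (k : ℤ) = 2 * p + q + κ ∧ At X Y l (p + 1) (q + 1) ∧ At X Y r p q ∧
        At X Y t (p + 1) q ∧ β * q < α * p ∧ α * (p + 1) < β * (q + 1)) ∨
      (o = r ∧ (k : ℤ) = 2 * p + q + κ - 1 ∧ At X Y l p (q + 1) ∧ At X Y r p q ∧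
        At X Y t (p + 1) q ∧ β * q < α * p) ∨
      (o = l ∧ (k : ℤ) = 2 * p + q + κ - 1 ∧ At X Y l p q ∧ At X Y r (p + 1) q ∧
        At X Y t p (q + 1) ∧ α * p < β * q) ∨
      (o = t ∧ (k : ℤ) = 2 * p + q + κ ∧ At X Y l p (q + 1) ∧ At X Y r (p + 1) q ∧
        At X Y t (p + 1) (q + 1)))

lemma IsoscelesState.step {o : Fin 3} {κ : ℤ} {α β : ℝ} (hα : 0 < α) (hβ : 0 < β) (hαβ : α ≤ β)
    (k X Y i j) (h : IsoscelesState o κ α β k X Y i) (hj : j ≠ i)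
    (hc : Crosses (β • Y - α • X) j) :
    IsoscelesState o κ α β (k + 1) ((rightIsosceles o).refl j X) ((rightIsosceles o).refl j Y)
      j := by
  obtain ⟨l, r, t, hd, rfl, p, q, hg, h⟩ := h
  have hb := hg.below
  have ha := hg.above
  have hlr := hd.1
  have hrt := hd.2.1
  have hlt := hd.2.2
  rcases h with ⟨rfl, hk, hl, hr, ht, hs⟩ | ⟨rfl, hk, hl, hr, ht, hs⟩ |
    ⟨rfl, hk, hl, hr, ht, hs, hs'⟩ | ⟨rfl, hk, hl, hr, ht, hs⟩ | ⟨rfl, hk, hl, hr, ht, hs⟩ |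
    ⟨rfl, hk, hl, hr, ht⟩ <;>
  rcases hd.exit_cases (by rw [hl.eval]; linarith) (by rw [hr.eval]; linarith) hj hc with
      ⟨rfl, h⟩ | ⟨rfl, h⟩ <;> rw [ht.eval] at h
  · refine ⟨t, r, o, hd.rotate, rfl, p, q, hg, Or.inr (Or.inr (Or.inl
      ⟨rfl, by push_cast; linarith, ?_, ?_, ?_, hs, by linarith⟩))⟩
    · exact ht.triangle_refl hlt.symm
    · exact hr.triangle_refl hlr.symm
    · convert At.hypotenuse hd.rotate ht hr hl using 1 <;> ring
  · refine ⟨o, t, r, hd.swap, rfl, p, q + 1, hg.up hβ (by linarith), Or.inr (Or.inr (Or.inr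
      (Or.inr (Or.inl ⟨rfl, by push_cast; linarith, ?_, ?_, ?_, ?_⟩))))⟩
    · exact_mod_cast hl.triangle_refl hlr
    · exact_mod_cast ht.triangle_refl hrt.symm
    · convert At.leg_left hd.swap hl hr using 1 <;> push_cast <;> ring
    · push_cast; exact ha
  · refine ⟨t, o, l, hd.rotate, rfl, p + 1, q, hg.right hα hβ (by linarith), Or.inr (Or.inr (Or.inr
      (Or.inl ⟨rfl, by push_cast; linarith, ?_, ?_, ?_, ?_⟩)))⟩
    · exact_mod_cast ht.triangle_refl hlt.symm
    · exact_mod_cast hr.triangle_refl hlr.symm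
    · convert At.leg_right hd.rotate hr hl using 1 <;> push_cast <;> ring
    · push_cast; exact hb
  · linarith
  · linarith
  · refine ⟨l, o, r, hd.swap, rfl, p + 1, q, hg.right hα hβ hs', Or.inr (Or.inr (Or.inr
      (Or.inl ⟨rfl, by push_cast; linarith, ?_, ?_, ?_, ?_⟩)))⟩
    · exact_mod_cast hl.triangle_refl hlr
    · exact_mod_cast ht.triangle_refl hrt.symm
    · convert At.leg_right hd.swap ht hr using 1 <;> push_cast <;> ring
    · push_cast; exact hb
  · linarith
  · refine ⟨l, t, o, hd.swap, rfl, p, q, hg, Or.inr (Or.inr (Or.inr (Or.inr (Or.inr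
      ⟨rfl, by push_cast; linarith, ?_, ?_, ?_⟩))))⟩
    · exact hl.triangle_refl hlr
    · exact ht.triangle_refl hrt.symm
    · convert At.hypotenuse hd.swap hl ht hr using 1 <;> ring
  · refine ⟨t, r, o, hd.rotate, rfl, p, q, hg, Or.inr (Or.inr (Or.inr (Or.inr (Or.inr
      ⟨rfl, by push_cast; linarith, ?_, ?_, ?_⟩))))⟩
    · exact ht.triangle_refl hlt.symm
    · exact hr.triangle_refl hlr.symm
    · convert At.hypotenuse hd.rotate ht hr hl using 1 <;> ring
  · linarith
  · refine ⟨o, r, l, hd.rotate, rfl, p + 1, q, hg.right hα hβ (by linarith),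
      Or.inl ⟨rfl, by push_cast; linarith, ?_, ?_, ?_, ?_⟩⟩
    · exact_mod_cast ht.triangle_refl hlt.symm
    · exact_mod_cast hr.triangle_refl hlr.symm
    · convert At.leg_left hd.rotate ht hl using 1 <;> push_cast <;> ring
    · push_cast; exact hb
  · refine ⟨l, o, r, hd.swap, rfl, p, q + 1, hg.up hβ (by linarith),
      Or.inr (Or.inl ⟨rfl, by push_cast; linarith, ?_, ?_, ?_, ?_⟩)⟩
    · exact_mod_cast hl.triangle_refl hlr
    · exact_mod_cast ht.triangle_refl hrt.symm
    · convert At.leg_right hd.swap ht hr using 1 <;> push_cast <;> ring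
    · push_cast; exact ha

/-- What the positions say about the vertices and the number of crossings. -/
lemma IsoscelesState.follow {o : Fin 3} {κ : ℤ} (hκ : 0 ≤ κ) (hκ' : κ ≤ 1) {α β : ℝ} (hα : 0 < α)
    (hβ : 0 < β) (hαβ : α ≤ β) {X Y : Fin 3 → ℝ} {i w} (h : IsoscelesState o κ α β 1 X Y i)
    (hw : (i :: w).IsChain (· ≠ ·)) (hr : (rightIsosceles o).Run w (β • Y - α • X)) :
    (∀ v, (∀ j ∈ (i :: w).getLast?, OffSide v j) →
      (rightIsosceles o).fold w (β • Y - α • X) v = 0 →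
      ∃ x y : ℕ, 0 < x ∧ 0 < y ∧ β * y = α * x ∧ (rightIsosceles o).fold w X v = x ∧
        (rightIsosceles o).fold w Y v = y ∧ 2 * x + y ≤ (i :: w).length + 4) ∧
    ∀ x y : ℕ, 0 < x → 0 < y → β * y = α * x → (i :: w).length ≤ 2 * x + y + 4 := by
  obtain ⟨i, hi, l, r, t, hd, rfl, p, q, hg, h⟩ :=
    exists_invariant_of_run _ (IsoscelesState.step hα hβ hαβ) h hw hr
  have hp := hg.nonneg_left
  have hq := hg.nonneg_right
  have hb := hg.below
  have ha := hg.above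
  rw [hi]
  constructor
  · intro v hv hz
    obtain rfl := offSide_iff.1 (hv _ rfl)
    rw [map_sub, map_smul, map_smul] at hz
    have key : At ((rightIsosceles o).fold w X) ((rightIsosceles o).fold w Y) v (p + 1) (q + 1) →
        2 * p + q + κ - 1 ≤ 1 + w.length →
        ∃ x y : ℕ, 0 < x ∧ 0 < y ∧ β * y = α * x ∧ (rightIsosceles o).fold w X v = x ∧
        (rightIsosceles o).fold w Y v = y ∧ 2 * x + y ≤ (i :: w).length + 4 := by
      intro ht hk
      rw [ht.eval] at hz
      have e1 : ((p + 1).toNat : ℤ) = p + 1 := Int.toNat_of_nonneg (by omega)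
      have e2 : ((q + 1).toNat : ℤ) = q + 1 := Int.toNat_of_nonneg (by omega)
      have e1' : ((p + 1).toNat : ℝ) = p + 1 := by exact_mod_cast e1
      have e2' : ((q + 1).toNat : ℝ) = q + 1 := by exact_mod_cast e2
      refine ⟨(p + 1).toNat, (q + 1).toNat, by omega, by omega, ?_, ht.1.trans e1'.symm,
        ht.2.trans e2'.symm, ?_⟩
      · rw [e1', e2']; linarith
      · simp only [List.length_cons]
        omega
    rcases h with ⟨-, hk, hl, hr, ht, hs⟩ | ⟨-, hk, hl, hr, ht, hs⟩ |
      ⟨-, hk, hl, hr, ht, hs, hs'⟩ | ⟨-, hk, hl, hr, ht, hs⟩ | ⟨-, hk, hl, hr, ht, hs⟩ |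
      ⟨-, hk, hl, hr, ht⟩
    · exact key ht (by omega)
    · rw [ht.eval] at hz; linarith
    · rw [ht.eval] at hz; linarith
    · rw [ht.eval] at hz; linarith
    · rw [ht.eval] at hz; linarith
    · exact key ht (by omega)
  · intro x y hx hy hxy
    obtain ⟨h1, h2⟩ := hg.lt_of_mem hα hβ hx hxy
    simp only [List.length_cons]
    rcases h with ⟨-, hk, -⟩ | ⟨-, hk, -⟩ | ⟨-, hk, -⟩ | ⟨-, hk, -⟩ | ⟨-, hk, -⟩ | ⟨-, hk, -⟩ <;>
      omega

lemma cornerData_right (o : Fin 3) : (rightIsosceles o).CornerData o (cornerX o) (cornerY o)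
    (fun x y => x + y + max x y) 4 := by
  refine cornerData_triangle fun α β hα hβ w hw hr => ?_
  have hd := distinct_corner o
  have h1 : At ((rightIsosceles o).refl (o + 1) (cornerX o))
      ((rightIsosceles o).refl (o + 1) (cornerY o)) (o + 1) 1 0 :=
    (at_corner_one o).triangle_refl hd.2.1
  have h2 : At ((rightIsosceles o).refl (o + 1) (cornerX o))
      ((rightIsosceles o).refl (o + 1) (cornerY o)) (o + 2) 0 1 :=
    (at_corner_two o).triangle_refl hd.2.2
  have h0 : At ((rightIsosceles o).refl (o + 1) (cornerX o))
      ((rightIsosceles o).refl (o + 1) (cornerY o)) o 1 1 := by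
    simpa using At.hypotenuse hd (at_corner_two o) (at_corner_one o) (at_corner_zero o)
  rcases le_total α β with hαβ | hαβ
  · have hI : IsoscelesState o 1 α β 1 ((rightIsosceles o).refl (o + 1) (cornerX o))
        ((rightIsosceles o).refl (o + 1) (cornerY o)) (o + 1) := by
      refine ⟨o + 2, o + 1, o, hd, rfl, 0, 0, GridCell.zero hα hβ, Or.inr (Or.inr (Or.inr (Or.inr
        (Or.inr ⟨rfl, by norm_num, ?_, ?_, ?_⟩))))⟩
      · simpa using h2
      · simpa using h1
      · simpa using h0
    obtain ⟨f1, f2⟩ := hI.follow (by norm_num) (by norm_num) hα hβ hαβ hw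
      (by simpa only [map_sub, map_smul] using hr.2)
    have hle : ∀ x y : ℕ, β * y = α * x → y ≤ x := by
      intro x y hxy
      have : β * y ≤ β * x := by
        rw [hxy]; exact mul_le_mul_of_nonneg_right hαβ (Nat.cast_nonneg x)
      exact_mod_cast le_of_mul_le_mul_left this hβ
    refine ⟨fun v hv hz => ?_, fun x y hx hy hxy => ?_⟩
    · obtain ⟨x, y, hx, hy, hxy, hX, hY, hl⟩ := f1 v hv
        (by simpa only [fold_cons, map_sub, map_smul] using hz)
      have := hle x y hxy
      exact ⟨x, y, hx, hy, hX, hY, by rw [max_eq_left this]; omega⟩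
    · have := f2 x y hx hy hxy
      rw [max_eq_left (hle x y hxy)]
      omega
  · -- directions beyond the altitude are mirrored
    have hI : IsoscelesState o 1 β α 1 ((rightIsosceles o).refl (o + 1) (cornerY o))
        ((rightIsosceles o).refl (o + 1) (cornerX o)) (o + 1) := by
      refine ⟨o + 1, o + 2, o, ⟨hd.1.symm, hd.2.2, hd.2.1⟩, rfl, 0, 0, GridCell.zero hβ hα,
        Or.inr (Or.inr (Or.inr (Or.inr (Or.inr ⟨rfl, by norm_num, ?_, ?_, ?_⟩))))⟩
      · simpa [At] using And.symm h1
      · simpa [At] using And.symm h2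
      · simpa [At] using And.symm h0
    have hneg : α • cornerX o - β • cornerY o = -(β • cornerY o - α • cornerX o) := by abel
    obtain ⟨f1, f2⟩ := hI.follow (by norm_num) (by norm_num) hβ hα hαβ hw
      (by simpa only [map_sub, map_smul, ← hneg] using (Run.neg hr).2)
    have hle : ∀ x y : ℕ, α * x = β * y → x ≤ y := by
      intro x y hxy
      have : α * x ≤ α * y := by
        rw [hxy]; exact mul_le_mul_of_nonneg_right hαβ (Nat.cast_nonneg y)
      exact_mod_cast le_of_mul_le_mul_left this hα
    refine ⟨fun v hv hz => ?_, fun x y hx hy hxy => ?_⟩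
    · obtain ⟨y, x, hy, hx, hxy, hY, hX, hl⟩ := f1 v hv (by
        rw [← map_smul, ← map_smul, ← map_sub, hneg, map_neg, map_neg, Pi.neg_apply, neg_eq_zero]
        exact hz)
      have := hle x y hxy
      exact ⟨x, y, hx, hy, hX, hY, by rw [max_eq_right this]; omega⟩
    · have := f2 y x hy hx hxy.symm
      rw [max_eq_right (hle x y hxy.symm)]
      omega

/-- The start at an acute vertex. The hypotenuse is the diagonal of the first unit square, and the
first crossing leads into the square to the right of it. -/
lemma IsoscelesState.acute {o c l : Fin 3} (hd : Distinct l o c) {α β : ℝ} (hα : 0 < α)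
    (hαβ : α < β) {X Y : Fin 3 → ℝ} (hc : At X Y c 0 0) (ho : At X Y o 1 0) (hl : At X Y l 1 1) :
    IsoscelesState o 0 α β 1 ((rightIsosceles o).refl (c + 1) X)
      ((rightIsosceles o).refl (c + 1) Y) (c + 1) := by
  have hβ := hα.trans hαβ
  refine ⟨l, o, c, hd, rfl, 0 + 1, 0, (GridCell.zero hα hβ).right hα hβ (by simpa using hαβ),
    Or.inr (Or.inr (Or.inr (Or.inl ⟨rfl, by norm_num, ?_, ?_, ?_, ?_⟩)))⟩
  · simpa using hl.triangle_refl hd.2.2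
  · simpa using ho.triangle_refl hd.2.1
  · convert At.leg_right hd ho hc using 1 <;> norm_num
  · simpa using hα

lemma cornerData_acute_one (c : Fin 3) :
    (rightIsosceles (c + 1)).CornerData c (cornerX c) (cornerY c)
      (fun x y => 2 * x + 3 * y) 4 := by
  refine cornerData_triangle fun α β hα hβ w hw hr => ?_
  have hI := IsoscelesState.acute (distinct_corner c) hα (show α < α + β by linarith)
    (X := cornerX c + cornerY c) (Y := cornerY c)
    (by
      have := at_corner_zero c
      exact ⟨by simp [this.1, this.2], this.2⟩) (by
      have := at_corner_one c
      exact ⟨by simp [this.1, this.2], this.2⟩) (by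
      have := at_corner_two c
      exact ⟨by simp [this.1, this.2], this.2⟩)
  have hF : (α + β) • cornerY c - α • (cornerX c + cornerY c) = β • cornerY c - α • cornerX c := by
    module
  obtain ⟨f1, f2⟩ := hI.follow le_rfl zero_le_one hα (by linarith) (by linarith) hw
    (by rw [← map_smul, ← map_smul, ← map_sub, hF]; exact hr.2)
  refine ⟨fun v hv hz => ?_, fun x y hx hy hxy => ?_⟩
  · obtain ⟨x, y, hx, hy, hxy, hX, hY, hl⟩ := f1 v hv
      (by rw [← map_smul, ← map_smul, ← map_sub, hF]; exact hz)
    have hlt : y < x := by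
      by_contra hle
      have : (x : ℝ) ≤ y := by exact_mod_cast not_lt.1 hle
      have hx' : (0 : ℝ) < x := by exact_mod_cast hx
      nlinarith
    refine ⟨x - y, y, by omega, hy, ?_, hY, by omega⟩
    rw [map_add, map_add, Pi.add_apply, hY] at hX
    rw [Nat.cast_sub hlt.le, fold_cons]
    linarith
  · have := f2 (x + y) y (by omega) hy (by push_cast; linarith)
    omega

lemma cornerData_acute_two (c : Fin 3) :
    (rightIsosceles (c + 2)).CornerData c (cornerX c) (cornerY c)
      (fun x y => 3 * x + 2 * y) 4 := by
  refine cornerData_triangle fun α β hα hβ w hw hr => ?_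
  have hd := distinct_corner c
  have hI := IsoscelesState.acute (o := c + 2) (c := c) (l := c + 1)
    ⟨hd.1.symm, hd.2.2, hd.2.1⟩ hβ
    (show β < α + β by linarith) (X := cornerX c + cornerY c) (Y := cornerX c)
    (by
      have := at_corner_zero c
      exact ⟨by simp [this.1, this.2], this.1⟩) (by
      have := at_corner_two c
      exact ⟨by simp [this.1, this.2], this.1⟩) (by
      have := at_corner_one c
      exact ⟨by simp [this.1, this.2], this.1⟩)
  have hF : (α + β) • cornerX c - β • (cornerX c + cornerY c) =
      -(β • cornerY c - α • cornerX c) := by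
    module
  obtain ⟨f1, f2⟩ := hI.follow le_rfl zero_le_one hβ (by linarith) (by linarith) hw
    (by rw [← map_smul, ← map_smul, ← map_sub, hF]; exact (Run.neg hr).2)
  refine ⟨fun v hv hz => ?_, fun x y hx hy hxy => ?_⟩
  · obtain ⟨x, y, hx, hy, hxy, hX, hY, hl⟩ := f1 v hv
      (by
        rw [← map_smul, ← map_smul, ← map_sub, hF, map_neg, map_neg, Pi.neg_apply, neg_eq_zero]
        exact hz)
    have hlt : y < x := by
      by_contra hle
      have : (x : ℝ) ≤ y := by exact_mod_cast not_lt.1 hle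
      have hx' : (0 : ℝ) < x := by exact_mod_cast hx
      nlinarith
    refine ⟨y, x - y, hy, by omega, hY, ?_, by omega⟩
    rw [map_add, map_add, Pi.add_apply, hY] at hX
    rw [Nat.cast_sub hlt.le, fold_cons]
    linarith
  · have := f2 (x + y) x (by omega) hx (by push_cast; linarith)
    omega

end UnfoldingModel
end PolygonalBilliard

namespace PolygonalBilliard
namespace UnfoldingModel

/-! ### The tiling by squares -/

/-- The labels `a`, `b`, `c`, `d` go once around the square, in one of the two directions. -/
def Cyclic (a b c d : Fin 4) : Prop :=
  (b = a + 1 ∧ c = a + 2 ∧ d = a + 3) ∨ (b = a + 3 ∧ c = a + 2 ∧ d = a + 1)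

/-- The side `i` joins the vertices `u` and `v`. -/
def JoinsVertices (i u v : Fin 4) : Prop := (u = i ∧ v = i + 1) ∨ (u = i + 1 ∧ v = i)

lemma JoinsVertices.crosses {i u v : Fin 4} (h : JoinsVertices i u v) {F : Fin 4 → ℝ} :
    Crosses F i ↔ F u * F v < 0 := by
  rcases h with ⟨rfl, rfl⟩ | ⟨rfl, rfl⟩
  · rfl
  · rw [Crosses, mul_comm]

lemma JoinsVertices.symm {i u v : Fin 4} (h : JoinsVertices i u v) : JoinsVertices i v u :=
  Or.symm (h.imp And.symm And.symm)

lemma JoinsVertices.unique {i j u v : Fin 4} (h : JoinsVertices i u v) (h' : JoinsVertices j u v) :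
    i = j := by
  rcases h with ⟨rfl, rfl⟩ | ⟨rfl, rfl⟩
  · revert h'; unfold JoinsVertices; revert j u; decide
  · revert h'; unfold JoinsVertices; revert j v; decide

lemma Cyclic.right {a b c d} (h : Cyclic a b c d) : Cyclic b a d c := by
  rcases h with ⟨rfl, rfl, rfl⟩ | ⟨rfl, rfl, rfl⟩ <;> revert a <;> unfold Cyclic <;> decide

lemma Cyclic.up {a b c d} (h : Cyclic a b c d) : Cyclic d c b a := by
  rcases h with ⟨rfl, rfl, rfl⟩ | ⟨rfl, rfl, rfl⟩ <;> revert a <;> unfold Cyclic <;> decide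

lemma Cyclic.transpose {a b c d} (h : Cyclic a b c d) : Cyclic a d c b := by
  rcases h with ⟨rfl, rfl, rfl⟩ | ⟨rfl, rfl, rfl⟩ <;> revert a <;> unfold Cyclic <;> decide

lemma Cyclic.side_cases {a b c d} (h : Cyclic a b c d) (j : Fin 4) :
    JoinsVertices j a b ∨ JoinsVertices j b c ∨ JoinsVertices j c d ∨ JoinsVertices j a d := by
  rcases h with ⟨rfl, rfl, rfl⟩ | ⟨rfl, rfl, rfl⟩ <;> revert a j <;> unfold JoinsVertices <;> decide

lemma Cyclic.offSide_left {a b c d i v} (h : Cyclic a b c d) (hi : JoinsVertices i a d)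
    (hv : OffSide v i) : v = b ∨ v = c := by
  revert hi hv
  rcases h with ⟨rfl, rfl, rfl⟩ | ⟨rfl, rfl, rfl⟩ <;> revert a i v <;>
    unfold JoinsVertices OffSide <;> decide

lemma Cyclic.offSide_bottom {a b c d i v} (h : Cyclic a b c d) (hi : JoinsVertices i a b)
    (hv : OffSide v i) : v = c ∨ v = d := by
  revert hi hv
  rcases h with ⟨rfl, rfl, rfl⟩ | ⟨rfl, rfl, rfl⟩ <;> revert a i v <;>
    unfold JoinsVertices OffSide <;> decide

/-- In the reflection in the side joining `b` and `c`, the vertex `a` moves to the other side of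
`b`, and `d` to the other side of `c`. -/
lemma Cyclic.square_refl {a b c d j} (h : Cyclic a b c d) (hj : JoinsVertices j b c)
    (F : Fin 4 → ℝ) : square.refl j F b = F b ∧ square.refl j F c = F c ∧
      square.refl j F a = 2 * F b - F a ∧ square.refl j F d = 2 * F c - F d := by
  have key : (b = j ∧ c = j + 1 ∧ d = j + 2 ∧ a = j + 3) ∨
      (b = j + 1 ∧ c = j ∧ d = j + 3 ∧ a = j + 2) := by
    revert hj
    rcases h with ⟨rfl, rfl, rfl⟩ | ⟨rfl, rfl, rfl⟩ <;> revert a j <;>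
      unfold JoinsVertices <;> decide
  obtain ⟨i1, i2, i3, i12, i13, i23⟩ := ne_fin4 j
  have e1 := square.refl_left j F
  have e2 := square.refl_right j F
  have e3 : square.refl j F (j + 2) = 2 * F (j + 1) - F (j + 2) := by
    simp [UnfoldingModel.square_refl]
  have e4 : square.refl j F (j + 3) = 2 * F j - F (j + 3) := by
    simp [UnfoldingModel.square_refl, i23.symm]
  rcases key with ⟨rfl, rfl, rfl, rfl⟩ | ⟨rfl, rfl, rfl, rfl⟩
  · exact ⟨e1, e2, e4, e3⟩
  · exact ⟨e2, e1, e3, e4⟩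

/-- The vertices `a`, `b`, `c`, `d` are the lower left, lower right, upper right and upper left
corner of the unit square at `(p, q)`. -/
def SquareCell (X Y : Fin 4 → ℝ) (p q : ℤ) (a b c d : Fin 4) : Prop :=
  Cyclic a b c d ∧ At X Y a p q ∧ At X Y b (p + 1) q ∧ At X Y c (p + 1) (q + 1) ∧
    At X Y d p (q + 1)

/-- The position of a line in the tiling by unit squares after `k` crossings. The last side that
has been crossed is the left or the lower one. -/
def SquareState (α β : ℝ) (k : ℕ) (X Y : Fin 4 → ℝ) (i : Fin 4) : Prop :=
  ∃ a b c d, ∃ p q : ℤ, GridCell α β p q ∧ SquareCell X Y p q a b c d ∧ (k : ℤ) = p + q ∧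
    ((JoinsVertices i a d ∧ β * q < α * p) ∨ (JoinsVertices i a b ∧ α * p < β * q))

lemma SquareCell.right {X Y p q a b c d j} (h : SquareCell X Y p q a b c d)
    (hj : JoinsVertices j b c) :
    SquareCell (square.refl j X) (square.refl j Y) (p + 1) q b a d c := by
  obtain ⟨h, ha, hb, hc, hd⟩ := h
  obtain ⟨x1, x2, x3, x4⟩ := h.square_refl hj X
  obtain ⟨y1, y2, y3, y4⟩ := h.square_refl hj Y
  refine ⟨h.right, ?_, ?_, ?_, ?_⟩ <;> unfold At at *
  · rw [x1, y1, hb.1, hb.2]; push_cast; exact ⟨rfl, rfl⟩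
  · rw [x3, y3, hb.1, hb.2, ha.1, ha.2]; push_cast; constructor <;> ring
  · rw [x4, y4, hc.1, hc.2, hd.1, hd.2]; push_cast; constructor <;> ring
  · rw [x2, y2, hc.1, hc.2]; push_cast; exact ⟨rfl, rfl⟩

lemma SquareCell.up {X Y p q a b c d j} (h : SquareCell X Y p q a b c d)
    (hj : JoinsVertices j c d) :
    SquareCell (square.refl j X) (square.refl j Y) p (q + 1) d c b a := by
  obtain ⟨h, ha, hb, hc, hd⟩ := h
  obtain ⟨x1, x2, x3, x4⟩ := h.transpose.square_refl hj.symm X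
  obtain ⟨y1, y2, y3, y4⟩ := h.transpose.square_refl hj.symm Y
  refine ⟨h.up, ?_, ?_, ?_, ?_⟩ <;> unfold At at *
  · rw [x1, y1, hd.1, hd.2]; push_cast; exact ⟨rfl, rfl⟩
  · rw [x2, y2, hc.1, hc.2]; push_cast; exact ⟨rfl, rfl⟩
  · rw [x4, y4, hc.1, hc.2, hb.1, hb.2]; push_cast; constructor <;> ring
  · rw [x3, y3, hd.1, hd.2, ha.1, ha.2]; push_cast; constructor <;> ring

/-- A line which leaves a unit square through its right or upper side. -/
lemma SquareCell.advance {α β : ℝ} (hα : 0 < α) (hβ : 0 < β) {k : ℕ} {X Y p q a b c d j}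
    (hg : GridCell α β p q) (h : SquareCell X Y p q a b c d) (hk : (k : ℤ) = p + q)
    (hc : Crosses (β • Y - α • X) j) (hj : JoinsVertices j b c ∨ JoinsVertices j c d) :
    SquareState α β (k + 1) (square.refl j X) (square.refl j Y) j := by
  have hb := hg.below
  have ha := hg.above
  rcases hj with hj | hj
  · rw [hj.crosses, h.2.2.1.eval, h.2.2.2.1.eval] at hc
    refine ⟨b, a, d, c, p + 1, q, hg.right hα hβ ?_, h.right hj, by push_cast; linarith,
      Or.inl ⟨hj, by push_cast; exact hb⟩⟩
    nlinarith
  · rw [hj.crosses, h.2.2.2.1.eval, h.2.2.2.2.eval] at hc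
    refine ⟨d, c, b, a, p, q + 1, hg.up hβ ?_, h.up hj, by push_cast; linarith,
      Or.inr ⟨hj.symm, by push_cast; exact ha⟩⟩
    nlinarith

lemma SquareState.step {α β : ℝ} (hα : 0 < α) (hβ : 0 < β) (k X Y i j)
    (h : SquareState α β k X Y i) (hj : j ≠ i) (hc : Crosses (β • Y - α • X) j) :
    SquareState α β (k + 1) (square.refl j X) (square.refl j Y) j := by
  obtain ⟨a, b, c, d, p, q, hg, h, hk, hs⟩ := h
  have hb := hg.below
  have ha := hg.above
  refine h.advance hα hβ hg hk hc ?_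
  rcases h.1.side_cases j with hj' | hj' | hj' | hj'
  · exfalso
    rcases hs with ⟨hi, hs⟩ | ⟨hi, hs⟩
    · rw [hj'.crosses, h.2.1.eval, h.2.2.1.eval] at hc
      nlinarith
    · exact hj (hj'.unique hi)
  · exact Or.inl hj'
  · exact Or.inr hj'
  · exfalso
    rcases hs with ⟨hi, hs⟩ | ⟨hi, hs⟩
    · exact hj (hj'.unique hi)
    · rw [hj'.crosses, h.2.1.eval, h.2.2.2.2.eval] at hc
      nlinarith

/-- The coordinate along the side from `c` to `c + 1`. -/
def squareX (c : Fin 4) : Fin 4 → ℝ := fun v => if v = c + 1 ∨ v = c + 2 then 1 else 0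

/-- The coordinate along the side from `c` to `c + 3`. -/
def squareY (c : Fin 4) : Fin 4 → ℝ := fun v => if v = c + 2 ∨ v = c + 3 then 1 else 0

lemma squareCell_corner (c : Fin 4) :
    SquareCell (squareX c) (squareY c) (0 : ℤ) (0 : ℤ) c (c + 1) (c + 2) (c + 3) := by
  obtain ⟨i1, i2, i3, i12, i13, i23⟩ := ne_fin4 c
  refine ⟨Or.inl ⟨rfl, rfl, rfl⟩, ?_, ?_, ?_, ?_⟩ <;>
    simp [At, squareX, squareY, i12, i13, i23, i12.symm, i13.symm, i23.symm,
      i1.symm, i2.symm, i3.symm]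

lemma squareX_mem (c : Fin 4) : squareX c ∈ square.V := by
  change squareX c 0 + squareX c 2 = squareX c 1 + squareX c 3
  fin_cases c <;> simp [squareX]

lemma squareY_mem (c : Fin 4) : squareY c ∈ square.V := by
  change squareY c 0 + squareY c 2 = squareY c 1 + squareY c 3
  fin_cases c <;> simp [squareY]

lemma offSide_fin4_iff {c i : Fin 4} : OffSide c i ↔ i = c + 1 ∨ i = c + 2 := by
  revert c i; unfold OffSide; decide

lemma cornerData_square (c : Fin 4) :
    square.CornerData c (squareX c) (squareY c) (fun x y => x + y) 2 := by
  obtain ⟨-, h0, h1, h2, h3⟩ := squareCell_corner c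
  have e0 := fun α β => h0.eval α β
  have e1 := fun α β => h1.eval α β
  have e2 := fun α β => h2.eval α β
  have e3 := fun α β => h3.eval α β
  push_cast at e0 e1 e2 e3
  simp only [mul_zero, zero_add, mul_one, sub_zero, zero_sub] at e0 e1 e2 e3
  obtain ⟨a1, a2, a3⟩ := add_fin4 c
  have follow : ∀ α β : ℝ, 0 < α → 0 < β → ∀ i w, (i :: w).IsChain (· ≠ ·) → OffSide c i →
      square.Run (i :: w) (β • squareY c - α • squareX c) →
      ∃ l, (i :: w).getLast? = some l ∧ SquareState α β (i :: w).length
        (square.fold (i :: w) (squareX c)) (square.fold (i :: w) (squareY c)) l := by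
    intro α β hα hβ i w hw hi hr
    have hI : SquareState α β (0 + 1) (square.refl i (squareX c)) (square.refl i (squareY c)) i := by
      refine (squareCell_corner c).advance hα hβ (GridCell.zero hα hβ) (by norm_num) hr.1 ?_
      rcases offSide_fin4_iff.1 hi with rfl | rfl
      · exact Or.inl (Or.inl ⟨rfl, a1.symm⟩)
      · exact Or.inr (Or.inl ⟨rfl, a2.symm⟩)
    obtain ⟨l, hl, hI⟩ := exists_invariant_of_run square (SquareState.step hα hβ) hI hw
      (by simpa only [map_sub, map_smul] using hr.2)
    refine ⟨l, hl, ?_⟩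
    rwa [zero_add, add_comm] at hI
  have signs : ∀ F ∈ square.V, F c = 0 → F (c + 2) = F (c + 1) + F (c + 3) := by
    intro F hF h0
    have := parallelogramValues_add_three hF c
    linarith
  refine ⟨squareX_mem c, squareY_mem c, by simpa using h0.1, by simpa using h0.2, ?_, ?_, ?_, ?_, ?_⟩
  · intro F hF hz i hi hc
    have hs := signs F hF hz
    have hlin : ∀ s α β : ℝ, F (c + 1) = s * -α → F (c + 3) = s * β →
        F = s • (β • squareY c - α • squareX c) := by
      intro s α β h1 h3
      ext v
      have hv : v = c ∨ v = c + 1 ∨ v = c + 2 ∨ v = c + 3 := by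
        clear * -; revert v c; decide
      rw [Pi.smul_apply, smul_eq_mul]
      rcases hv with rfl | rfl | rfl | rfl
      · rw [hz, e0]; ring
      · rw [h1, e1]
      · rw [hs, h1, h3, e2]; ring
      · rw [h3, e3]
    have hop : F (c + 1) < 0 ∧ 0 < F (c + 3) ∨ 0 < F (c + 1) ∧ F (c + 3) < 0 := by
      unfold Crosses at hc
      rcases offSide_fin4_iff.1 hi with rfl | rfl
      · rw [a1] at hc
        rcases mul_neg_iff.1 hc with ⟨h, h'⟩ | ⟨h, h'⟩
        · exact Or.inr ⟨h, by linarith⟩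
        · exact Or.inl ⟨h, by linarith⟩
      · rw [a2] at hc
        rcases mul_neg_iff.1 hc with ⟨h, h'⟩ | ⟨h, h'⟩
        · exact Or.inr ⟨by linarith, h'⟩
        · exact Or.inl ⟨by linarith, h'⟩
    rcases hop with ⟨h, h'⟩ | ⟨h, h'⟩
    · exact ⟨-F (c + 1), F (c + 3), 1, by linarith, h', one_ne_zero,
        hlin _ _ _ (by ring) (by ring)⟩
    · exact ⟨F (c + 1), -F (c + 3), -1, h, by linarith, by norm_num,
        hlin _ _ _ (by ring) (by ring)⟩
  · intro α β hα hβ hne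
    rcases lt_or_gt_of_ne hne with h | h
    · refine ⟨c + 1, offSide_fin4_iff.2 (Or.inl rfl), ?_⟩
      rw [Crosses, a1, e1, e2]
      nlinarith
    · refine ⟨c + 2, offSide_fin4_iff.2 (Or.inr rfl), ?_⟩
      rw [Crosses, a2, e2, e3]
      nlinarith
  · intro F hF hz i j hi hj hci hcj
    have hs := signs F hF hz
    unfold Crosses at hci hcj
    rcases offSide_fin4_iff.1 hi with rfl | rfl <;> rcases offSide_fin4_iff.1 hj with rfl | rfl
    · rfl
    · exfalso
      rw [a1] at hci
      rw [a2] at hcj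
      rcases mul_neg_iff.1 hci with h | h <;> rcases mul_neg_iff.1 hcj with h' | h' <;> linarith
    · exfalso
      rw [a2] at hci
      rw [a1] at hcj
      rcases mul_neg_iff.1 hci with h | h <;> rcases mul_neg_iff.1 hcj with h' | h' <;> linarith
    · rfl
  · intro α β hα hβ i w v hw hi hr hv hz
    obtain ⟨l, hl, a, b, c, d, p, q, hg, ⟨hcy, ha, hb, hc, hd⟩, hk, hs⟩ :=
      follow α β hα hβ i w hw hi hr
    have hp := hg.nonneg_left
    have hq := hg.nonneg_right
    have hbe := hg.below
    have hab := hg.above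
    have hvl := hv l hl
    rw [map_sub, map_smul, map_smul] at hz
    have hvc : v = c := by
      rcases hs with ⟨hj, hs⟩ | ⟨hj, hs⟩
      · rcases hcy.offSide_left hj hvl with rfl | rfl
        · rw [hb.eval] at hz; linarith
        · rfl
      · rcases hcy.offSide_bottom hj hvl with rfl | rfl
        · rfl
        · rw [hd.eval] at hz; linarith
    subst hvc
    have e1 : ((p + 1).toNat : ℤ) = p + 1 := Int.toNat_of_nonneg (by omega)
    have e2 : ((q + 1).toNat : ℤ) = q + 1 := Int.toNat_of_nonneg (by omega)
    have e1' : ((p + 1).toNat : ℝ) = p + 1 := by exact_mod_cast e1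
    have e2' : ((q + 1).toNat : ℝ) = q + 1 := by exact_mod_cast e2
    exact ⟨(p + 1).toNat, (q + 1).toNat, by omega, by omega, hc.1.trans e1'.symm,
      hc.2.trans e2'.symm, by omega⟩
  · intro α β hα hβ i w hw hi hr x y hx hy hxy
    obtain ⟨l, hl, a, b, c, d, p, q, hg, -, hk, -⟩ := follow α β hα hβ i w hw hi hr
    obtain ⟨h1, h2⟩ := hg.lt_of_mem hα hβ hx hxy
    omega

end UnfoldingModel
end PolygonalBilliard

namespace PolygonalBilliard

/-! ### Counting coprime pairs -/

/-- Pairs of positive integers of height at most `N`. -/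
def pairs (h : ℕ → ℕ → ℕ) (N : ℕ) : Set (ℕ × ℕ) := {z | 0 < z.1 ∧ 0 < z.2 ∧ h z.1 z.2 ≤ N}

section moebius

variable {h : ℕ → ℕ → ℕ} (hx : ∀ x y, x ≤ h x y) (hy : ∀ x y, y ≤ h x y)
include hx hy

lemma pairs_subset (N : ℕ) : pairs h N ⊆ (Finset.Icc 1 N ×ˢ Finset.Icc 1 N : Finset (ℕ × ℕ)) := by
  rintro ⟨x, y⟩ ⟨h1, h2, h3⟩
  have := hx x y
  have := hy x y
  simp only at h1 h2 h3
  simp only [Finset.coe_product, Finset.coe_Icc, Set.mem_prod, Set.mem_Icc]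
  omega

lemma finite_pairs (N : ℕ) : (pairs h N).Finite := (Finset.finite_toSet _).subset (pairs_subset hx hy N)

lemma ncard_pairs_le (N : ℕ) : (pairs h N).ncard ≤ N ^ 2 := by
  refine (Set.ncard_le_ncard (pairs_subset hx hy N) (Finset.finite_toSet _)).trans ?_
  rw [Set.ncard_coe_finset, Finset.card_product, Nat.card_Icc]
  simp [sq]

/-- Möbius inversion over the greatest common divisor. -/
lemma ncard_primitive_eq (hh : ∀ d x y, h (d * x) (d * y) = d * h x y) (N : ℕ) :
    ((UnfoldingModel.primitive h N).ncard : ℤ) =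
      ∑ d ∈ Finset.Icc 1 N, ArithmeticFunction.moebius d * ((pairs h (N / d)).ncard : ℤ) := by
  classical
  set S := (finite_pairs hx hy N).toFinset with hS
  have mS : ∀ z, z ∈ S ↔ z ∈ pairs h N := fun z => Set.Finite.mem_toFinset _
  have h1 : UnfoldingModel.primitive h N = (S.filter fun z => Nat.gcd z.1 z.2 = 1 : Finset _) := by
    ext z
    simp only [Finset.coe_filter, mS, pairs, UnfoldingModel.primitive, Set.mem_ofPred_eq,
      Nat.Coprime]
    tauto
  have h2 : ∀ z ∈ S, (if Nat.gcd z.1 z.2 = 1 then (1 : ℤ) else 0) =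
      ∑ d ∈ Finset.Icc 1 N, if d ∣ z.1 ∧ d ∣ z.2 then ArithmeticFunction.moebius d else 0 := by
    intro z hz
    have hz' := pairs_subset hx hy N ((mS z).1 hz)
    simp only [Finset.coe_product, Finset.coe_Icc, Set.mem_prod, Set.mem_Icc] at hz'
    rw [← Finset.sum_filter]
    have h3 : (Finset.Icc 1 N).filter (fun d => d ∣ z.1 ∧ d ∣ z.2) = (Nat.gcd z.1 z.2).divisors := by
      ext d
      simp only [Finset.mem_filter, Finset.mem_Icc, Nat.mem_divisors, Nat.dvd_gcd_iff]
      constructor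
      · rintro ⟨_, hd⟩
        exact ⟨hd, Nat.gcd_ne_zero_left (by omega)⟩
      · rintro ⟨hd, _⟩
        have := Nat.le_of_dvd (by omega) hd.1
        have := Nat.pos_of_dvd_of_pos hd.1 (by omega)
        exact ⟨by omega, hd⟩
    rw [h3, ← ArithmeticFunction.coe_mul_zeta_apply, ArithmeticFunction.moebius_mul_coe_zeta,
      ArithmeticFunction.one_apply]
  rw [h1, Set.ncard_coe_finset, Finset.card_filter]
  push_cast
  rw [Finset.sum_congr rfl h2, Finset.sum_comm]
  refine Finset.sum_congr rfl fun d hd => ?_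
  have hd0 : 0 < d := by simp only [Finset.mem_Icc] at hd; omega
  rw [← Finset.sum_filter, Finset.sum_const, nsmul_eq_mul, mul_comm]
  congr 2
  rw [← Set.ncard_coe_finset]
  have h4 : ((S.filter fun z => d ∣ z.1 ∧ d ∣ z.2 : Finset _) : Set (ℕ × ℕ)) =
      (fun z : ℕ × ℕ => (d * z.1, d * z.2)) '' pairs h (N / d) := by
    ext ⟨x, y⟩
    simp only [Finset.coe_filter, mS, pairs, Set.mem_ofPred_eq, Set.mem_image, Prod.exists,
      Prod.mk.injEq]
    constructor
    · rintro ⟨⟨h5, h6, h7⟩, ⟨x, rfl⟩, ⟨y, rfl⟩⟩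
      refine ⟨x, y, ⟨Nat.pos_of_mul_pos_left h5, Nat.pos_of_mul_pos_left h6, ?_⟩, rfl, rfl⟩
      rw [Nat.le_div_iff_mul_le hd0, mul_comm, ← hh]
      exact h7
    · rintro ⟨x, y, ⟨h5, h6, h7⟩, rfl, rfl⟩
      refine ⟨⟨Nat.mul_pos hd0 h5, Nat.mul_pos hd0 h6, ?_⟩, dvd_mul_right d x, dvd_mul_right d y⟩
      rwa [Nat.le_div_iff_mul_le hd0, mul_comm, ← hh] at h7
  rw [h4, Set.ncard_image_of_injective]
  rintro ⟨x, y⟩ ⟨x', y'⟩ he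
  simp only [Prod.mk.injEq] at he
  rw [Nat.eq_of_mul_eq_mul_left hd0 he.1, Nat.eq_of_mul_eq_mul_left hd0 he.2]

end moebius

lemma tsum_moebius_div_sq :
    ∑' d : ℕ, (ArithmeticFunction.moebius d : ℝ) / (d : ℝ) ^ 2 = 6 / Real.pi ^ 2 := by
  have h := ArithmeticFunction.LSeries_zeta_mul_Lseries_moebius (s := 2) (by norm_num)
  rw [ArithmeticFunction.LSeries_zeta_eq_riemannZeta (by norm_num), riemannZeta_two] at h
  have h2 : LSeries (fun n => (ArithmeticFunction.moebius n : ℂ)) 2 =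
      ((∑' d : ℕ, (ArithmeticFunction.moebius d : ℝ) / (d : ℝ) ^ 2 : ℝ) : ℂ) := by
    rw [Complex.ofReal_tsum]
    refine tsum_congr fun d => ?_
    rw [LSeries.term_def]
    split_ifs with hd
    · simp [hd]
    · push_cast
      congr 1
      exact_mod_cast Complex.cpow_natCast (d : ℂ) 2
  rw [h2] at h
  have h3 : Real.pi ^ 2 / 6 * ∑' d : ℕ, (ArithmeticFunction.moebius d : ℝ) / (d : ℝ) ^ 2 = 1 := by
    exact_mod_cast h
  have : Real.pi ^ 2 ≠ 0 := pow_ne_zero _ Real.pi_ne_zero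
  field_simp at h3 ⊢
  linarith

lemma tendsto_natDiv_div (d : ℕ) : Tendsto (fun N : ℕ => ((N / d : ℕ) : ℝ) / N) atTop (𝓝 (1 / d)) := by
  have h := (tendsto_nat_floor_mul_div_atTop (R := ℝ) (a := 1 / d) (by positivity)).comp
    tendsto_natCast_atTop_atTop
  refine h.congr fun N => ?_
  simp only [Function.comp_apply]
  rw [one_div, mul_comm, ← div_eq_mul_inv, Nat.floor_div_eq_div]

/-- The density of coprime pairs: if there are about `κ N ^ 2` pairs of height at most `N`, then the
proportion `6 / π ^ 2` of them is coprime. -/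
lemma tendsto_primitive {h : ℕ → ℕ → ℕ} (hx : ∀ x y, x ≤ h x y) (hy : ∀ x y, y ≤ h x y)
    (hh : ∀ d x y, h (d * x) (d * y) = d * h x y) {κ : ℝ}
    (hκ : Tendsto (fun N : ℕ => ((pairs h N).ncard : ℝ) / (N : ℝ) ^ 2) atTop (𝓝 κ)) :
    Tendsto (fun N : ℕ => ((UnfoldingModel.primitive h N).ncard : ℝ) / (N : ℝ) ^ 2) atTop
      (𝓝 (κ * (6 / Real.pi ^ 2))) := by
  set f : ℕ → ℕ → ℝ := fun N d =>
    ArithmeticFunction.moebius d * (((pairs h (N / d)).ncard : ℝ) / (N : ℝ) ^ 2) with hf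
  have hpos : pairs h 0 = ∅ := by
    rw [Set.eq_empty_iff_forall_notMem]
    rintro ⟨x, y⟩ ⟨h1, _, h3⟩
    have := hx x y
    simp only at h1 h3
    omega
  have h1 : ∀ N : ℕ, ∑' d, f N d = ((UnfoldingModel.primitive h N).ncard : ℝ) / (N : ℝ) ^ 2 := by
    intro N
    have h2 := ncard_primitive_eq hx hy hh N
    rw [tsum_eq_sum (s := Finset.Icc 1 N)]
    · have h3 : ((UnfoldingModel.primitive h N).ncard : ℝ) = ∑ d ∈ Finset.Icc 1 N,
          (ArithmeticFunction.moebius d : ℝ) * ((pairs h (N / d)).ncard : ℝ) := by exact_mod_cast h2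
      rw [h3, Finset.sum_div]
      exact Finset.sum_congr rfl fun d _ => by rw [hf]; ring
    · intro d hd
      have h3 : N / d = 0 := by
        rw [Nat.div_eq_zero_iff]
        simp only [Finset.mem_Icc] at hd
        omega
      simp [hf, h3, hpos]
  have h2 : ∀ d : ℕ, Tendsto (fun N => f N d) atTop
      (𝓝 (κ * ((ArithmeticFunction.moebius d : ℝ) / (d : ℝ) ^ 2))) := by
    intro d
    rcases Nat.eq_zero_or_pos d with rfl | hd
    · simp [hf]
    have h3 := (hκ.comp (Nat.tendsto_div_const_atTop hd.ne')).mul ((tendsto_natDiv_div d).pow 2)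
    have h4 := h3.const_mul (ArithmeticFunction.moebius d : ℝ)
    convert h4.congr' _ using 2
    · ring
    · filter_upwards [eventually_ge_atTop d] with N hN
      have h5 : ((N / d : ℕ) : ℝ) ≠ 0 := by
        have := Nat.div_pos hN hd
        exact_mod_cast this.ne'
      simp only [Function.comp_apply, hf]
      field_simp
  have h3 : Summable fun d : ℕ => 1 / (d : ℝ) ^ 2 := Real.summable_one_div_nat_pow.2 one_lt_two
  have key := tendsto_tsum_of_dominated_convergence (f := f) h3 h2 (Eventually.of_forall ?_)
  · simp only [h1] at key
    rwa [tsum_mul_left, tsum_moebius_div_sq] at key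
  · intro N d
    rcases Nat.eq_zero_or_pos d with rfl | hd
    · simp [hf]
    rcases Nat.eq_zero_or_pos N with rfl | hN
    · simp [hf]
    have e1 : |(ArithmeticFunction.moebius d : ℝ)| ≤ 1 := by
      exact_mod_cast ArithmeticFunction.abs_moebius_le_one (n := d)
    have e2 : ((pairs h (N / d)).ncard : ℝ) ≤ ((N : ℝ) / d) ^ 2 := by
      have : ((pairs h (N / d)).ncard : ℝ) ≤ ((N / d : ℕ) : ℝ) ^ 2 := by
        exact_mod_cast ncard_pairs_le hx hy (N / d)
      refine this.trans ?_
      gcongr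
      exact Nat.cast_div_le
    have hN' : (0 : ℝ) < N := by exact_mod_cast hN
    have hd' : (0 : ℝ) < d := by exact_mod_cast hd
    rw [hf, Real.norm_eq_abs, abs_mul, abs_of_nonneg (a := ((pairs h (N / d)).ncard : ℝ) / (N : ℝ) ^ 2)
      (by positivity)]
    calc _ ≤ 1 * (((N : ℝ) / d) ^ 2 / (N : ℝ) ^ 2) := by gcongr
      _ = _ := by field_simp

/-! ### Heights -/

/-- Removing the lowest row of the lattice triangle `a x + b y ≤ N + b`. -/
lemma ncard_pairs_linear_add {a b : ℕ} (ha : 0 < a) (hb : 0 < b) (N : ℕ) :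
    (pairs (fun x y => a * x + b * y) (N + b)).ncard =
      N / a + (pairs (fun x y => a * x + b * y) N).ncard := by
  have hx : ∀ x y, x ≤ a * x + b * y := fun x y => by
    have := Nat.le_mul_of_pos_left x ha
    omega
  have hy : ∀ x y, y ≤ a * x + b * y := fun x y => by
    have := Nat.le_mul_of_pos_left y hb
    omega
  have h1 : pairs (fun x y => a * x + b * y) (N + b) =
      (fun x => (x, 1)) '' (Set.Icc 1 (N / a)) ∪
        (fun z => (z.1, z.2 + 1)) '' pairs (fun x y => a * x + b * y) N := by
    ext ⟨x, y⟩
    simp only [pairs, Set.mem_ofPred_eq, Set.mem_union, Set.mem_image, Set.mem_Icc, Prod.mk.injEq,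
      Prod.exists]
    constructor
    · rintro ⟨h1, h2, h3⟩
      obtain ⟨y, rfl⟩ : ∃ y', y = y' + 1 := ⟨y - 1, by omega⟩
      rw [mul_add] at h3
      rcases Nat.eq_zero_or_pos y with rfl | hy
      · refine Or.inl ⟨x, ⟨h1, ?_⟩, rfl, rfl⟩
        rw [Nat.le_div_iff_mul_le ha, mul_comm]
        omega
      · exact Or.inr ⟨x, y, ⟨h1, hy, by omega⟩, rfl, rfl⟩
    · rintro (⟨x, ⟨h1, h2⟩, rfl, rfl⟩ | ⟨x, y, ⟨h1, h2, h3⟩, rfl, rfl⟩)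
      · rw [Nat.le_div_iff_mul_le ha, mul_comm] at h2
        exact ⟨h1, one_pos, by omega⟩
      · refine ⟨h1, Nat.succ_pos y, ?_⟩
        rw [mul_add]
        omega
  have h2 : Disjoint ((fun x => (x, 1)) '' (Set.Icc 1 (N / a)))
      ((fun z : ℕ × ℕ => (z.1, z.2 + 1)) '' pairs (fun x y => a * x + b * y) N) := by
    rw [Set.disjoint_left]
    rintro _ ⟨x, _, rfl⟩ ⟨⟨x', y'⟩, ⟨_, h2, _⟩, h3⟩
    simp only [Prod.mk.injEq] at h2 h3
    omega
  have h3 : Function.Injective fun z : ℕ × ℕ => (z.1, z.2 + 1) := by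
    rintro ⟨x, y⟩ ⟨x', y'⟩ h
    simpa using h
  have h4 : Function.Injective fun x : ℕ => (x, 1) := by
    intro x x' h
    simpa using h
  rw [h1, Set.ncard_union_eq h2 ((Set.finite_Icc _ _).image _) ((finite_pairs hx hy N).image _),
    Set.ncard_image_of_injective _ h3, Set.ncard_image_of_injective _ h4, ← Finset.coe_Icc,
    Set.ncard_coe_finset, Nat.card_Icc, Nat.add_sub_cancel, add_comm]

lemma abs_ncard_pairs_linear_sub_le {a b : ℕ} (ha : 0 < a) (hb : 0 < b) (N : ℕ) :
    |((pairs (fun x y => a * x + b * y) N).ncard : ℝ) - (N : ℝ) ^ 2 / (2 * a * b)| ≤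
      ((1 : ℝ) + b) * ((N : ℝ) + 1) := by
  have ha' : (1 : ℝ) ≤ a := by exact_mod_cast ha
  have hb' : (1 : ℝ) ≤ b := by exact_mod_cast hb
  induction N using Nat.strong_induction_on with
  | _ N ih =>
    rcases lt_or_ge N b with hN | hN
    · have : pairs (fun x y => a * x + b * y) N = ∅ := by
        rw [Set.eq_empty_iff_forall_notMem]
        rintro ⟨x, y⟩ ⟨_, h2, h3⟩
        have := Nat.le_mul_of_pos_right b h2
        simp only at this h3
        omega
      have hN' : (N : ℝ) ≤ b := by exact_mod_cast hN.le
      have hN0 : (0 : ℝ) ≤ N := Nat.cast_nonneg N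
      rw [this, Set.ncard_empty, Nat.cast_zero, zero_sub, abs_neg, abs_of_nonneg (by positivity),
        div_le_iff₀ (by positivity)]
      have e1 : (N : ℝ) ^ 2 ≤ N * b := by nlinarith
      have e2 : (N : ℝ) * b ≤ (N + 1) * b * ((1 + b) * (2 * a)) := by
        have e3 : (1 : ℝ) ≤ (1 + b) * (2 * a) := by nlinarith
        calc (N : ℝ) * b ≤ (N + 1) * b := by nlinarith
          _ ≤ _ := le_mul_of_one_le_right (by positivity) e3
      linarith
    · obtain ⟨M, rfl⟩ := Nat.exists_eq_add_of_le' hN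
      have h1 := ih M (by omega)
      rw [ncard_pairs_linear_add ha hb]
      have h2 : ((M / a : ℕ) : ℝ) ≤ (M : ℝ) / a := Nat.cast_div_le
      have h3 : (M : ℝ) / a - 1 < ((M / a : ℕ) : ℝ) := by
        rw [← Nat.floor_div_eq_div (K := ℝ)]
        exact Nat.sub_one_lt_floor _
      have h4 : ((M + b : ℕ) : ℝ) ^ 2 / (2 * a * b) =
          (M : ℝ) ^ 2 / (2 * a * b) + M / a + b / (2 * a) := by
        push_cast
        field_simp
        ring
      have h5 : (b : ℝ) / (2 * a) ≤ b := div_le_self (by positivity) (by linarith)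
      have h6 : 0 ≤ (b : ℝ) / (2 * a) := by positivity
      rw [h4]
      push_cast
      rw [abs_le] at h1 ⊢
      constructor <;> nlinarith

lemma tendsto_ncard_pairs_linear {a b : ℕ} (ha : 0 < a) (hb : 0 < b) :
    Tendsto (fun N : ℕ => ((pairs (fun x y => a * x + b * y) N).ncard : ℝ) / (N : ℝ) ^ 2) atTop
      (𝓝 (1 / (2 * a * b))) := by
  rw [tendsto_iff_norm_sub_tendsto_zero]
  have h1 : Tendsto (fun N : ℕ => (1 + b : ℝ) * (1 / N + (1 / N) ^ 2)) atTop (𝓝 0) := by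
    have h := tendsto_one_div_atTop_nhds_zero_nat (𝕜 := ℝ)
    simpa using (h.add (h.pow 2)).const_mul (1 + b : ℝ)
  refine squeeze_zero' (Eventually.of_forall fun N => norm_nonneg _) ?_ h1
  filter_upwards [eventually_gt_atTop 0] with N hN
  have hN' : (0 : ℝ) < N := by exact_mod_cast hN
  have h2 := abs_ncard_pairs_linear_sub_le ha hb N
  have h3 : ((pairs (fun x y => a * x + b * y) N).ncard : ℝ) / (N : ℝ) ^ 2 - 1 / (2 * a * b) =
      (((pairs (fun x y => a * x + b * y) N).ncard : ℝ) - (N : ℝ) ^ 2 / (2 * a * b)) /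
        (N : ℝ) ^ 2 := by
    field_simp
  rw [h3, Real.norm_eq_abs, abs_div, abs_of_pos (a := (N : ℝ) ^ 2) (by positivity),
    div_le_iff₀ (by positivity)]
  refine h2.trans (le_of_eq ?_)
  field_simp

lemma tendsto_primitive_linear {a b : ℕ} (ha : 0 < a) (hb : 0 < b) :
    Tendsto (fun N : ℕ => ((UnfoldingModel.primitive (fun x y => a * x + b * y) N).ncard : ℝ) /
      (N : ℝ) ^ 2) atTop (𝓝 (3 / (a * b * Real.pi ^ 2))) := by
  have h := tendsto_primitive (h := fun x y => a * x + b * y) (fun x y => ?_) (fun x y => ?_)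
    (fun d x y => by ring) (tendsto_ncard_pairs_linear ha hb)
  · convert h using 2
    have := Real.pi_ne_zero
    field_simp
    norm_num
  · have := Nat.le_mul_of_pos_left x ha
    omega
  · have := Nat.le_mul_of_pos_left y hb
    omega

/-- The height at the right angle: the directions on both sides of the altitude contribute as the
directions at the acute vertices do. -/
lemma ncard_primitive_max {N : ℕ} (hN : 3 ≤ N) :
    (UnfoldingModel.primitive (fun x y => x + y + max x y) N).ncard =
      2 * (UnfoldingModel.primitive (fun x y => 2 * x + 3 * y) N).ncard + 1 := by
  have hfin : (UnfoldingModel.primitive (fun x y => 2 * x + 3 * y) N).Finite := by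
    refine (finite_pairs (h := fun x y => 2 * x + 3 * y) (fun x y => by omega)
      (fun x y => by omega) N).subset ?_
    rintro z ⟨h1, h2, _, h3⟩
    exact ⟨h1, h2, h3⟩
  have h1 : UnfoldingModel.primitive (fun x y => x + y + max x y) N =
      {(1, 1)} ∪ ((fun z : ℕ × ℕ => (z.1 + z.2, z.2)) ''
        UnfoldingModel.primitive (fun x y => 2 * x + 3 * y) N ∪
      (fun z : ℕ × ℕ => (z.2, z.1 + z.2)) ''
        UnfoldingModel.primitive (fun x y => 2 * x + 3 * y) N) := by
    ext ⟨x, y⟩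
    simp only [UnfoldingModel.primitive, Set.mem_ofPred_eq, Set.mem_union, Set.mem_image,
      Set.mem_singleton_iff, Prod.mk.injEq, Prod.exists]
    constructor
    · rintro ⟨h1, h2, h3, h4⟩
      rcases lt_trichotomy x y with h | h | h
      · obtain ⟨s, rfl⟩ := Nat.exists_eq_add_of_le' h.le
        rw [max_eq_right h.le] at h4
        refine Or.inr (Or.inr ⟨s, x, ⟨by omega, h1, ?_, by omega⟩, rfl, rfl⟩)
        simpa [Nat.coprime_comm] using h3
      · subst h
        rw [Nat.coprime_self] at h3
        exact Or.inl ⟨h3, h3⟩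
      · obtain ⟨s, rfl⟩ := Nat.exists_eq_add_of_le' h.le
        rw [max_eq_left h.le] at h4
        refine Or.inr (Or.inl ⟨s, y, ⟨by omega, h2, ?_, by omega⟩, rfl, rfl⟩)
        simpa using h3
    · rintro (⟨rfl, rfl⟩ | ⟨s, y, ⟨h1, h2, h3, h4⟩, rfl, rfl⟩ | ⟨s, y, ⟨h1, h2, h3, h4⟩, rfl, rfl⟩)
      · exact ⟨one_pos, one_pos, Nat.coprime_one_left 1, by simpa using hN⟩
      · refine ⟨by omega, h2, by simpa using h3, ?_⟩
        rw [max_eq_left (by omega)]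
        omega
      · refine ⟨h2, by omega, by simpa [Nat.coprime_comm] using h3, ?_⟩
        rw [max_eq_right (by omega)]
        omega
  have h2 : Disjoint ((fun z : ℕ × ℕ => (z.1 + z.2, z.2)) ''
        UnfoldingModel.primitive (fun x y => 2 * x + 3 * y) N)
      ((fun z : ℕ × ℕ => (z.2, z.1 + z.2)) ''
        UnfoldingModel.primitive (fun x y => 2 * x + 3 * y) N) := by
    rw [Set.disjoint_left]
    rintro _ ⟨⟨x, y⟩, ⟨h2, h3, _⟩, rfl⟩ ⟨⟨x', y'⟩, ⟨h2', h3', _⟩, h⟩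
    simp only [Prod.mk.injEq] at h h2 h2'
    omega
  have h3 : Disjoint {((1, 1) : ℕ × ℕ)} ((fun z : ℕ × ℕ => (z.1 + z.2, z.2)) ''
        UnfoldingModel.primitive (fun x y => 2 * x + 3 * y) N ∪
      (fun z : ℕ × ℕ => (z.2, z.1 + z.2)) ''
        UnfoldingModel.primitive (fun x y => 2 * x + 3 * y) N) := by
    rw [Set.disjoint_left]
    rintro _ rfl
    rintro (⟨⟨x', y'⟩, ⟨h2', h3', _⟩, h⟩ | ⟨⟨x', y'⟩, ⟨h2', h3', _⟩, h⟩) <;>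
    · simp only [Prod.mk.injEq] at h h2'
      omega
  have h4 : Function.Injective fun z : ℕ × ℕ => (z.1 + z.2, z.2) := by
    rintro ⟨x, y⟩ ⟨x', y'⟩ h
    simp only [Prod.mk.injEq] at h ⊢
    omega
  have h5 : Function.Injective fun z : ℕ × ℕ => (z.2, z.1 + z.2) := by
    rintro ⟨x, y⟩ ⟨x', y'⟩ h
    simp only [Prod.mk.injEq] at h ⊢
    omega
  rw [h1, Set.ncard_union_eq h3 (Set.finite_singleton _) ((hfin.image _).union (hfin.image _)),
    Set.ncard_union_eq h2 (hfin.image _) (hfin.image _), Set.ncard_image_of_injective _ h4,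
    Set.ncard_image_of_injective _ h5, Set.ncard_singleton]
  omega

lemma tendsto_primitive_max :
    Tendsto (fun N : ℕ => ((UnfoldingModel.primitive (fun x y => x + y + max x y) N).ncard : ℝ) /
      (N : ℝ) ^ 2) atTop (𝓝 (1 / Real.pi ^ 2)) := by
  have h1 := (tendsto_primitive_linear (a := 2) (b := 3) two_pos three_pos).const_mul 2
  have h2 : Tendsto (fun N : ℕ => (1 / N : ℝ) ^ 2) atTop (𝓝 0) := by
    simpa using (tendsto_one_div_atTop_nhds_zero_nat (𝕜 := ℝ)).pow 2
  have h3 := h1.add h2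
  have e : (2 : ℝ) * (3 / (((2 : ℕ) : ℝ) * ((3 : ℕ) : ℝ) * Real.pi ^ 2)) + 0 = 1 / Real.pi ^ 2 := by
    have := Real.pi_ne_zero
    push_cast
    field_simp
    norm_num
  rw [e] at h3
  refine h3.congr' ?_
  filter_upwards [eventually_ge_atTop 3] with N hN
  rw [ncard_primitive_max hN]
  push_cast
  ring

lemma tendsto_primitive_two_mul :
    Tendsto (fun N : ℕ => ((UnfoldingModel.primitive (fun x y => 2 * (x + y)) N).ncard : ℝ) /
      (N : ℝ) ^ 2) atTop (𝓝 (3 / (4 * Real.pi ^ 2))) := by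
  have h1 := (tendsto_primitive_linear (a := 1) (b := 1) one_pos one_pos).comp
    (Nat.tendsto_div_const_atTop two_ne_zero)
  have h2 := h1.mul ((tendsto_natDiv_div 2).pow 2)
  convert h2.congr' _ using 2
  · have := Real.pi_ne_zero
    push_cast
    field_simp
    norm_num
  · filter_upwards [eventually_ge_atTop 2] with N hN
    have h5 : ((N / 2 : ℕ) : ℝ) ≠ 0 := by
      have := Nat.div_pos hN two_pos
      exact_mod_cast this.ne'
    have h6 : UnfoldingModel.primitive (fun x y => 1 * x + 1 * y) (N / 2) =
        UnfoldingModel.primitive (fun x y => 2 * (x + y)) N := by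
      ext z
      simp only [UnfoldingModel.primitive, Set.mem_ofPred_eq]
      rw [Nat.le_div_iff_mul_le two_pos]
      constructor <;> rintro ⟨h1, h2, h3, h4⟩ <;> exact ⟨h1, h2, h3, by omega⟩
    simp only [Function.comp_apply, h6]
    field_simp

end PolygonalBilliard

namespace PolygonalBilliard

/-! ### Cubic growth -/

/-- Summation of a sequence of quadratic growth. -/
lemma tendsto_div_cube {u v : ℕ → ℝ} {γ : ℝ} (h : ∀ n, 1 ≤ n → u (n + 1) = u n + v n)
    (hv : Tendsto (fun n : ℕ => v n / (n : ℝ) ^ 2) atTop (𝓝 γ)) :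
    Tendsto (fun n : ℕ => u n / (n : ℝ) ^ 3) atTop (𝓝 (γ / 3)) := by
  set g : ℕ → ℝ := fun i => ((i : ℝ) + 1) ^ 2 with hg
  set G : ℕ → ℝ := fun n => ∑ i ∈ Finset.range n, g i with hG
  have hGe : ∀ n, G n = n * (n + 1) * (2 * n + 1) / 6 := by
    intro n
    induction n with
    | zero => simp [hG]
    | succ n ih =>
      have : G (n + 1) = G n + g n := Finset.sum_range_succ _ _
      rw [this, ih, hg]
      push_cast
      ring
  have hGtop : Tendsto G atTop atTop := by
    refine tendsto_atTop_mono (fun n => ?_) tendsto_natCast_atTop_atTop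
    rw [hGe]
    rcases Nat.eq_zero_or_pos n with rfl | hn
    · simp
    · have : (1 : ℝ) ≤ n := by exact_mod_cast hn
      nlinarith [mul_nonneg (by linarith : (0 : ℝ) ≤ n) (by nlinarith : (0 : ℝ) ≤ (n - 1) * (n + 1)),
        mul_nonneg (by linarith : (0 : ℝ) ≤ n) (by linarith : (0 : ℝ) ≤ (n - 1 : ℝ))]
  have h1 : Tendsto (fun n : ℕ => 1 / ((n : ℝ) + 1)) atTop (𝓝 0) :=
    tendsto_one_div_add_atTop_nhds_zero_nat
  have hGlim : Tendsto (fun n : ℕ => G n / ((n : ℝ) + 1) ^ 3) atTop (𝓝 (1 / 3)) := by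
    have h2 := ((h1.const_sub 1).mul (h1.const_sub 2)).div_const 6
    convert h2 using 2 with n
    · rw [hGe]
      have : (n : ℝ) + 1 ≠ 0 := by positivity
      field_simp
      ring
    · norm_num
  have hlo : (fun i => v (i + 1) - γ * g i) =o[atTop] g := by
    rw [Asymptotics.isLittleO_iff_tendsto fun i hi => absurd hi (by simp only [hg]; positivity)]
    have h2 := ((tendsto_add_atTop_iff_nat 1).2 hv).sub_const γ
    rw [sub_self] at h2
    refine h2.congr fun i => ?_
    have : (i : ℝ) + 1 ≠ 0 := by positivity
    simp only [hg]
    push_cast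
    field_simp
  have hsum := hlo.sum_range (fun i => by simp only [hg]; positivity) hGtop
  have hu : ∀ n, u (n + 1) = u 1 + γ * G n + ∑ i ∈ Finset.range n, (v (i + 1) - γ * g i) := by
    intro n
    induction n with
    | zero => simp [hG]
    | succ n ih =>
      have : G (n + 1) = G n + g n := Finset.sum_range_succ _ _
      rw [h (n + 1) (by omega), ih, this, Finset.sum_range_succ]
      ring
  have h3 := hsum.tendsto_div_nhds_zero.mul hGlim
  have h4 := ((h1.pow 3).const_mul (u 1)).add ((hGlim.const_mul γ).add h3)
  rw [← tendsto_add_atTop_iff_nat 1]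
  convert h4.congr' _ using 2
  · ring
  · filter_upwards [eventually_gt_atTop 0] with n hn
    have hn' : (0 : ℝ) < n := by exact_mod_cast hn
    have hGn : G n ≠ 0 := by rw [hGe]; positivity
    have : (n : ℝ) + 1 ≠ 0 := by positivity
    have h5 : (∑ i ∈ Finset.range n, g i) = G n := rfl
    rw [hu n, h5, div_mul_div_cancel₀ hGn]
    push_cast
    field_simp
    ring

/-- Quadratic growth does not notice shifts. -/
lemma tendsto_shift_div_sq {P : ℕ → ℝ} {γ : ℝ}
    (h : Tendsto (fun n : ℕ => P n / (n : ℝ) ^ 2) atTop (𝓝 γ)) (k : ℕ) :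
    Tendsto (fun n : ℕ => P (n + k) / (n : ℝ) ^ 2) atTop (𝓝 γ) := by
  have h1 := (tendsto_add_atTop_iff_nat k).2 h
  have h2 : Tendsto (fun n : ℕ => (1 + k * (1 / n) : ℝ) ^ 2) atTop (𝓝 1) := by
    have := ((tendsto_one_div_atTop_nhds_zero_nat (𝕜 := ℝ)).const_mul (k : ℝ)).const_add 1
    simpa using this.pow 2
  have h3 := h1.mul h2
  rw [mul_one] at h3
  refine h3.congr' ?_
  filter_upwards [eventually_gt_atTop 0] with n hn
  have hn' : (n : ℝ) ≠ 0 := by positivity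
  have : (n : ℝ) + k ≠ 0 := by positivity
  push_cast
  field_simp

namespace UnfoldingModel

variable {m : ℕ} [NeZero m] {M : UnfoldingModel m}

/-- The words followed by a line to the vertex `c` grow like the coprime pairs below a height. -/
lemma CornerData.tendsto_words_vanishing {c : Fin m} {X Y : Fin m → ℝ} {h : ℕ → ℕ → ℕ} {C : ℕ}
    (hD : M.CornerData c X Y h C) (hmono : ∀ g x y, 0 < g → h x y ≤ h (g * x) (g * y))
    (hx : ∀ x y, x ≤ h x y) (hy : ∀ x y, y ≤ h x y) {γ : ℝ}
    (hP : Tendsto (fun N : ℕ => ((primitive h N).ncard : ℝ) / (N : ℝ) ^ 2) atTop (𝓝 γ)) :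
    Tendsto (fun n : ℕ => ((M.words (vanishing c) (OffSide c) n).ncard : ℝ) / (n : ℝ) ^ 2) atTop
      (𝓝 γ) := by
  set a : ℝ := ((M.words (vanishing c) (OffSide c) 1).ncard : ℝ)
  have h0 : Tendsto (fun n : ℕ => (1 / n : ℝ) ^ 2) atTop (𝓝 0) := by
    simpa using (tendsto_one_div_atTop_nhds_zero_nat (𝕜 := ℝ)).pow 2
  have hdiag : Tendsto (fun N : ℕ => ((M.diagonalsUpTo c (N + C)).ncard : ℝ) / (N : ℝ) ^ 2) atTop
      (𝓝 γ) := by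
    have hl := hP.sub h0
    rw [sub_zero] at hl
    refine tendsto_of_tendsto_of_tendsto_of_le_of_le hl (tendsto_shift_div_sq hP (C + C))
      (fun N => ?_) (fun N => ?_)
    · have h1 : ((primitive h N).ncard : ℝ) ≤ (M.diagonalsUpTo c (N + C)).ncard + 1 := by
        exact_mod_cast hD.ncard_primitive_le N
      have h2 : (1 / N : ℝ) ^ 2 = 1 / (N : ℝ) ^ 2 := by rw [one_div_pow]
      simp only
      rw [h2, ← sub_div]
      gcongr
      linarith
    · have h1 : ((M.diagonalsUpTo c (N + C)).ncard : ℝ) ≤ (primitive h (N + (C + C))).ncard := by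
        rw [← add_assoc]
        exact_mod_cast hD.ncard_diagonalsUpTo_le hmono hx hy (N + C)
      simp only
      gcongr
  rw [← tendsto_add_atTop_iff_nat (C + 1)]
  have h1 : Tendsto (fun N : ℕ => ((M.words (vanishing c) (OffSide c) (N + (C + 1))).ncard : ℝ) /
      (N : ℝ) ^ 2) atTop (𝓝 γ) := by
    have h2 := (h0.const_mul a).add hdiag
    rw [mul_zero, zero_add] at h2
    refine h2.congr fun N => ?_
    rw [← add_assoc, hD.ncard_words_vanishing]
    push_cast
    ring
  have h2 : Tendsto (fun N : ℕ => ((1 : ℝ) - (C + 1) * (1 / ((N + (C + 1) : ℕ) : ℝ))) ^ 2) atTop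
      (𝓝 1) := by
    have := (((tendsto_add_atTop_iff_nat (C + 1)).2
      (tendsto_one_div_atTop_nhds_zero_nat (𝕜 := ℝ))).const_mul ((C : ℝ) + 1)).const_sub 1
    simpa using this.pow 2
  have h3 := h1.mul h2
  rw [mul_one] at h3
  refine h3.congr' ?_
  filter_upwards [eventually_gt_atTop 0] with N hN
  have hN' : (N : ℝ) ≠ 0 := by positivity
  have : (N : ℝ) + (C + 1) ≠ 0 := by positivity
  push_cast
  field_simp
  ring

/-- The second difference of the number of words counts generalized diagonals, hence each vertex
contributes a third of its quadratic rate to the cubic rate. -/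
lemma tendsto_words {γ : Fin m → ℝ}
    (h : ∀ c, Tendsto (fun n : ℕ => ((M.words (vanishing c) (OffSide c) n).ncard : ℝ) / (n : ℝ) ^ 2)
      atTop (𝓝 (γ c))) :
    Tendsto (fun n : ℕ => ((M.words ⊤ (fun _ => True) n).ncard : ℝ) / (n : ℝ) ^ 3) atTop
      (𝓝 ((∑ c, γ c) / 3)) := by
  refine tendsto_div_cube
    (v := fun n => ∑ c, ((M.words (vanishing c) (OffSide c) n).ncard : ℝ)) (fun n hn => ?_) ?_
  · rw [M.ncard_words_top_succ hn]
    push_cast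
    rfl
  · simp only [Finset.sum_div]
    exact tendsto_finsetSum _ fun c _ => h c

lemma tendsto_words_square :
    Tendsto (fun n : ℕ => ((square.words ⊤ (fun _ => True) n).ncard : ℝ) / (n : ℝ) ^ 3) atTop
      (𝓝 (4 / Real.pi ^ 2)) := by
  have h1 := tendsto_primitive_linear (a := 1) (b := 1) one_pos one_pos
  simp only [one_mul, Nat.cast_one] at h1
  have h2 := UnfoldingModel.tendsto_words fun c => (cornerData_square c).tendsto_words_vanishing
    (fun g x y hg => by nlinarith [Nat.zero_le x, Nat.zero_le y]) (fun x y => by omega)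
    (fun x y => by omega) h1
  convert h2 using 2
  simp only [Finset.sum_const, Finset.card_univ, Fintype.card_fin, nsmul_eq_mul]
  push_cast
  ring

lemma tendsto_words_equilateral :
    Tendsto (fun n : ℕ => ((equilateral.words ⊤ (fun _ => True) n).ncard : ℝ) / (n : ℝ) ^ 3) atTop
      (𝓝 (3 / (4 * Real.pi ^ 2))) := by
  have h2 := UnfoldingModel.tendsto_words fun c =>
    (cornerData_equilateral c).tendsto_words_vanishing
    (fun g x y hg => by nlinarith [Nat.zero_le x, Nat.zero_le y]) (fun x y => by omega)
    (fun x y => by omega) tendsto_primitive_two_mul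
  convert h2 using 2
  simp only [Finset.sum_const, Finset.card_univ, Fintype.card_fin, nsmul_eq_mul]
  push_cast
  ring

lemma tendsto_words_rightIsosceles (o : Fin 3) :
    Tendsto (fun n : ℕ => (((rightIsosceles o).words ⊤ (fun _ => True) n).ncard : ℝ) / (n : ℝ) ^ 3)
      atTop (𝓝 (2 / (3 * Real.pi ^ 2))) := by
  have hpi := Real.pi_ne_zero
  have h23 := tendsto_primitive_linear (a := 2) (b := 3) two_pos three_pos
  have h32 := tendsto_primitive_linear (a := 3) (b := 2) three_pos two_pos
  have hg : ∀ {g x : ℕ}, 0 < g → x ≤ g * x := fun hg => Nat.le_mul_of_pos_left _ hg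
  have h2 := UnfoldingModel.tendsto_words (M := rightIsosceles o)
    (γ := fun c => if c = o then 1 / Real.pi ^ 2 else 1 / (2 * Real.pi ^ 2)) fun c => by
      have hc : c = o ∨ o = c + 1 ∨ o = c + 2 := by clear h23 h32 hg hpi; revert c o; decide
      rcases hc with rfl | rfl | rfl
      · rw [if_pos rfl]
        refine (cornerData_right c).tendsto_words_vanishing (fun g x y h => ?_) (fun x y => by omega)
          (fun x y => by omega) tendsto_primitive_max
        have := hg (x := x) h
        have := hg (x := y) h
        exact Nat.add_le_add (Nat.add_le_add ‹_› ‹_›) (max_le_max ‹_› ‹_›)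
      · rw [if_neg (by revert c; decide)]
        have h := (cornerData_acute_one c).tendsto_words_vanishing (fun g x y h => ?_)
          (fun x y => by omega) (fun x y => by omega) h23
        · convert h using 2
          push_cast
          field_simp
          try norm_num
        · have := hg (x := x) h
          have := hg (x := y) h
          omega
      · rw [if_neg (by revert c; decide)]
        have h := (cornerData_acute_two c).tendsto_words_vanishing (fun g x y h => ?_)
          (fun x y => by omega) (fun x y => by omega) h32
        · convert h using 2
          push_cast
          field_simp
          try norm_num
        · have := hg (x := x) h
          have := hg (x := y) h
          omega
  convert h2 using 2
  rw [Finset.sum_ite, Finset.sum_const, Finset.sum_const, Finset.filter_eq', Finset.filter_ne',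
    if_pos (Finset.mem_univ o), Finset.card_singleton, Finset.card_erase_of_mem (Finset.mem_univ o),
    Finset.card_univ, Fintype.card_fin]
  simp only [nsmul_eq_mul]
  push_cast
  field_simp
  norm_num

end UnfoldingModel
end PolygonalBilliard

namespace PolygonalBilliard

/-! ### Billiard orbits and unfolded lines -/

lemma affine_add (A : Plane →ᵃ[ℝ] ℝ) (p v : Plane) : A (p + v) = A p + A.linear v := by
  have h := A.map_vadd p v
  rw [vadd_eq_add, vadd_eq_add, add_comm v p] at h
  rw [h, add_comm]

lemma exists_eq_smul {L : Plane →ₗ[ℝ] ℝ} (hL : L ≠ 0) {u v : Plane} (hu : u ≠ 0) (h : L u = 0)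
    (h' : L v = 0) : ∃ t : ℝ, v = t • u := by
  have h1 := L.finrank_range_add_finrank_ker
  rw [LinearMap.range_eq_top.2 (LinearMap.surjective hL), finrank_top, Module.finrank_self,
    finrank_euclideanSpace_fin] at h1
  have h2 : Module.finrank ℝ (LinearMap.ker L) = 1 := by omega
  have hu' : (⟨u, h⟩ : LinearMap.ker L) ≠ 0 := fun he => hu (congrArg Subtype.val he)
  obtain ⟨t, ht⟩ := (finrank_eq_one_iff_of_nonzero' _ hu').1 h2 ⟨v, h'⟩
  exact ⟨t, (congrArg Subtype.val ht).symm⟩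

variable {m : ℕ}

/-- The reflection of the plane in the line through side `i`. -/
noncomputable def sideReflection (Q : Polygon Plane m) (i : Fin m) : Plane →ᵃ[ℝ] Plane where
  toFun x := Q i + (Submodule.span ℝ {edgeVector Q i}).reflection (x - Q i)
  linear := ((Submodule.span ℝ {edgeVector Q i}).reflection.toLinearEquiv : Plane →ₗ[ℝ] Plane)
  map_vadd' p v := by
    simp only [vadd_eq_add, map_add, map_sub, LinearEquiv.coe_coe,
      LinearIsometryEquiv.coe_toLinearEquiv]
    abel

lemma sideReflection_apply (Q : Polygon Plane m) (i : Fin m) (x : Plane) : sideReflection Q i x =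
    Q i + (Submodule.span ℝ {edgeVector Q i}).reflection (x - Q i) := rfl

lemma sideReflection_linear (Q : Polygon Plane m) (i : Fin m) (v : Plane) :
    (sideReflection Q i).linear v = (Submodule.span ℝ {edgeVector Q i}).reflection v := rfl

lemma reflection_edgeVector (Q : Polygon Plane m) (i : Fin m) :
    (Submodule.span ℝ {edgeVector Q i}).reflection (edgeVector Q i) = edgeVector Q i :=
  Submodule.reflection_mem_subspace_eq_self (Submodule.mem_span_singleton_self _)

/-- The values of an affine functional at the vertices of a polygon. -/
noncomputable def vertexValues (Q : Polygon Plane m) (A : Plane →ᵃ[ℝ] ℝ) : Fin m → ℝ := fun v => A (Q v)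

/-- The polygon `Q` with the side functionals `ℓ`, positive on the table, realises the unfolding
model `M`. -/
structure Realises [NeZero m] (M : UnfoldingModel m) (Q : Polygon Plane m)
    (ℓ : Fin m → Plane →ᵃ[ℝ] ℝ) : Prop where
  left : ∀ i, ℓ i (Q i) = 0
  right : ∀ i, ℓ i (Q (i + 1)) = 0
  edge_ne : ∀ i, edgeVector Q i ≠ 0
  linear_ne : ∀ i, (ℓ i).linear ≠ 0
  table_eq : table Q = {x | ∀ i, 0 < ℓ i x}
  pos : ∀ i, ∀ x ∈ openSide Q i, ∀ j ≠ i, 0 < ℓ j x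
  values_mem : ∀ A, vertexValues Q A ∈ M.V
  exists_values : ∀ F ∈ M.V, ∃ A, F = vertexValues Q A
  refl_values : ∀ i A, M.refl i (vertexValues Q A) = vertexValues Q (A.comp (sideReflection Q i))

/-- The functional `A` vanishes precisely on the line along which the phase point `γ` moves. -/
def Along {Q : Polygon Plane m} (A : Plane →ᵃ[ℝ] ℝ) (γ : PhasePoint Q) : Prop :=
  A γ.point = 0 ∧ A.linear γ.dir = 0 ∧ A.linear ≠ 0

lemma exists_along {Q : Polygon Plane m} (γ : PhasePoint Q) : ∃ A, Along A γ := by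
  have h1 : Submodule.span ℝ {γ.dir} < ⊤ := by
    refine lt_top_iff_ne_top.2 fun h => ?_
    have h2 := finrank_span_singleton (K := ℝ) (v := γ.dir)
      (fun h0 => by simpa [h0] using γ.norm_dir)
    rw [h, finrank_top, finrank_euclideanSpace_fin] at h2
    omega
  obtain ⟨f, hf, hk⟩ := Submodule.exists_le_ker_of_lt_top _ h1
  refine ⟨f.toAffineMap - AffineMap.const ℝ _ (f γ.point), ?_, ?_, ?_⟩
  · simp
  · have : f γ.dir = 0 := hk (Submodule.mem_span_singleton_self _)
    simpa using this
  · simpa using hf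

lemma dir_ne_zero {Q : Polygon Plane m} (γ : PhasePoint Q) : γ.dir ≠ 0 := fun h0 => by
  simpa [h0] using γ.norm_dir

lemma mem_openSide {Q : Polygon Plane m} {i : Fin m} {x : Plane} :
    x ∈ openSide Q i ↔ ∃ s : ℝ, 0 < s ∧ s < 1 ∧ x = Q i + s • edgeVector Q i := by
  rw [openSide, openSegment_eq_image', Set.mem_image]
  constructor
  · rintro ⟨s, ⟨h1, h2⟩, rfl⟩
    exact ⟨s, h1, h2, rfl⟩
  · rintro ⟨s, h1, h2, rfl⟩
    exact ⟨s, ⟨h1, h2⟩, rfl⟩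

lemma sideReflection_of_mem {Q : Polygon Plane m} {i : Fin m} {x : Plane} (h : x ∈ openSide Q i) :
    sideReflection Q i x = x := by
  obtain ⟨s, -, -, rfl⟩ := mem_openSide.1 h
  rw [sideReflection_apply, add_sub_cancel_left, map_smul, reflection_edgeVector]

/-- The next phase point moves along the reflected line. -/
lemma Along.reflect {Q : Polygon Plane m} {A : Plane →ᵃ[ℝ] ℝ} {γ γ' : PhasePoint Q} (h : Along A γ) {t : ℝ}
    (hp : γ'.point = γ.point + t • γ.dir)
    (hd : γ'.dir = (Submodule.span ℝ {edgeVector Q γ'.side}).reflection γ.dir) :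
    Along (A.comp (sideReflection Q γ'.side)) γ' := by
  refine ⟨?_, ?_, fun h0 => h.2.2 ?_⟩
  · rw [AffineMap.comp_apply, sideReflection_of_mem γ'.point_mem, hp, affine_add, h.1, map_smul,
      h.2.1]
    simp
  · rw [AffineMap.comp_linear, LinearMap.comp_apply, sideReflection_linear, hd,
      Submodule.reflection_reflection, h.2.1]
  · ext v
    have h1 := LinearMap.congr_fun h0
      ((Submodule.span ℝ {edgeVector Q γ'.side}).reflection v)
    rwa [AffineMap.comp_linear, LinearMap.comp_apply, sideReflection_linear,
      Submodule.reflection_reflection] at h1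

variable [NeZero m] {M : UnfoldingModel m} {Q : Polygon Plane m} {ℓ : Fin m → Plane →ᵃ[ℝ] ℝ}

lemma edgeVector_eq (Q : Polygon Plane m) (i : Fin m) : edgeVector Q i = Q (i + 1) - Q i := by
  rw [edgeVector, finRotate_apply]

lemma apply_succ (A : Plane →ᵃ[ℝ] ℝ) (i : Fin m) :
    A (Q (i + 1)) = A (Q i) + A.linear (edgeVector Q i) := by
  rw [← affine_add, edgeVector_eq]
  congr 1
  abel

namespace Realises

lemma linear_edge (hQ : Realises M Q ℓ) (i : Fin m) : (ℓ i).linear (edgeVector Q i) = 0 := by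
  have h := apply_succ (Q := Q) (ℓ i) i
  rw [hQ.left, hQ.right] at h
  linarith

lemma eq_zero (hQ : Realises M Q ℓ) {i : Fin m} {x : Plane} (h : x ∈ openSide Q i) : ℓ i x = 0 := by
  obtain ⟨s, -, -, rfl⟩ := mem_openSide.1 h
  rw [affine_add, hQ.left, map_smul, hQ.linear_edge]
  simp

lemma linear_dir_pos (hQ : Realises M Q ℓ) (γ : PhasePoint Q) : 0 < (ℓ γ.side).linear γ.dir := by
  obtain ⟨ε, hε, h⟩ := γ.inward
  have h1 := h (ε / 2) ⟨by linarith, by linarith⟩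
  rw [hQ.table_eq] at h1
  have h2 := h1 γ.side
  rw [affine_add, hQ.eq_zero γ.point_mem, map_smul, zero_add, smul_eq_mul] at h2
  exact pos_of_mul_pos_right h2 (by linarith)

/-- A line through a point of an open side in a direction transversal to the side separates the
endpoints of the side. -/
lemma crosses (hQ : Realises M Q ℓ) {A : Plane →ᵃ[ℝ] ℝ} {i : Fin m} {x d : Plane}
    (hx : x ∈ openSide Q i) (hA : A x = 0) (hd : A.linear d = 0) (h0 : A.linear ≠ 0)
    (hi : (ℓ i).linear d ≠ 0) : Crosses (vertexValues Q A) i := by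
  obtain ⟨s, hs, hs', rfl⟩ := mem_openSide.1 hx
  have hd0 : d ≠ 0 := fun h => hi (by rw [h, map_zero])
  rw [affine_add, map_smul, smul_eq_mul] at hA
  have he : A.linear (edgeVector Q i) ≠ 0 := by
    intro he
    obtain ⟨t, ht⟩ := exists_eq_smul h0 hd0 hd he
    have h1 := hQ.linear_edge i
    rw [ht, map_smul, smul_eq_mul, mul_eq_zero] at h1
    rcases h1 with h1 | h1
    · rw [h1, zero_smul] at ht
      exact hQ.edge_ne i ht
    · exact hi h1
  have h1 := apply_succ (Q := Q) A i
  unfold Crosses vertexValues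
  rw [h1]
  have h2 : A (Q i) = -(s * A.linear (edgeVector Q i)) := by linarith
  rw [h2]
  have h3 := mul_self_pos.2 he
  nlinarith [mul_pos (mul_pos hs (sub_pos.2 hs')) h3]

/-- A direction which points from an open side to the positive side of its functional is inward. -/
lemma inward (hQ : Realises M Q ℓ) {i : Fin m} {x d : Plane} (hx : x ∈ openSide Q i)
    (hd : 0 < (ℓ i).linear d) : ∃ ε : ℝ, 0 < ε ∧ ∀ s ∈ Set.Ioo 0 ε, x + s • d ∈ table Q := by
  have h1 : ∀ᶠ s in 𝓝[>] (0 : ℝ), ∀ j, 0 < ℓ j (x + s • d) := by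
    rw [eventually_all]
    intro j
    simp only [affine_add, map_smul, smul_eq_mul]
    rcases eq_or_ne j i with rfl | hj
    · filter_upwards [self_mem_nhdsWithin] with s hs
      rw [hQ.eq_zero hx, zero_add]
      exact mul_pos hs hd
    · refine Filter.Eventually.filter_mono nhdsWithin_le_nhds ?_
      have hc : ContinuousAt (fun s : ℝ => ℓ j x + s * (ℓ j).linear d) 0 := by fun_prop
      refine continuousAt_const.eventually_lt hc ?_
      simpa using hQ.pos i x hx j hj
  obtain ⟨ε, hε, h⟩ := mem_nhdsGT_iff_exists_Ioo_subset.1 h1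
  refine ⟨ε, hε, fun s hs => ?_⟩
  rw [hQ.table_eq]
  exact h hs

lemma linear_reflection (hQ : Realises M Q ℓ) (i : Fin m) (v : Plane) :
    (ℓ i).linear ((Submodule.span ℝ {edgeVector Q i}).reflection v) = -(ℓ i).linear v := by
  rw [Submodule.reflection_singleton_apply, map_sub, map_nsmul, map_smul, hQ.linear_edge]
  simp

/-- The ball leaves its line through the next side. -/
lemma linear_dir_neg (hQ : Realises M Q ℓ) {γ : PhasePoint Q} {j : Fin m} (hj : j ≠ γ.side) {t : ℝ}
    (ht : 0 < t) (h : γ.point + t • γ.dir ∈ openSide Q j) : (ℓ j).linear γ.dir < 0 := by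
  have h1 := hQ.eq_zero h
  rw [affine_add, map_smul, smul_eq_mul] at h1
  have h2 := hQ.pos _ _ γ.point_mem j hj
  by_contra! h3
  nlinarith [mul_nonneg ht.le h3]

/-- The line of a phase point leaves the table through the side of the next phase point, which is
another side. -/
lemma of_billiardStep (hQ : Realises M Q ℓ) {γ γ' : PhasePoint Q} (h : BilliardStep γ γ')
    {A : Plane →ᵃ[ℝ] ℝ} (hA : Along A γ) : γ.side ≠ γ'.side ∧
      Crosses (vertexValues Q A) γ'.side ∧ Along (A.comp (sideReflection Q γ'.side)) γ' := by
  obtain ⟨⟨t, ht, hp, -⟩, hd⟩ := h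
  have hne : γ'.side ≠ γ.side := by
    intro he
    have h1 := hQ.eq_zero γ'.point_mem
    rw [he, hp, affine_add, hQ.eq_zero γ.point_mem, map_smul, smul_eq_mul, zero_add] at h1
    exact (mul_pos ht (hQ.linear_dir_pos γ)).ne' h1
  have hm : γ.point + t • γ.dir ∈ openSide Q γ'.side := hp ▸ γ'.point_mem
  refine ⟨hne.symm, hQ.crosses hm ?_ hA.2.1 hA.2.2 (hQ.linear_dir_neg hne ht hm).ne,
    hA.reflect hp hd⟩
  rw [affine_add, hA.1, map_smul, hA.2.1]
  simp

lemma exists_mem_openSide {A : Plane →ᵃ[ℝ] ℝ} {i : Fin m} (h : Crosses (vertexValues Q A) i) :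
    ∃ x ∈ openSide Q i, A x = 0 := by
  have h1 := apply_succ (Q := Q) A i
  unfold Crosses vertexValues at h
  set a := A (Q i)
  set b := A.linear (edgeVector Q i)
  rw [h1] at h
  have hb : b ≠ 0 := by
    rintro hb
    rw [hb] at h
    nlinarith [mul_self_nonneg a]
  refine ⟨Q i + (-a / b) • edgeVector Q i, mem_openSide.2 ⟨_, ?_, ?_, rfl⟩, ?_⟩
  · rcases lt_or_gt_of_ne hb with hb | hb
    · exact div_pos_of_neg_of_neg (by nlinarith) hb
    · exact div_pos (by nlinarith) hb
  · rcases lt_or_gt_of_ne hb with hb | hb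
    · rw [div_lt_one_of_neg hb]
      nlinarith
    · rw [div_lt_one hb]
      nlinarith
  · rw [affine_add, map_smul, smul_eq_mul, div_mul_cancel₀ _ hb]
    exact add_neg_cancel a

/-- A side through which the line of a phase point leaves the table is hit by the ball. -/
lemma exists_billiardStep (hQ : Realises M Q ℓ) {γ : PhasePoint Q} {A : Plane →ᵃ[ℝ] ℝ}
    (hA : Along A γ) {j : Fin m} (hj : γ.side ≠ j) (hc : Crosses (vertexValues Q A) j) :
    ∃ γ', γ'.side = j ∧ BilliardStep γ γ' := by
  obtain ⟨y, hy, hAy⟩ := exists_mem_openSide hc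
  have h1 : A.linear (y - γ.point) = 0 := by
    have h := affine_add A γ.point (y - γ.point)
    rw [add_sub_cancel, hAy, hA.1] at h
    linarith
  obtain ⟨t, ht⟩ := exists_eq_smul hA.2.2 (dir_ne_zero γ) hA.2.1 h1
  obtain rfl : y = γ.point + t • γ.dir := by rw [← ht]; abel
  have hpos : ∀ k, ℓ k (γ.point + t • γ.dir) = ℓ k γ.point + t * (ℓ k).linear γ.dir := fun k => by
    rw [affine_add, map_smul, smul_eq_mul]
  have ht0 : 0 < t := by
    have h2 := hQ.pos _ _ hy γ.side hj
    rw [hpos, hQ.eq_zero γ.point_mem, zero_add] at h2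
    exact pos_of_mul_pos_left h2 (hQ.linear_dir_pos γ).le
  have hneg := hQ.linear_dir_neg hj.symm ht0 hy
  refine ⟨⟨j, γ.point + t • γ.dir, (Submodule.span ℝ {edgeVector Q j}).reflection γ.dir, hy, ?_,
    hQ.inward hy ?_⟩, rfl, ⟨t, ht0, rfl, fun s hs => ?_⟩, rfl⟩
  · rw [LinearIsometryEquiv.norm_map, γ.norm_dir]
  · rw [hQ.linear_reflection]
    linarith
  · rw [hQ.table_eq]
    intro k
    rw [affine_add, map_smul, smul_eq_mul]
    have h3 := hpos k
    -- the side functionals are affine on the segment and vanish at one endpoint at most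
    have h4 : t * (ℓ k γ.point + s * (ℓ k).linear γ.dir) =
        (t - s) * ℓ k γ.point + s * ℓ k (γ.point + t • γ.dir) := by
      rw [h3]
      ring
    have h5 : 0 < (t - s) * ℓ k γ.point + s * ℓ k (γ.point + t • γ.dir) := by
      have hts : 0 < t - s := sub_pos.2 hs.2
      rcases eq_or_ne k j with rfl | hk
      · rw [hQ.eq_zero hy, mul_zero, add_zero]
        exact mul_pos hts (hQ.pos _ _ γ.point_mem k hj.symm)
      · have h6 := mul_pos hs.1 (hQ.pos _ _ hy k hk)
        rcases eq_or_ne k γ.side with rfl | hk'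
        · rw [hQ.eq_zero γ.point_mem, mul_zero, zero_add]
          exact h6
        · exact add_pos (mul_pos hts (hQ.pos _ _ γ.point_mem k hk')) h6
    rw [← h4] at h5
    exact pos_of_mul_pos_right h5 ht0.le

/-- A line which crosses an open side carries a phase point on this side. -/
lemma exists_phasePoint (hQ : Realises M Q ℓ) {A : Plane →ᵃ[ℝ] ℝ} {i : Fin m}
    (hc : Crosses (vertexValues Q A) i) : ∃ γ : PhasePoint Q, γ.side = i ∧ Along A γ := by
  obtain ⟨y, hy, hAy⟩ := exists_mem_openSide hc
  have he : A.linear (edgeVector Q i) ≠ 0 := by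
    intro he
    have h1 := apply_succ (Q := Q) A i
    unfold Crosses vertexValues at hc
    rw [h1, he, add_zero] at hc
    nlinarith [mul_self_nonneg (A (Q i))]
  have hA0 : A.linear ≠ 0 := fun h => he (by rw [h]; rfl)
  have hker : LinearMap.ker A.linear ≠ ⊥ := by
    refine LinearMap.ker_ne_bot_of_finrank_lt ?_
    rw [finrank_euclideanSpace_fin, Module.finrank_self]
    exact one_lt_two
  obtain ⟨d, hd, hd0⟩ := Submodule.exists_mem_ne_zero_of_ne_bot hker
  rw [LinearMap.mem_ker] at hd
  have hi : (ℓ i).linear d ≠ 0 := by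
    intro h
    obtain ⟨t, ht⟩ := exists_eq_smul (hQ.linear_ne i) hd0 h (hQ.linear_edge i)
    rw [ht, map_smul, hd, smul_zero] at he
    exact he rfl
  obtain ⟨d, hd, hd0, hi⟩ : ∃ d, A.linear d = 0 ∧ d ≠ 0 ∧ 0 < (ℓ i).linear d := by
    rcases lt_or_gt_of_ne hi with h | h
    · exact ⟨-d, by rw [map_neg, hd, neg_zero], neg_ne_zero.2 hd0, by rw [map_neg]; linarith⟩
    · exact ⟨d, hd, hd0, h⟩
  have hn : 0 < ‖d‖ := norm_pos_iff.2 hd0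
  refine ⟨⟨i, y, ‖d‖⁻¹ • d, hy, ?_, hQ.inward hy ?_⟩, rfl, hAy, ?_, hA0⟩
  · rw [norm_smul, norm_inv, norm_norm, inv_mul_cancel₀ hn.ne']
  · rw [map_smul]
    exact mul_pos (inv_pos.2 hn) hi
  · simp only [map_smul, hd, smul_zero]

lemma run_of_isChain (hQ : Realises M Q ℓ) {L : List (PhasePoint Q)} {γ : PhasePoint Q}
    (hL : (γ :: L).IsChain BilliardStep) {A : Plane →ᵃ[ℝ] ℝ} (hA : Along A γ) :
    ((γ :: L).map PhasePoint.side).IsChain (· ≠ ·) ∧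
      M.Run (L.map PhasePoint.side) (vertexValues Q A) := by
  induction L generalizing γ A with
  | nil => simp
  | cons γ' L ih =>
    rw [List.isChain_cons_cons] at hL
    obtain ⟨h1, h2, h3⟩ := hQ.of_billiardStep hL.1 hA
    obtain ⟨h4, h5⟩ := ih hL.2 h3
    refine ⟨?_, h2, ?_⟩
    · rw [List.map_cons, List.map_cons, List.isChain_cons_cons]
      exact ⟨h1, h4⟩
    · rwa [hQ.refl_values]

lemma exists_isChain (hQ : Realises M Q ℓ) {w : List (Fin m)} {γ : PhasePoint Q}
    (hw : (γ.side :: w).IsChain (· ≠ ·)) {A : Plane →ᵃ[ℝ] ℝ} (hA : Along A γ)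
    (hr : M.Run w (vertexValues Q A)) :
    ∃ L : List (PhasePoint Q), (γ :: L).IsChain BilliardStep ∧ L.map PhasePoint.side = w := by
  induction w generalizing γ A with
  | nil => exact ⟨[], by simp, rfl⟩
  | cons j w ih =>
    rw [List.isChain_cons_cons] at hw
    obtain ⟨γ', rfl, hs⟩ := hQ.exists_billiardStep hA hw.1 hr.1
    obtain ⟨L, hL, rfl⟩ := ih hw.2 (hQ.of_billiardStep hs hA).2.2 (by rw [← hQ.refl_values]; exact hr.2)
    exact ⟨γ' :: L, List.isChain_cons_cons.2 ⟨hs, hL⟩, rfl⟩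

/-- The codes of billiard orbits are the words of lines in the unfolding. -/
lemma image_language (hQ : Realises M Q ℓ) {n : ℕ} (hn : 1 ≤ n) :
    List.ofFn '' language Q n = M.words ⊤ (fun _ => True) n := by
  ext w
  constructor
  · rintro ⟨w, ⟨γ, hγ, hs⟩, rfl⟩
    have h1 : (List.ofFn γ).IsChain BilliardStep :=
      List.isChain_ofFn.2 fun i hi => hγ _ _ rfl
    have h2 : List.ofFn w = (List.ofFn γ).map PhasePoint.side := by
      rw [List.map_ofFn]
      exact congrArg _ (funext fun i => (hs i).symm)
    have h3 : (List.ofFn w).length = n := List.length_ofFn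
    obtain ⟨γ₀, L, h4⟩ : ∃ γ₀ L, List.ofFn γ = γ₀ :: L := by
      refine List.exists_cons_of_ne_nil fun h => ?_
      rw [h2, h] at h3
      simp at h3
      omega
    rw [h4] at h1 h2
    obtain ⟨A, hA⟩ := exists_along γ₀
    obtain ⟨h5, h6⟩ := hQ.run_of_isChain h1 hA
    refine ⟨h3, h2 ▸ h5, fun _ _ => trivial, M.refl γ₀.side (vertexValues Q A),
      M.refl_mem _ _ (hQ.values_mem A), ?_, trivial⟩
    rw [h2, List.map_cons, UnfoldingModel.run_cons, M.crosses_refl, M.refl_refl]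
    exact ⟨hQ.crosses γ₀.point_mem hA.1 hA.2.1 hA.2.2 (hQ.linear_dir_pos γ₀).ne', h6⟩
  · rintro ⟨hl, hw, -, F, hF, hr, -⟩
    match w, hl with
    | [], hl => simp at hl; omega
    | i :: w, hl =>
      obtain ⟨A, hA⟩ := hQ.exists_values _ (M.refl_mem i F hF)
      obtain ⟨h1, h2⟩ := hr
      rw [← M.crosses_refl] at h1
      rw [hA] at h1 h2
      obtain ⟨γ, rfl, hγ⟩ := hQ.exists_phasePoint h1
      obtain ⟨L, hL, rfl⟩ := hQ.exists_isChain hw hγ h2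
      have hl' : (γ :: L).length = n := by simpa using hl
      subst hl'
      refine ⟨fun k => ((γ :: L).get k).side, ⟨(γ :: L).get, ?_, fun _ => rfl⟩, ?_⟩
      · rw [← List.ofFn_get (γ :: L), List.isChain_ofFn] at hL
        rintro ⟨a, ha⟩ ⟨b, hb⟩ (rfl : b = a + 1)
        simpa using hL a (by simpa using hb)
      · rw [← List.map_cons, ← List.ofFn_get (γ :: L), List.map_ofFn]
        simp [Function.comp_def]

lemma tendsto_complexity (hQ : Realises M Q ℓ) {a : ℝ}
    (h : Tendsto (fun n : ℕ => ((M.words ⊤ (fun _ => True) n).ncard : ℝ) / (n : ℝ) ^ 3) atTop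
      (𝓝 a)) : Tendsto (fun n : ℕ => (complexity Q n : ℝ) / (n : ℝ) ^ 3) atTop (𝓝 a) := by
  refine h.congr' ?_
  filter_upwards [eventually_ge_atTop 1] with n hn
  rw [← hQ.image_language hn, Set.ncard_image_of_injective _ List.ofFn_injective, complexity]

end Realises
end PolygonalBilliard

namespace PolygonalBilliard

open UnfoldingModel

/-! ### Triangular tables -/

section triangle

variable {Q : Polygon Plane 3}

lemma fin3_add_two_add_two (i : Fin 3) : i + 2 + 2 = i + 1 := by revert i; decide

lemma affineIndependent_of_inner_sq_lt (o : Fin 3)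
    (h : inner ℝ (Q (o + 1) - Q o) (Q (o + 2) - Q o) ^ 2 <
      ‖Q (o + 1) - Q o‖ ^ 2 * ‖Q (o + 2) - Q o‖ ^ 2) : AffineIndependent ℝ Q.vertices := by
  rw [affineIndependent_iff_not_collinear, collinear_iff_of_mem (Set.mem_range_self o)]
  rintro ⟨v, hv⟩
  obtain ⟨r, hr⟩ := hv _ (Set.mem_range_self (o + 1))
  obtain ⟨s, hs⟩ := hv _ (Set.mem_range_self (o + 2))
  rw [vadd_eq_add] at hr hs
  rw [hr, hs, add_sub_cancel_right, add_sub_cancel_right, real_inner_smul_left,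
    real_inner_smul_right, norm_smul, norm_smul, real_inner_self_eq_norm_sq, mul_pow, mul_pow,
    mul_pow, mul_pow, Real.norm_eq_abs, Real.norm_eq_abs, sq_abs, sq_abs] at h
  exact absurd h (by rw [not_lt]; exact le_of_eq (by ring))

/-- A triangle realises the model whose coefficients describe the feet of its altitudes. The side
functionals are the barycentric coordinates. -/
lemma exists_realises_triangle (hQ : AffineIndependent ℝ Q.vertices) {a : Fin 3 → ℝ}
    (h : ∀ i, 2 * inner ℝ (Q (i + 1) - Q i) (Q (i + 2) - Q i) =
      (2 - a i) * ‖Q (i + 1) - Q i‖ ^ 2) : ∃ ℓ, Realises (triangle a) Q ℓ := by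
  let b : AffineBasis (Fin 3) ℝ Plane := ⟨Q.vertices, hQ, by
    rw [hQ.affineSpan_eq_top_iff_card_eq_finrank_add_one, Fintype.card_fin,
      finrank_euclideanSpace_fin]⟩
  have hb : ∀ i, b i = Q i := fun i => rfl
  have hone : ∀ i, b.coord i (Q i) = 1 := fun i => b.coord_apply_eq i
  have hzero : ∀ {i j}, i ≠ j → b.coord i (Q j) = 0 := fun hij => b.coord_apply_ne hij
  have hedge : ∀ i, edgeVector Q i ≠ 0 := fun i h0 => by
    rw [edgeVector_eq, sub_eq_zero] at h0
    exact add_one_ne_fin3 i (hQ.injective h0)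
  refine ⟨fun i => b.coord (i + 2), fun i => hzero (add_two_ne_fin3 i),
    fun i => hzero (add_one_ne_add_two_fin3 i).symm, hedge, fun i h0 => ?_, ?_, ?_, fun _ => trivial,
    fun F _ => ?_, fun i A => ?_⟩
  · have h1 := affine_add (b.coord (i + 2)) (Q i) (Q (i + 2) - Q i)
    rw [add_sub_cancel, hone, hzero (add_two_ne_fin3 i), h0] at h1
    simp at h1
  · have h1 := b.interior_convexHull
    have h2 : Set.range b = Set.range Q.vertices := rfl
    rw [table, ← h2, h1]
    ext x
    simp only [Set.mem_ofPred_eq]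
    refine ⟨fun hx i => hx _, fun hx i => ?_⟩
    have := hx (i + 1)
    rwa [add_one_add_two_fin3] at this
  · intro i x hx j hj
    obtain ⟨s, hs, hs', rfl⟩ := mem_openSide.1 hx
    have h1 := apply_succ (Q := Q) (b.coord (j + 2)) i
    simp only [affine_add, map_smul, smul_eq_mul]
    rcases fin3_eq_or i j with rfl | rfl | rfl
    · exact absurd rfl hj
    · rw [add_one_add_two_fin3] at h1 ⊢
      rw [hone, hzero (add_one_ne_fin3 i).symm] at h1
      rw [hone]
      nlinarith
    · rw [fin3_add_two_add_two] at h1 ⊢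
      rw [hone, hzero (add_one_ne_fin3 i)] at h1
      rw [hzero (add_one_ne_fin3 i)]
      nlinarith
  · refine ⟨F 0 • b.coord 0 + F 1 • b.coord 1 + F 2 • b.coord 2, funext fun v => ?_⟩
    simp only [vertexValues, AffineMap.coe_add, AffineMap.coe_smul, Pi.add_apply, Pi.smul_apply,
      smul_eq_mul]
    have h1 : ∀ j, b.coord j (Q v) = if j = v then 1 else 0 := fun j => b.coord_apply j v
    rw [h1, h1, h1]
    fin_cases v <;> simp
  · have h1 := apply_succ (Q := Q) A i
    have h2 := affine_add A (Q i) (Q (i + 2) - Q i)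
    rw [add_sub_cancel] at h2
    funext v
    rcases fin3_eq_or i v with rfl | rfl | rfl
    · rw [(triangle a).refl_left]
      simp [vertexValues, sideReflection_apply]
    · rw [(triangle a).refl_right]
      simp only [vertexValues, AffineMap.comp_apply, sideReflection_apply]
      rw [← edgeVector_eq, reflection_edgeVector, affine_add, h1]
    · rw [triangle_refl_apex]
      simp only [vertexValues, AffineMap.comp_apply, sideReflection_apply]
      have hn : ‖edgeVector Q i‖ ^ 2 ≠ 0 := pow_ne_zero _ (norm_ne_zero_iff.2 (hedge i))
      have h3 : inner ℝ (edgeVector Q i) (Q (i + 2) - Q i) / ((‖edgeVector Q i‖ : ℝ) : ℝ) ^ 2 =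
          (2 - a i) / 2 := by
        have := h i
        rw [← edgeVector_eq] at this
        rw [div_eq_div_iff hn two_ne_zero]
        linarith
      rw [Submodule.reflection_singleton_apply, affine_add, map_sub, map_nsmul, map_smul]
      simp only [RCLike.ofReal_real_eq_id, id_eq]
      rw [h3, smul_eq_mul, nsmul_eq_mul]
      push_cast
      rw [h1, h2]
      ring

lemma exists_realises_equilateral (hQ : IsEquilateralTable Q) : ∃ ℓ, Realises equilateral Q ℓ := by
  obtain ⟨a, ha, h⟩ := hQ
  have h0 : ∀ i, ‖Q (i + 1) - Q i‖ = a := fun i => by rw [← dist_eq_norm, dist_comm, h]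
  have h1 : ∀ i, ‖Q (i + 2) - Q i‖ = a := fun i => by
    have := h (i + 2)
    rw [add_two_add_one_fin3] at this
    rw [← dist_eq_norm, this]
  have h2 : ∀ i, 2 * inner ℝ (Q (i + 1) - Q i) (Q (i + 2) - Q i) = a ^ 2 := fun i => by
    have h3 := norm_sub_sq_real (Q (i + 2) - Q i) (Q (i + 1) - Q i)
    have h4 := h0 (i + 1)
    rw [add_one_add_one_fin3] at h4
    rw [sub_sub_sub_cancel_right, h4, h0, h1, real_inner_comm] at h3
    linarith
  refine exists_realises_triangle (affineIndependent_of_inner_sq_lt 0 ?_) fun i => ?_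
  · rw [h0, h1]
    have := h2 0
    have h5 : inner ℝ (Q (0 + 1) - Q 0) (Q (0 + 2) - Q 0) = a ^ 2 / 2 := by linarith
    rw [h5]
    nlinarith [pow_pos ha 4]
  · rw [h2, h0]
    ring

lemma exists_realises_rightIsosceles (hQ : IsRightIsoscelesTable Q) :
    ∃ o ℓ, Realises (rightIsosceles o) Q ℓ := by
  obtain ⟨o, h1, h2, -⟩ := hQ
  refine ⟨o, ?_⟩
  set u := Q (o + 1) - Q o with hu
  set v := Q (o + 2) - Q o with hv
  have huv : inner ℝ u v = 0 := by
    rw [real_inner_comm]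
    exact InnerProductGeometry.inner_eq_zero_iff_angle_eq_pi_div_two _ _ |>.2 h1
  have h3 : InnerProductGeometry.angle (-u) (v - u) = Real.pi / 4 := by
    rw [← h2, EuclideanGeometry.angle, vsub_eq_sub, vsub_eq_sub, hu, hv, neg_sub,
      sub_sub_sub_cancel_right]
  have hu0 : u ≠ 0 := by
    intro h
    rw [h, neg_zero, InnerProductGeometry.angle_zero_left] at h3
    linarith [Real.pi_pos]
  have hn : 0 < ‖u‖ ^ 2 := pow_pos (norm_pos_iff.2 hu0) 2
  have h4 := InnerProductGeometry.cos_angle_mul_norm_mul_norm (-u) (v - u)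
  have h5 : ‖v - u‖ ^ 2 = ‖v‖ ^ 2 + ‖u‖ ^ 2 := by
    rw [norm_sub_sq_real, real_inner_comm, huv]
    ring
  rw [h3, Real.cos_pi_div_four, norm_neg, inner_neg_left, inner_sub_right, huv,
    real_inner_self_eq_norm_sq, zero_sub, neg_neg] at h4
  have heq : ‖v‖ ^ 2 = ‖u‖ ^ 2 := by
    have h6 := congrArg (· ^ 2) h4
    simp only [mul_pow, div_pow] at h6
    rw [h5, Real.sq_sqrt zero_le_two] at h6
    have h7 : ‖u‖ ^ 2 * (‖v‖ ^ 2 - ‖u‖ ^ 2) = 0 := by linarith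
    rcases mul_eq_zero.1 h7 with h | h
    · exact absurd h hn.ne'
    · linarith
  refine exists_realises_triangle (affineIndependent_of_inner_sq_lt o ?_) fun i => ?_
  · rw [← hu, ← hv, huv, heq]
    nlinarith
  · rcases fin3_eq_or o i with rfl | rfl | rfl
    · rw [if_neg (add_two_ne_fin3 i), if_pos rfl, ← hu, ← hv, huv]
      ring
    · rw [if_pos (add_one_add_two_fin3 o), add_one_add_one_fin3, add_one_add_two_fin3]
      have e1 : Q (o + 2) - Q (o + 1) = v - u := by rw [hu, hv, sub_sub_sub_cancel_right]
      have e2 : Q o - Q (o + 1) = -u := by rw [hu, neg_sub]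
      rw [e1, e2, h5, heq, inner_neg_right, inner_sub_left, real_inner_comm, huv,
        real_inner_self_eq_norm_sq]
      ring
    · rw [fin3_add_two_add_two, add_two_add_one_fin3, if_neg (add_one_ne_fin3 o),
        if_neg (add_two_ne_fin3 o)]
      have e1 : Q o - Q (o + 2) = -v := by rw [hv, neg_sub]
      have e2 : Q (o + 1) - Q (o + 2) = u - v := by rw [hu, hv, sub_sub_sub_cancel_right]
      rw [e1, e2, norm_neg, inner_neg_left, inner_sub_right, real_inner_comm, huv,
        real_inner_self_eq_norm_sq]
      ring

end triangle

/-! ### Square tables -/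

/-- The affine functional with gradient `v` which vanishes at `q`. -/
noncomputable def gradientFunctional (q v : Plane) : Plane →ᵃ[ℝ] ℝ where
  toFun p := inner ℝ v (p - q)
  linear := innerₛₗ ℝ v
  map_vadd' p w := by
    simp only [vadd_eq_add, innerₛₗ_apply_apply, add_sub_assoc, inner_add_right]

section square

variable {Q : Polygon Plane 4}

lemma fin4_add_one_add_one (i : Fin 4) : i + 1 + 1 = i + 2 := by revert i; decide
lemma fin4_add_one_add_two (i : Fin 4) : i + 1 + 2 = i + 3 := by revert i; decide
lemma fin4_add_two_add_one (i : Fin 4) : i + 2 + 1 = i + 3 := by revert i; decide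
lemma fin4_add_three_add_one (i : Fin 4) : i + 3 + 1 = i := by revert i; decide
lemma fin4_add_three_ne_add_two (i : Fin 4) : i + 3 ≠ i + 2 := by revert i; decide
lemma fin4_eq_or (i v : Fin 4) : v = i ∨ v = i + 1 ∨ v = i + 2 ∨ v = i + 3 := by
  revert i v; decide

/-- The functional of a side is the scalar product with the next side, an inward normal. -/
lemma exists_realises_square (hQ : IsSquareTable Q) : ∃ ℓ, Realises square Q ℓ := by
  obtain ⟨a, ha, h⟩ := hQ
  set e : Fin 4 → Plane := fun i => Q (i + 1) - Q i with he
  have hedge : ∀ i, edgeVector Q i = e i := fun i => edgeVector_eq Q i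
  have hsucc : ∀ i, Q (i + 1) = Q i + e i := fun i => (add_sub_cancel _ _).symm
  have hself : ∀ i, inner ℝ (e i) (e i) = a ^ 2 := fun i => by
    rw [real_inner_self_eq_norm_sq, he, ← dist_eq_norm, dist_comm, (h i).1]
  have horth : ∀ i, inner ℝ (e i) (e (i + 1)) = 0 := fun i => by
    have h1 := InnerProductGeometry.inner_eq_zero_iff_angle_eq_pi_div_two _ _ |>.2 (h i).2
    rw [vsub_eq_sub, vsub_eq_sub, ← neg_sub, inner_neg_left, neg_eq_zero] at h1
    simpa only [he, fin4_add_one_add_one] using h1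
  have horth' : ∀ i, inner ℝ (e (i + 1)) (e i) = 0 := fun i => by rw [real_inner_comm, horth]
  -- the four sides add up to zero, and two of them are orthogonal to a given one
  have hopp : ∀ i, e (i + 2) = -e i := by
    intro i
    have h1 : e i + e (i + 1) + e (i + 2) + e (i + 3) = 0 := by
      simp only [he, fin4_add_one_add_one, fin4_add_two_add_one, fin4_add_three_add_one]
      abel
    have h2 := congrArg (inner ℝ (e i)) h1
    have h3 := horth' (i + 3)
    rw [fin4_add_three_add_one] at h3
    rw [inner_add_right, inner_add_right, inner_add_right, hself, horth, h3, inner_zero_right] at h2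
    have h4 : inner ℝ (e (i + 2) + e i) (e (i + 2) + e i) = 0 := by
      rw [inner_add_left, inner_add_right, inner_add_right, hself, hself,
        real_inner_comm (e i) (e (i + 2))]
      linarith
    exact eq_neg_of_add_eq_zero_left (inner_self_eq_zero.1 h4)
  have hopp' : ∀ i, e (i + 3) = -e (i + 1) := fun i => by
    rw [← hopp, fin4_add_one_add_two]
  have hQ2 : ∀ i, Q (i + 2) = Q i + e i + e (i + 1) := fun i => by
    rw [← fin4_add_one_add_one, hsucc, hsucc]
  have hQ3 : ∀ i, Q (i + 3) = Q i + e (i + 1) := fun i => by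
    rw [← fin4_add_two_add_one, hsucc, hQ2, hopp]
    abel
  have ha2 : 0 < a ^ 2 := pow_pos ha 2
  have he0 : ∀ i, e i ≠ 0 := fun i h0 => by
    have := hself i
    rw [h0, inner_zero_left] at this
    exact ha2.ne this
  set ℓ : Fin 4 → Plane →ᵃ[ℝ] ℝ := fun i => gradientFunctional (Q i) (e (i + 1)) with hℓ
  have hval : ∀ i x, ℓ i x = inner ℝ (e (i + 1)) (x - Q i) := fun i x => rfl
  have hlin : ∀ i x, (ℓ i).linear x = inner ℝ (e (i + 1)) x := fun i x => rfl
  have v0 : ∀ i, ℓ i (Q i) = 0 := fun i => by rw [hval, sub_self, inner_zero_right]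
  have v1 : ∀ i, ℓ i (Q (i + 1)) = 0 := fun i => by rw [hsucc, affine_add, v0, hlin, horth', add_zero]
  have v2 : ∀ i, ℓ i (Q (i + 2)) = a ^ 2 := fun i => by
    rw [hQ2, affine_add, ← hsucc, v1, hlin, hself, zero_add]
  have v3 : ∀ i, ℓ i (Q (i + 3)) = a ^ 2 := fun i => by
    rw [hQ3, affine_add, v0, hlin, hself, zero_add]
  have hnonneg : ∀ i v, 0 ≤ ℓ i (Q v) := by
    intro i v
    rcases fin4_eq_or i v with rfl | rfl | rfl | rfl
    · exact (v0 _).ge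
    · exact (v1 _).ge
    · exact (v2 i).symm ▸ ha2.le
    · exact (v3 i).symm ▸ ha2.le
  have hadd : ∀ i x, ℓ (i + 2) x = a ^ 2 - ℓ i x := by
    intro i x
    have h1 : x - Q (i + 2) = x - Q i - e i - e (i + 1) := by rw [hQ2]; abel
    rw [hval, hval, fin4_add_two_add_one, hopp', h1, inner_neg_left, inner_sub_right,
      inner_sub_right, horth', hself]
    ring
  -- coordinates with respect to two adjacent sides
  have hcoord : ∀ x, x = Q 0 + (ℓ 3 x / a ^ 2) • e 0 + (ℓ 0 x / a ^ 2) • e 1 := by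
    intro x
    set r := x - Q 0 - (ℓ 3 x / a ^ 2) • e 0 - (ℓ 0 x / a ^ 2) • e 1 with hr
    have h01 : inner ℝ (e 0) (e 1) = 0 := horth 0
    have h10 : inner ℝ (e 1) (e 0) = 0 := horth' 0
    have e3 : ℓ 3 x = inner ℝ (e 0) (x - Q 0) := by
      have h3 := hval 3 x
      have h4 : Q 3 = Q 0 + e 1 := hQ3 0
      rw [h4, ← sub_sub, inner_sub_right] at h3
      rw [h3]
      change inner ℝ (e 0) (x - Q 0) - inner ℝ (e 0) (e 1) = _
      rw [h01, sub_zero]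
    have h1 : inner ℝ (e 0) r = 0 := by
      rw [hr, inner_sub_right, inner_sub_right, real_inner_smul_right, real_inner_smul_right, h01,
        hself, e3]
      field_simp
      ring
    have h2 : inner ℝ (e 1) r = 0 := by
      rw [hr, inner_sub_right, inner_sub_right, real_inner_smul_right, real_inner_smul_right, h10,
        hself, hval 0 x]
      change inner ℝ (e 1) (x - Q 0) - _ - inner ℝ (e 1) (x - Q 0) / a ^ 2 * a ^ 2 = 0
      field_simp
      ring
    have hne : innerₛₗ ℝ (e 0) ≠ 0 := fun h0 => by
      have h3 := LinearMap.congr_fun h0 (e 0)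
      rw [innerₛₗ_apply_apply, hself] at h3
      exact ha2.ne' h3
    obtain ⟨t, ht⟩ := exists_eq_smul hne (he0 1) h01 h1
    have ht0 : t = 0 := by
      rw [ht, real_inner_smul_right, hself] at h2
      rcases mul_eq_zero.1 h2 with h | h
      · exact h
      · exact absurd h ha2.ne'
    rw [ht0, zero_smul] at ht
    rw [← sub_eq_zero, ← ht, hr]
    abel
  have hhull : convexHull ℝ (Set.range Q.vertices) = {x | ∀ i, 0 ≤ ℓ i x} := by
    apply subset_antisymm
    · refine convexHull_min ?_ ?_
      · rintro _ ⟨v, rfl⟩ i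
        exact hnonneg i v
      · intro x hx y hy s t hs ht hst i
        have h1 := Convex.combo_affine_apply (f := ℓ i) (x := x) (y := y) hst
        rw [h1]
        have := mul_nonneg hs (hx i)
        have := mul_nonneg ht (hy i)
        simp only [smul_eq_mul]
        linarith
    · intro x hx
      have hc := convex_convexHull ℝ (Set.range Q.vertices)
      have hm : ∀ v, Q v ∈ convexHull ℝ (Set.range Q.vertices) := fun v =>
        subset_convexHull ℝ _ (Set.mem_range_self v)
      have s1 : ℓ 3 x = a ^ 2 - ℓ 1 x := hadd 1 x
      have s2 : ℓ 2 x = a ^ 2 - ℓ 0 x := hadd 0 x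
      have x0 : 0 ≤ ℓ 3 x / a ^ 2 := div_nonneg (hx 3) ha2.le
      have x1 : 0 ≤ 1 - ℓ 3 x / a ^ 2 := by
        have := hx 1
        rw [sub_nonneg, div_le_one ha2]
        linarith
      have y0 : 0 ≤ ℓ 0 x / a ^ 2 := div_nonneg (hx 0) ha2.le
      have y1 : 0 ≤ 1 - ℓ 0 x / a ^ 2 := by
        have := hx 2
        rw [s2] at this
        rw [sub_nonneg, div_le_one ha2]
        linarith
      have h1 := hc (hc (hm 0) (hm 1) x1 x0 (by ring)) (hc (hm 3) (hm 2) x1 x0 (by ring)) y1 y0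
        (by ring)
      have q1 : Q 1 = Q 0 + e 0 := hsucc 0
      have q2 : Q 2 = Q 0 + e 0 + e 1 := hQ2 0
      have q3 : Q 3 = Q 0 + e 1 := hQ3 0
      rw [q1, q2, q3] at h1
      convert h1 using 1
      nth_rewrite 1 [hcoord x]
      module
  refine ⟨ℓ, v0, v1, fun i => ?_, fun i h0 => ?_, ?_, ?_, fun A => ?_, fun F hF => ?_,
    fun i A => ?_⟩
  · rw [hedge]
    exact he0 i
  · have h1 := hlin i (e (i + 1))
    rw [h0, hself] at h1
    exact ha2.ne h1
  · rw [table, hhull]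
    apply subset_antisymm
    · intro x hx i
      rw [mem_interior_iff_mem_nhds] at hx
      have hc : Tendsto (fun ε : ℝ => x - ε • e (i + 1)) (𝓝[>] 0) (𝓝 x) := by
        have : Continuous fun ε : ℝ => x - ε • e (i + 1) := by fun_prop
        simpa using (this.tendsto 0).mono_left nhdsWithin_le_nhds
      obtain ⟨ε, h1, h2⟩ := ((hc.eventually hx).and self_mem_nhdsWithin).exists
      have h3 := h1 i
      rw [sub_eq_add_neg, affine_add, map_neg, map_smul, hlin, hself, smul_eq_mul] at h3
      have := mul_pos (Set.mem_Ioi.1 h2) ha2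
      linarith
    · refine interior_maximal (fun x hx i => (hx i).le) ?_
      simp only [Set.ofPred_forall]
      refine isOpen_iInter_of_finite fun i => isOpen_lt continuous_const ?_
      exact AffineMap.continuous_of_finiteDimensional _
  · intro i x hx j hj
    obtain ⟨s, hs, hs', rfl⟩ := mem_openSide.1 hx
    have h1 := apply_succ (Q := Q) (ℓ j) i
    rw [affine_add, map_smul, smul_eq_mul]
    rcases fin4_eq_or j i with rfl | rfl | rfl | rfl
    · exact absurd rfl hj
    · rw [fin4_add_one_add_one, v1, v2] at h1
      rw [v1]
      nlinarith
    · rw [fin4_add_two_add_one, v2, v3] at h1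
      rw [v2]
      nlinarith
    · rw [fin4_add_three_add_one, v3, v0] at h1
      rw [v3]
      nlinarith
  · change A (Q 0) + A (Q 2) = A (Q 1) + A (Q 3)
    have q1 : Q 1 = Q 0 + e 0 := hsucc 0
    have q2 : Q 2 = Q 0 + e 0 + e 1 := hQ2 0
    have q3 : Q 3 = Q 0 + e 1 := hQ3 0
    rw [q1, q2, q3]
    simp only [affine_add]
    ring
  · have hF' : F 0 + F 2 = F 1 + F 3 := hF
    refine ⟨AffineMap.const ℝ _ (F 0) + ((F 1 - F 0) / a ^ 2) • ℓ 3 + ((F 3 - F 0) / a ^ 2) • ℓ 0,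
      funext fun v => ?_⟩
    simp only [vertexValues, AffineMap.coe_add, AffineMap.coe_smul, AffineMap.coe_const,
      Function.const_apply, Pi.add_apply, Pi.smul_apply, smul_eq_mul]
    have e0 : ℓ 3 (Q 0) = 0 := v1 3
    have e1 : ℓ 3 (Q 1) = a ^ 2 := v2 3
    have e2 : ℓ 3 (Q 2) = a ^ 2 := v3 3
    have e3 : ℓ 3 (Q 3) = 0 := v0 3
    have f0 : ℓ 0 (Q 0) = 0 := v0 0
    have f1 : ℓ 0 (Q 1) = 0 := v1 0
    have f2 : ℓ 0 (Q 2) = a ^ 2 := v2 0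
    have f3 : ℓ 0 (Q 3) = a ^ 2 := v3 0
    match v with
    | 0 => rw [e0, f0]; ring
    | 1 => rw [e1, f1]; field_simp; ring
    | 2 => rw [e2, f2]; field_simp; linarith
    | 3 => rw [e3, f3]; field_simp; ring
  · have hR : (Submodule.span ℝ {edgeVector Q i}).reflection (e (i + 1)) = -e (i + 1) := by
      rw [Submodule.reflection_singleton_apply, hedge, horth]
      simp
    funext v
    rcases fin4_eq_or i v with rfl | rfl | rfl | rfl
    · rw [square.refl_left]
      simp [vertexValues, sideReflection_apply]
    · rw [square.refl_right]
      simp only [vertexValues, AffineMap.comp_apply, sideReflection_apply]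
      rw [← edgeVector_eq, reflection_edgeVector, hedge, hsucc]
    · rw [square_refl, if_pos rfl]
      simp only [vertexValues, AffineMap.comp_apply, sideReflection_apply]
      have h1 : Q (i + 2) - Q i = edgeVector Q i + e (i + 1) := by rw [hQ2, hedge]; abel
      have h2 := (Submodule.span ℝ {edgeVector Q i}).reflection.map_add (edgeVector Q i) (e (i + 1))
      rw [h1, h2, reflection_edgeVector, hR, hQ2, hsucc, hedge]
      simp only [affine_add, map_add, map_neg]
      ring
    · rw [square_refl, if_neg (fin4_add_three_ne_add_two i), if_pos rfl]
      simp only [vertexValues, AffineMap.comp_apply, sideReflection_apply]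
      rw [hQ3, add_sub_cancel_left, hR]
      simp only [affine_add, map_neg]
      ring

end square
end PolygonalBilliard

theorem theorem2 :
    (∀ Q : Polygon PolygonalBilliard.Plane 4, PolygonalBilliard.IsSquareTable Q →
      Tendsto (fun n : ℕ => (PolygonalBilliard.complexity Q n : ℝ) / (n : ℝ) ^ 3) atTop
        (𝓝 (4 / Real.pi ^ 2))) ∧
    (∀ Q : Polygon PolygonalBilliard.Plane 3, PolygonalBilliard.IsRightIsoscelesTable Q →
      Tendsto (fun n : ℕ => (PolygonalBilliard.complexity Q n : ℝ) / (n : ℝ) ^ 3) atTop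
        (𝓝 (2 / (3 * Real.pi ^ 2)))) ∧
    (∀ Q : Polygon PolygonalBilliard.Plane 3, PolygonalBilliard.IsEquilateralTable Q →
      Tendsto (fun n : ℕ => (PolygonalBilliard.complexity Q n : ℝ) / (n : ℝ) ^ 3) atTop
        (𝓝 (3 / (4 * Real.pi ^ 2)))) := by
  refine ⟨fun Q hQ => ?_, fun Q hQ => ?_, fun Q hQ => ?_⟩
  · obtain ⟨ℓ, h⟩ := PolygonalBilliard.exists_realises_square hQ
    exact h.tendsto_complexity PolygonalBilliard.UnfoldingModel.tendsto_words_square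
  · obtain ⟨o, ℓ, h⟩ := PolygonalBilliard.exists_realises_rightIsosceles hQ
    exact h.tendsto_complexity (PolygonalBilliard.UnfoldingModel.tendsto_words_rightIsosceles o)
  · obtain ⟨ℓ, h⟩ := PolygonalBilliard.exists_realises_equilateral hQ
    exact h.tendsto_complexity PolygonalBilliard.UnfoldingModel.tendsto_words_equilateral
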